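/- Units $G=c=1$; $\Lambda\in\mathbb R$; an overdot is $\partial_t$; comoving coordinates are $\boldsymbol\xi=(\varsigma,\varkappa,\xi)$. **Backgrounds.** Let $k_0\in\{0,1,-1\}$, $\mu>0$, $T\in\mathbb R$, and let $L$ be an open interval of times starting at $T$. A background with parameters $(\mu,k_0,T)$ is a smooth $S:L\to(0,\infty)$ with $\dot S^2=-k_0+2\mu/S+\tfrac{\Lambda}{3}S^2$ and $S\to0$ as $t\to T^+$. Put $H=\dot S/S$ and $4\pi\varrho_b=3\mu/S^3$. A density mode is a solution of $\ddot{\mathcal F}+2H\dot{\mathcal F}-\tfrac{3\mu}{S^3}\mathcal F=0$. The growing mode $f_+$ is the density mode that equals $\tfrac{\dot S}{S}\int_0^S(-k_0+2\mu/\hat s+\tfrac\Lambda3\hat s^2)^{-3/2}d\hat s$ during the initial expansion; the decaying mode is $f_-=\dot S/S$. **Szekeres models (Goode–Wainwright form).** The metric is $$ds^2=-dt^2+S^2\big(\mathcal G^2\mathcal W^2d\xi^2+e^{2\nu}(d\varsigma^2+d\varkappa^2)\big),\qquad \mathcal G=\mathcal A-\mathcal F,\quad \mathcal F=\beta_+f_++\beta_-f_-,$$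 with density $8\pi\varrho=6\mu\mathcal A/(S^3\mathcal G)$; the free functions are smooth. *Class II:* $\mu,T$ are constants, $S,f_\pm$ depend on $t$ only, $\mathcal W=1$, $e^\nu=[1+\frac{k_0}4(\varsigma^2+\varkappa^2)]^{-1}$, $c_0,c_1,c_2,\beta_\pm$ are arbitrary functions of $\xi$, and $\mathcal A=e^\nu[c_0(1-\frac{k_0}4(\varsigma^2+\varkappa^2))+c_1\varsigma+c_2\varkappa]-k_0\beta_+$ if $k_0=\pm1$, $\mathcal A=c_0+c_1\varsigma+c_2\varkappa-\frac12\beta_+(\varsigma^2+\varkappa^2)$ if $k_0=0$. *Class I:* $\mu,T,f,c_0,\dots,c_3$ are functions of $\xi$; for each $\xi$, $S(\cdot,\xi)$ is a background with parameters $(\mu(\xi),k_0,T(\xi))$ and $f_\pm(\cdot,\xi)$ are its modes, $S$ being smooth in $(t,\xi)$; $e^\nu=f/[c_0(\varsigma^2+\varkappa^2)+2c_1\varsigma+2c_2\varkappa+c_3]$, $c_0c_3-c_1^2-c_2^2=\epsilon/4$ with $\epsilon\in\{0,1,-1\}$, $\mathcal W^2=(\epsilon-k_0f^2)^{-1}$,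 $\beta_+=-k_0f\mu_{,\xi}/(3\mu)$, $\beta_-=fT_{,\xi}$, $\mathcal A=f\nu_{,\xi}-k_0\beta_+$; if $k_0=0$ the parameter $\mu$ is normalized so that $\mu_{,\xi}=0$. An event is regular if all functions are defined there, $e^\nu>0$, $\mathcal G\ne0$ and (class I) $\epsilon-k_0f^2>0$. For a label $\boldsymbol\xi$ and an initial time $t_i$ with $(t_i,\boldsymbol\xi)$ regular, consider times $t$ such that the world line is regular between $t_i$ and $t$. Its deformation field $P^a{}_i(t)$ has the single non-zero component $P=P^3{}_3=-(\mathcal F-\mathcal F(t_i))/(\mathcal A-\mathcal F(t_i))$, and $\mathfrak J=1+P$, $J=S^3\mathfrak J$. **Exact body.** The world line is a solution of the exact body of RZA on the background $S$ if, with $\eta^a{}_i=S(\delta^a_i+P^a{}_i)$ and Gram matrix $S(t_i)^2G_{ab}=g_{ab}(t_i)$: $g_{ij}=G_{ab}\eta^a{}_i\eta^b{}_j$; $G_{ab}\dot\eta^a{}_{[i}\eta^b{}_{j]}=0$; $P^a{}_i(t_i)=0$; the initial velocity $\dot P^a{}_i(t_i)$ and the acceleration $W^a{}_i=\ddot P^a{}_i(t_i)+2H(t_i)\dot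 P^a{}_i(t_i)$ are symmetric with respect to $G$; the second and third principal scalar invariants of $P^a{}_i$ and of the peculiar-expansion tensor $\Theta^i{}_j-H\delta^i_j$ vanish; $\det\eta=\sqrt g/\sqrt G=J$; and $\ddot P+2H\dot P-4\pi\varrho_bP=(S/S(t_i))^{-3}W$, with $W=W^a{}_a$. The *exact-body functionals* are $$\varrho=\varrho(t_i)\frac{J(t_i)}{J},\quad \Theta=3H+\frac{\dot P}{\mathfrak J},\quad \Theta^i{}_j=\mathrm{Diag}\Big[H,H,H+\frac{\dot P}{\mathfrak J}\Big],\quad \sigma^i{}_j=\frac1{\mathfrak J}\big(\dot P^i{}_j-\tfrac13\dot P\delta^i_j\big),$$ $$E^i{}_j=\frac{2H\dot P+\ddot P}{3\mathfrak J}\,\mathrm{Diag}[1,1,-2],\quad H^i{}_j=0,\quad X=\frac{3H\dot P+\ddot P}{\mathfrak J},$$ $$\mathcal R^i{}_j=\frac{2k_0}{S^2}\delta^i_j-X\,\mathrm{Diag}[1,1,2],\quad \mathcal R=\frac{6k_0}{S^2}-4X,\quad \tau^i{}_j=\frac X3\mathrm{Diag}[1,1,-2],$$ where $\varrho$, the expansion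 scalar $\Theta$ and tensor $\Theta^i{}_j$, the shear $\sigma$, the gravitoelectric and gravitomagnetic parts $E,H^i{}_j$ of the Weyl tensor, the spatial Ricci tensor $\mathcal R^i{}_j$, its trace $\mathcal R$ and its trace-free part $\tau$ are the *local quantities*, computed from the metric and $\varrho$. **Statement.** (0) Every class II model solves, at its regular events, Einstein's equations with cosmological constant $\Lambda$ for dust of density $\varrho$ and four-velocity $\partial_t$; each of its world lines is a solution of the exact body on the global background $S$; and its local quantities are given by the exact-body functionals. For every class I model: (1) (Constrained superposition) At all regular events the metric solves Einstein's equations with cosmological constant $\Lambda$ for dust of density $\varrho$ and four-velocity $\partial_t$; in particular the energy constraint $\mathcal R+\Theta^2-\Theta^i{}_j\Theta^j{}_i=16\pi\varrho+2\Lambda$ and the momentum constraint $\nabla_i\Theta^i{}_j=\partial_j\Theta$ hold on every slice of constant $t$. The world lines $\boldsymbol\xi=\mathrm{const}$ do not intersect: exactly one of them passes through each regular event; and they are unit-speed timelike geodesics. (2) Each world line $\boldsymbol\xi$ is a solution of the exact body on its own local background $S(\cdot,\xi)$, with parameters $(\mu(\xi),k_0,T(\xi))$, and $f_\pm(\cdot,\xi)$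 are density modes of that local background. Moreover there are a class II model with exactly this background (same $k_0$, $\mu=\mu(\xi)$, $T=T(\xi)$, $S=S(\cdot,\xi)$, $f_\pm=f_\pm(\cdot,\xi)$) and a world line of it with the same $\beta_\pm$, $\mathcal A$, $\mathcal F$, the same regular times, the same deformation field, and the same local quantities. (3) Consequently, along each class I world line all local quantities are given by the same exact-body functionals as in class II, with the global scale factor replaced by $S(\cdot,\xi)$. -/

import Mathlib

open Set Filter Topology
open scoped ContDiff

noncomputable section

namespace Szekeres

/-! ### Curvature in coordinates -/

/-- Partial derivative in the `i`-th coordinate. -/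
def pd {n : ℕ} (i : Fin n) (φ : (Fin n → ℝ) → ℝ) (x : Fin n → ℝ) : ℝ :=
  deriv (fun s => φ (Function.update x i s)) (x i)

/-- Christoffel symbols `Γ^k_{ij}` of a (pseudo-)Riemannian metric. -/
def christoffel {n : ℕ} (g : (Fin n → ℝ) → Matrix (Fin n) (Fin n) ℝ) (k i j : Fin n)
    (x : Fin n → ℝ) : ℝ :=
  (1 / 2) * ∑ l, (g x)⁻¹ k l *
    (pd i (fun y => g y j l) x + pd j (fun y => g y i l) x - pd l (fun y => g y i j) x)

/-- Riemann tensor `R^k_{lij}`. -/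
def riemann {n : ℕ} (g : (Fin n → ℝ) → Matrix (Fin n) (Fin n) ℝ) (k l i j : Fin n)
    (x : Fin n → ℝ) : ℝ :=
  pd i (christoffel g k j l) x - pd j (christoffel g k i l) x
    + ∑ m, (christoffel g k i m x * christoffel g m j l x
      - christoffel g k j m x * christoffel g m i l x)

/-- Ricci tensor `R_{ij}`. -/
def ricci {n : ℕ} (g : (Fin n → ℝ) → Matrix (Fin n) (Fin n) ℝ) (i j : Fin n)
    (x : Fin n → ℝ) : ℝ :=
  ∑ k, riemann g k i k j x

/-- Scalar curvature. -/
def scalarCurvature {n : ℕ} (g : (Fin n → ℝ) → Matrix (Fin n) (Fin n) ℝ) (x : Fin n → ℝ) : ℝ :=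
  ∑ i, ∑ j, (g x)⁻¹ i j * ricci g i j x

/-- Einstein tensor `R_{ij} - (1/2) R g_{ij}`. -/
def einsteinTensor {n : ℕ} (g : (Fin n → ℝ) → Matrix (Fin n) (Fin n) ℝ) (i j : Fin n)
    (x : Fin n → ℝ) : ℝ :=
  ricci g i j x - (1 / 2) * scalarCurvature g x * g x i j

/-- The Weyl tensor `C_{klij}` of a four-dimensional metric. -/
def weyl (g : (Fin 4 → ℝ) → Matrix (Fin 4) (Fin 4) ℝ) (k l i j : Fin 4) (x : Fin 4 → ℝ) : ℝ :=
  (∑ m, g x k m * riemann g m l i j x)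
    - (1 / 2) * (g x k i * ricci g l j x - g x k j * ricci g l i x
        - g x l i * ricci g k j x + g x l j * ricci g k i x)
    + scalarCurvature g x / 6 * (g x k i * g x l j - g x k j * g x l i)

/-- The geodesic equation for a curve, at the parameter value `t`. -/
def IsGeodesicAt {n : ℕ} (g : (Fin n → ℝ) → Matrix (Fin n) (Fin n) ℝ) (γ : ℝ → Fin n → ℝ)
    (t : ℝ) : Prop :=
  ∀ a, deriv (deriv (fun s => γ s a)) t
    + ∑ b, ∑ c, christoffel g a b c (γ t) * deriv (fun s => γ s b) t * deriv (fun s => γ s c) t = 0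

/-! ### Comoving synchronous spacetimes and their local quantities -/

/-- A time-dependent spatial metric `h_{ij}(t, x)` in comoving coordinates. -/
abbrev SpatialMetric := ℝ → (Fin 3 → ℝ) → Matrix (Fin 3) (Fin 3) ℝ

/-- The spacetime metric `-dt² + h_{ij} dx^i dx^j`; the coordinate `0` is the time. -/
def spacetimeMetric (h : SpatialMetric) (p : Fin 4 → ℝ) : Matrix (Fin 4) (Fin 4) ℝ :=
  Matrix.of (Fin.cons (Fin.cons (-1) (fun _ => 0))
    (fun i => Fin.cons 0 (fun j => h (p 0) (Fin.tail p) i j)))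

/-- The fluid world line with comoving label `x`. -/
def worldLineCurve (x : Fin 3 → ℝ) (t : ℝ) : Fin 4 → ℝ := Fin.cons t x

/-- The four-velocity of the comoving dust, `∂_t`. -/
def fourVelocity (a : Fin 4) : ℝ := if a = 0 then 1 else 0

/-- The expansion tensor `Θ^i_j = (1/2) h^{ik} ∂_t h_{kj}`. -/
def expansionTensor (h : SpatialMetric) (t : ℝ) (x : Fin 3 → ℝ) : Matrix (Fin 3) (Fin 3) ℝ :=
  (h t x)⁻¹ * Matrix.of (fun i j => (1 / 2) * deriv (fun s => h s x i j) t)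

/-- The mixed Ricci tensor `𝓡^i_j` of the spatial metric at time `t`. -/
def spatialRicci (h : SpatialMetric) (t : ℝ) (x : Fin 3 → ℝ) : Matrix (Fin 3) (Fin 3) ℝ :=
  (h t x)⁻¹ * Matrix.of (fun i j => ricci (h t) i j x)

/-- Gravitoelectric part `E^i_j` of the Weyl tensor, where `E_{ij} = C_{iajb} u^a u^b`. -/
def gravitoelectric (h : SpatialMetric) (t : ℝ) (x : Fin 3 → ℝ) : Matrix (Fin 3) (Fin 3) ℝ :=
  (h t x)⁻¹ * Matrix.of
    (fun i j => weyl (spacetimeMetric h) i.succ 0 j.succ 0 (Fin.cons t x))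

/-- The permutation symbol. -/
def permSymbol (i j k : Fin 3) : ℝ :=
  (((j : ℕ) : ℝ) - ((i : ℕ) : ℝ)) * (((k : ℕ) : ℝ) - ((j : ℕ) : ℝ))
    * (((k : ℕ) : ℝ) - ((i : ℕ) : ℝ)) / 2

/-- Gravitomagnetic part `H^i_j` of the Weyl tensor, where
`H_{ij} = (1/2) ε_{ikl} C^{kl}_{ja} u^a`. -/
def gravitomagnetic (h : SpatialMetric) (t : ℝ) (x : Fin 3 → ℝ) : Matrix (Fin 3) (Fin 3) ℝ :=
  (h t x)⁻¹ * Matrix.of (fun i j =>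
    (1 / 2) * ∑ k, ∑ l, √(h t x).det * permSymbol i k l *
      ∑ m, ∑ n, (h t x)⁻¹ k m * (h t x)⁻¹ l n *
        weyl (spacetimeMetric h) m.succ n.succ j.succ 0 (Fin.cons t x))

/-- The local quantities attached to a point of a fluid world line. -/
@[ext]
structure LocalQuantities where
  /-- energy density `ϱ` -/
  density : ℝ
  /-- expansion scalar `Θ` -/
  expansion : ℝ
  /-- expansion tensor `Θ^i_j` -/
  expansionTensor : Matrix (Fin 3) (Fin 3) ℝ
  /-- shear tensor `σ^i_j` -/
  shear : Matrix (Fin 3) (Fin 3) ℝ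
  /-- gravitoelectric part of the Weyl tensor `E^i_j` -/
  gravitoelectric : Matrix (Fin 3) (Fin 3) ℝ
  /-- gravitomagnetic part of the Weyl tensor `H^i_j` -/
  gravitomagnetic : Matrix (Fin 3) (Fin 3) ℝ
  /-- spatial Ricci tensor `𝓡^i_j` -/
  spatialRicci : Matrix (Fin 3) (Fin 3) ℝ
  /-- spatial scalar curvature `𝓡` -/
  spatialScalar : ℝ
  /-- trace-free part of the spatial Ricci tensor `τ^i_j` -/
  traceFreeRicci : Matrix (Fin 3) (Fin 3) ℝ

/-- The local quantities, computed from the metric (and the density field). -/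
def localQuantities (h : SpatialMetric) (ρ : ℝ → (Fin 3 → ℝ) → ℝ) (t : ℝ) (x : Fin 3 → ℝ) :
    LocalQuantities where
  density := ρ t x
  expansion := (expansionTensor h t x).trace
  expansionTensor := expansionTensor h t x
  shear := expansionTensor h t x - ((1 / 3) * (expansionTensor h t x).trace) • 1
  gravitoelectric := gravitoelectric h t x
  gravitomagnetic := gravitomagnetic h t x
  spatialRicci := spatialRicci h t x
  spatialScalar := scalarCurvature (h t) x
  traceFreeRicci := spatialRicci h t x - ((1 / 3) * scalarCurvature (h t) x) • 1

/-- Einstein's equations for dust of density `ρ` and four-velocity `∂_t`, at one event, together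
with the energy and momentum constraints on the slice of constant time through it. -/
structure IsDustSolutionAt (Λ : ℝ) (h : SpatialMetric) (ρ : ℝ → (Fin 3 → ℝ) → ℝ)
    (t : ℝ) (x : Fin 3 → ℝ) : Prop where
  einstein : ∀ a b : Fin 4,
    einsteinTensor (spacetimeMetric h) a b (Fin.cons t x)
        + Λ * spacetimeMetric h (Fin.cons t x) a b
      = 8 * Real.pi * ρ t x * (∑ c, spacetimeMetric h (Fin.cons t x) a c * fourVelocity c)
          * (∑ c, spacetimeMetric h (Fin.cons t x) b c * fourVelocity c)
  energy : scalarCurvature (h t) x + (expansionTensor h t x).trace ^ 2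
      - (expansionTensor h t x * expansionTensor h t x).trace = 16 * Real.pi * ρ t x + 2 * Λ
  momentum : ∀ j : Fin 3,
    ∑ i, (pd i (fun y => expansionTensor h t y i j) x
        + ∑ m, (christoffel (h t) i i m x * expansionTensor h t x m j
          - christoffel (h t) m i j x * expansionTensor h t x i m))
      = pd j (fun y => (expansionTensor h t y).trace) x

/-! ### Local backgrounds and their density modes -/

/-- `S` is the scale factor, on the time interval `L`, of a Friedmann dust background with curvature
constant `k₀`, cosmological constant `Λ`, mass parameter `μ` and bang time `T`. -/
structure IsBackground (Λ k₀ μ T : ℝ) (L : Set ℝ) (S : ℝ → ℝ) : Prop where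
  mu_pos : 0 < μ
  isOpen : IsOpen L
  bang_lt : ∀ t ∈ L, T < t
  past : ∀ t ∈ L, Ioc T t ⊆ L
  smooth : ContDiffOn ℝ ∞ S L
  pos : ∀ t ∈ L, 0 < S t
  friedmann : ∀ t ∈ L, deriv S t ^ 2 = -k₀ + 2 * μ / S t + Λ / 3 * S t ^ 2
  bang : Tendsto S (𝓝[>] T) (𝓝 0)

/-- The Hubble function of a scale factor. -/
def hubble (S : ℝ → ℝ) (t : ℝ) : ℝ := deriv S t / S t

/-- The background density, `4 π ϱ_b = 3 μ / S³`. -/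
def backgroundDensity (μ : ℝ) (S : ℝ → ℝ) (t : ℝ) : ℝ := 3 * μ / (4 * Real.pi * S t ^ 3)

/-- `F` solves the equation of the linear density modes on the background `S`. -/
def IsDensityMode (μ : ℝ) (L : Set ℝ) (S F : ℝ → ℝ) : Prop :=
  ContDiffOn ℝ 2 F L ∧
    ∀ t ∈ L, deriv (deriv F) t + 2 * hubble S t * deriv F t - 3 * μ / S t ^ 3 * F t = 0

/-- `F` is the growing mode: the solution of the mode equation that equals
`(Ṡ / S) ∫_0^S ŝ'^{-3} dŝ` during the initial expansion, with
`ŝ'² = -k₀ + 2 μ / ŝ + Λ ŝ² / 3`. -/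
def IsGrowingMode (Λ k₀ μ T : ℝ) (L : Set ℝ) (S F : ℝ → ℝ) : Prop :=
  IsDensityMode μ L S F ∧
    ∀ t ∈ L, (∀ s ∈ Ioc T t, 0 < deriv S s) →
      F t = hubble S t *
        ∫ s in (0 : ℝ)..S t, (√(-k₀ + 2 * μ / s + Λ / 3 * s ^ 2) ^ 3)⁻¹

/-! ### The exact body of the relativistic Zel'dovich approximation -/

/-- Second principal scalar invariant of a matrix. -/
def secondInvariant (A : Matrix (Fin 3) (Fin 3) ℝ) : ℝ := (A.trace ^ 2 - (A * A).trace) / 2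

/-- Coframe coefficients `η^a_i = S (δ^a_i + P^a_i)` along a world line. -/
def coframe (S : ℝ → ℝ) (P : ℝ → Matrix (Fin 3) (Fin 3) ℝ) (t : ℝ) : Matrix (Fin 3) (Fin 3) ℝ :=
  S t • (1 + P t)

/-- Entrywise time derivative. -/
def matrixDeriv (A : ℝ → Matrix (Fin 3) (Fin 3) ℝ) (t : ℝ) : Matrix (Fin 3) (Fin 3) ℝ :=
  Matrix.of (fun i j => deriv (fun s => A s i j) t)

/-- Gram's matrix, the initial spatial metric up to the initial scale factor:
`S(tᵢ)² G_{ab} = h_{ab}(tᵢ)`. -/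
def gram (h : SpatialMetric) (S : ℝ → ℝ) (tᵢ : ℝ) (x : Fin 3 → ℝ) : Matrix (Fin 3) (Fin 3) ℝ :=
  (S tᵢ ^ 2)⁻¹ • h tᵢ x

/-- The trace `P = P^k_k` of a deformation field. -/
def deformationTrace (P : ℝ → Matrix (Fin 3) (Fin 3) ℝ) (t : ℝ) : ℝ := (P t).trace

/-- The initial acceleration `W = P̈(tᵢ) + 2 H(tᵢ) Ṗ(tᵢ)` of a deformation field. -/
def initialAcceleration (S : ℝ → ℝ) (P : ℝ → Matrix (Fin 3) (Fin 3) ℝ) (tᵢ : ℝ) :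
    Matrix (Fin 3) (Fin 3) ℝ :=
  matrixDeriv (matrixDeriv P) tᵢ + (2 * hubble S tᵢ) • matrixDeriv P tᵢ

/-- The world line `x` of the comoving spacetime with spatial metric `h` is, for the times in `J`, a
solution of the exact body of the relativistic Zel'dovich approximation on the background `S` with
parameters `μ`, `k₀`, `Λ`, `T`, with deformation field `P` and initial time `tᵢ`. -/
structure IsExactBodyLine (Λ k₀ μ T : ℝ) (L : Set ℝ) (S : ℝ → ℝ) (h : SpatialMetric)
    (x : Fin 3 → ℝ) (tᵢ : ℝ) (P : ℝ → Matrix (Fin 3) (Fin 3) ℝ) (J : Set ℝ) : Prop where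
  background : IsBackground Λ k₀ μ T L S
  subset : J ⊆ L
  metric : ∀ t ∈ J, h t x = (coframe S P t).transpose * gram h S tᵢ x * coframe S P t
  symmetry : ∀ t ∈ J,
    ((matrixDeriv (coframe S P) t).transpose * gram h S tᵢ x * coframe S P t).IsSymm
  initial : P tᵢ = 0
  velocity_symm : (gram h S tᵢ x * matrixDeriv P tᵢ).IsSymm
  acceleration_symm : (gram h S tᵢ x * initialAcceleration S P tᵢ).IsSymm
  second_invariant : ∀ t ∈ J, secondInvariant (P t) = 0
  third_invariant : ∀ t ∈ J, (P t).det = 0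
  jacobian : ∀ t ∈ J, (coframe S P t).det = S t ^ 3 * (1 + deformationTrace P t) ∧
    √(h t x).det / √(gram h S tᵢ x).det = S t ^ 3 * (1 + deformationTrace P t)
  raychaudhuri : ∀ t ∈ J,
    deriv (deriv (deformationTrace P)) t + 2 * hubble S t * deriv (deformationTrace P) t
        - 4 * Real.pi * backgroundDensity μ S t * deformationTrace P t
      = (S t / S tᵢ)⁻¹ ^ 3 * (initialAcceleration S P tᵢ).trace
  peculiar_second : ∀ t ∈ J, secondInvariant (expansionTensor h t x - hubble S t • 1) = 0
  peculiar_third : ∀ t ∈ J, (expansionTensor h t x - hubble S t • 1).det = 0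

/-- The functional expressions of the exact body: the local quantities at time `t` as functionals
of the background scale factor `S`, its curvature constant `k₀`, the deformation field `P` and the
initial density `ρᵢ`; `J = S³ (1 + P)` and `𝔍 = 1 + P`. -/
def exactBodyFunctionals (k₀ : ℝ) (S : ℝ → ℝ) (P : ℝ → Matrix (Fin 3) (Fin 3) ℝ) (ρᵢ tᵢ t : ℝ) :
    LocalQuantities :=
  let p := deformationTrace P
  let J : ℝ → ℝ := fun s => S s ^ 3 * (1 + p s)
  let 𝔍 := 1 + p t
  let H := hubble S t
  let X := (3 * H * deriv p t + deriv (deriv p) t) / 𝔍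
  let D : Matrix (Fin 3) (Fin 3) ℝ := Matrix.diagonal ![1, 1, -2]
  { density := ρᵢ * (J t / J tᵢ)⁻¹
    expansion := 3 * H + deriv p t / 𝔍
    expansionTensor := Matrix.diagonal ![H, H, H + deriv p t / 𝔍]
    shear := 𝔍⁻¹ • (matrixDeriv P t - ((1 / 3) * deriv p t) • 1)
    gravitoelectric := ((2 * H * deriv p t + deriv (deriv p) t) / (3 * 𝔍)) • D
    gravitomagnetic := 0
    spatialRicci := Matrix.diagonal
      ![2 * k₀ / S t ^ 2 - X, 2 * k₀ / S t ^ 2 - X, 2 * k₀ / S t ^ 2 - 2 * X]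
    spatialScalar := 6 * k₀ / S t ^ 2 - 4 * X
    traceFreeRicci := (X / 3) • D }

/-! ### The Szekeres models in the Goode-Wainwright parametrization

The spatial coordinates are `x 0 = ς`, `x 1 = ϰ`, `x 2 = ξ`. -/

/-- The spatial metric `S² (𝓖² 𝓦² dξ² + e^{2ν} (dς² + dϰ²))`. -/
def gwMetric (S 𝓖 𝓦 eν : ℝ) : Matrix (Fin 3) (Fin 3) ℝ :=
  Matrix.diagonal ![S ^ 2 * eν ^ 2, S ^ 2 * eν ^ 2, S ^ 2 * 𝓖 ^ 2 * 𝓦 ^ 2]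

/-- The deformation field `P`, whose only nonvanishing component is
`P^3_3 = -(𝓕 - 𝓕(tᵢ)) / (𝓐 - 𝓕(tᵢ))`. -/
def gwDeformation (𝓐 : ℝ) (𝓕 : ℝ → ℝ) (tᵢ t : ℝ) : Matrix (Fin 3) (Fin 3) ℝ :=
  Matrix.diagonal ![0, 0, -(𝓕 t - 𝓕 tᵢ) / (𝓐 - 𝓕 tᵢ)]

/-- A Szekeres model of class II. -/
structure ClassII (Λ : ℝ) where
  k₀ : ℝ
  μ : ℝ
  /-- bang time -/
  T : ℝ
  /-- range of the time coordinate -/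
  L : Set ℝ
  /-- range of the coordinate `ξ` -/
  X : Set ℝ
  S : ℝ → ℝ
  fPlus : ℝ → ℝ
  c₀ : ℝ → ℝ
  c₁ : ℝ → ℝ
  c₂ : ℝ → ℝ
  βPlus : ℝ → ℝ
  βMinus : ℝ → ℝ
  k₀_mem : k₀ = 0 ∨ k₀ = 1 ∨ k₀ = -1
  background : IsBackground Λ k₀ μ T L S
  growing : IsGrowingMode Λ k₀ μ T L S fPlus
  X_open : IsOpen X
  c₀_smooth : ContDiffOn ℝ ∞ c₀ X
  c₁_smooth : ContDiffOn ℝ ∞ c₁ X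
  c₂_smooth : ContDiffOn ℝ ∞ c₂ X
  βPlus_smooth : ContDiffOn ℝ ∞ βPlus X
  βMinus_smooth : ContDiffOn ℝ ∞ βMinus X

namespace ClassII

variable {Λ : ℝ} (M : ClassII Λ)

/-- The decaying mode `Ṡ / S`. -/
def fMinus (t : ℝ) : ℝ := hubble M.S t

/-- `e^ν = [1 + (k₀/4) (ς² + ϰ²)]⁻¹` -/
def expNu (x : Fin 3 → ℝ) : ℝ := (1 + M.k₀ / 4 * (x 0 ^ 2 + x 1 ^ 2))⁻¹

open Classical in
/-- The time-independent part `𝓐` of the metric function `𝓖`. -/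
def 𝓐 (x : Fin 3 → ℝ) : ℝ :=
  if M.k₀ = 0 then
    M.c₀ (x 2) + M.c₁ (x 2) * x 0 + M.c₂ (x 2) * x 1 - M.βPlus (x 2) * (x 0 ^ 2 + x 1 ^ 2) / 2
  else
    M.expNu x * (M.c₀ (x 2) * (1 - M.k₀ / 4 * (x 0 ^ 2 + x 1 ^ 2)) + M.c₁ (x 2) * x 0
      + M.c₂ (x 2) * x 1) - M.k₀ * M.βPlus (x 2)

/-- The time-dependent part `𝓕 = β₊ f₊ + β₋ f₋`. -/
def 𝓕 (x : Fin 3 → ℝ) (t : ℝ) : ℝ := M.βPlus (x 2) * M.fPlus t + M.βMinus (x 2) * M.fMinus t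

/-- `𝓖 = 𝓐 - 𝓕` -/
def 𝓖 (t : ℝ) (x : Fin 3 → ℝ) : ℝ := M.𝓐 x - M.𝓕 x t

/-- The spatial metric. -/
def metric : SpatialMetric := fun t x => gwMetric (M.S t) (M.𝓖 t x) 1 (M.expNu x)

/-- The energy density, `8 π ϱ = 6 μ 𝓐 / (S³ 𝓖)`. -/
def density (t : ℝ) (x : Fin 3 → ℝ) : ℝ :=
  6 * M.μ * M.𝓐 x / (M.S t ^ 3 * M.𝓖 t x) / (8 * Real.pi)

/-- The regular events of the model. -/
def Regular (t : ℝ) (x : Fin 3 → ℝ) : Prop :=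
  t ∈ M.L ∧ x 2 ∈ M.X ∧ 0 < M.expNu x ∧ M.𝓖 t x ≠ 0

/-- The times `t` for which the part of the world line `x` between `tᵢ` and `t` is regular. -/
def worldLine (tᵢ : ℝ) (x : Fin 3 → ℝ) : Set ℝ := {t | ∀ s ∈ uIcc tᵢ t, M.Regular s x}

/-- The deformation field along the world line `x`, with initial time `tᵢ`. -/
def deformation (tᵢ : ℝ) (x : Fin 3 → ℝ) : ℝ → Matrix (Fin 3) (Fin 3) ℝ :=
  gwDeformation (M.𝓐 x) (M.𝓕 x) tᵢ

end ClassII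

/-- A Szekeres model of class I. -/
structure ClassI (Λ : ℝ) where
  k₀ : ℝ
  ε : ℝ
  /-- range of the coordinates `(t, ξ)` -/
  Ω : Set (ℝ × ℝ)
  μ : ℝ → ℝ
  /-- bang time -/
  T : ℝ → ℝ
  f : ℝ → ℝ
  c₀ : ℝ → ℝ
  c₁ : ℝ → ℝ
  c₂ : ℝ → ℝ
  c₃ : ℝ → ℝ
  /-- `S t ξ` -/
  S : ℝ → ℝ → ℝ
  /-- `fPlus t ξ` -/
  fPlus : ℝ → ℝ → ℝ
  k₀_mem : k₀ = 0 ∨ k₀ = 1 ∨ k₀ = -1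
  ε_mem : ε = 0 ∨ ε = 1 ∨ ε = -1
  Ω_open : IsOpen Ω
  μ_smooth : ContDiffOn ℝ ∞ μ (Prod.snd '' Ω)
  T_smooth : ContDiffOn ℝ ∞ T (Prod.snd '' Ω)
  f_smooth : ContDiffOn ℝ ∞ f (Prod.snd '' Ω)
  c₀_smooth : ContDiffOn ℝ ∞ c₀ (Prod.snd '' Ω)
  c₁_smooth : ContDiffOn ℝ ∞ c₁ (Prod.snd '' Ω)
  c₂_smooth : ContDiffOn ℝ ∞ c₂ (Prod.snd '' Ω)
  c₃_smooth : ContDiffOn ℝ ∞ c₃ (Prod.snd '' Ω)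
  S_smooth : ContDiffOn ℝ ∞ (fun q : ℝ × ℝ => S q.1 q.2) Ω
  background : ∀ ξ ∈ Prod.snd '' Ω,
    IsBackground Λ k₀ (μ ξ) (T ξ) {t | (t, ξ) ∈ Ω} (fun t => S t ξ)
  growing : ∀ ξ ∈ Prod.snd '' Ω,
    IsGrowingMode Λ k₀ (μ ξ) (T ξ) {t | (t, ξ) ∈ Ω} (fun t => S t ξ) (fun t => fPlus t ξ)
  c_rel : ∀ ξ ∈ Prod.snd '' Ω, c₀ ξ * c₃ ξ - c₁ ξ ^ 2 - c₂ ξ ^ 2 = ε / 4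
  /-- For `k₀ = 0` the mass parameter is normalized to be constant. -/
  μ_flat : k₀ = 0 → ∀ ξ ∈ Prod.snd '' Ω, deriv μ ξ = 0

namespace ClassI

variable {Λ : ℝ} (M : ClassI Λ)

/-- The life span of the world lines with the label `ξ`. -/
def lifeSpan (ξ : ℝ) : Set ℝ := {t | (t, ξ) ∈ M.Ω}

/-- The decaying mode `Ṡ / S`. -/
def fMinus (t ξ : ℝ) : ℝ := hubble (fun s => M.S s ξ) t

/-- `e^ν = f / [c₀ (ς² + ϰ²) + 2 c₁ ς + 2 c₂ ϰ + c₃]` -/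
def expNu (x : Fin 3 → ℝ) : ℝ :=
  M.f (x 2) / (M.c₀ (x 2) * (x 0 ^ 2 + x 1 ^ 2) + 2 * M.c₁ (x 2) * x 0 + 2 * M.c₂ (x 2) * x 1
    + M.c₃ (x 2))

/-- `β₊ = -k₀ f μ_{,ξ} / (3 μ)` -/
def βPlus (ξ : ℝ) : ℝ := -M.k₀ * M.f ξ * deriv M.μ ξ / (3 * M.μ ξ)

/-- `β₋ = f T_{,ξ}` -/
def βMinus (ξ : ℝ) : ℝ := M.f ξ * deriv M.T ξ

/-- `𝓦 = (ε - k₀ f²)^{-1/2}` -/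
def 𝓦 (ξ : ℝ) : ℝ := (√(M.ε - M.k₀ * M.f ξ ^ 2))⁻¹

/-- The time-independent part `𝓐 = f ν_{,ξ} - k₀ β₊` of the metric function `𝓖`. -/
def 𝓐 (x : Fin 3 → ℝ) : ℝ :=
  M.f (x 2) * pd 2 (fun y => Real.log (M.expNu y)) x - M.k₀ * M.βPlus (x 2)

/-- The time-dependent part `𝓕 = β₊ f₊ + β₋ f₋`. -/
def 𝓕 (x : Fin 3 → ℝ) (t : ℝ) : ℝ :=
  M.βPlus (x 2) * M.fPlus t (x 2) + M.βMinus (x 2) * M.fMinus t (x 2)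

/-- `𝓖 = 𝓐 - 𝓕` -/
def 𝓖 (t : ℝ) (x : Fin 3 → ℝ) : ℝ := M.𝓐 x - M.𝓕 x t

/-- The spatial metric. -/
def metric : SpatialMetric := fun t x =>
  gwMetric (M.S t (x 2)) (M.𝓖 t x) (M.𝓦 (x 2)) (M.expNu x)

/-- The energy density, `8 π ϱ = 6 μ 𝓐 / (S³ 𝓖)`. -/
def density (t : ℝ) (x : Fin 3 → ℝ) : ℝ :=
  6 * M.μ (x 2) * M.𝓐 x / (M.S t (x 2) ^ 3 * M.𝓖 t x) / (8 * Real.pi)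

/-- The regular events of the model. -/
def Regular (t : ℝ) (x : Fin 3 → ℝ) : Prop :=
  (t, x 2) ∈ M.Ω ∧ 0 < M.expNu x ∧ 0 < M.ε - M.k₀ * M.f (x 2) ^ 2 ∧ M.𝓖 t x ≠ 0

/-- The times `t` for which the part of the world line `x` between `tᵢ` and `t` is regular. -/
def worldLine (tᵢ : ℝ) (x : Fin 3 → ℝ) : Set ℝ := {t | ∀ s ∈ uIcc tᵢ t, M.Regular s x}

/-- The deformation field along the world line `x`, with initial time `tᵢ`. -/
def deformation (tᵢ : ℝ) (x : Fin 3 → ℝ) : ℝ → Matrix (Fin 3) (Fin 3) ℝ :=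
  gwDeformation (M.𝓐 x) (M.𝓕 x) tᵢ

end ClassI

end Szekeres

end

/-! In both classes the metric is `-dt² + A² (dx² + dy²) + B² dz²` with `A = S e^ν` and `B = S 𝓖 𝓦`.
The curvature of such a diagonal metric is a rational expression in the 2-jets of `A` and `B`.
`SzekeresJet` lists pointwise relations between these jets under which this expression collapses:
Ricci tensor, Weyl parts, slice curvature and expansion depend only on `H`, `s = S̈/S`, `γ₁ = 𝓖̇/𝓖`,
`γ₂ = 𝓖̈/𝓖` and `k = k₀/S²`. What remains is ordinary differential equations along one world line,
and the class of the model no longer matters. The Friedmann equations and the mode equation of `𝓕`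
give the dust equations (`IsSzekeresAt.isDustSolutionAt_of_mode`). Rewriting `γ₁, γ₂` through the
deformation field gives the exact-body functionals (`IsSzekeresAt.localQuantities_eq_functionals`).

The jet relations have to be proved for each class. In class II, `𝓐` is a quotient of quadratic
forms in `ς, ϰ`. The curvature relations for the planes containing the `ξ` direction reduce to the
fact that `β₊` occurs both in `𝓐` and as the conserved Wronskian of the decaying mode with `𝓕`
(`ClassII.wronskian_𝓕`).

In class I the decisive fact is `ClassI.𝓕_eq`: the superposition `β₊ f₊ + β₋ f₋` equals `-(k₀ β₊ + f
S_{,ξ}/S)`. Hence `S 𝓖 = S f ν_{,ξ} + f S_{,ξ}`, so that `𝓖` is `f` times the label derivative of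
`log (S e^ν)` and `B` is proportional to `A_{,ξ}`. The jet relations then follow from commuting
derivatives, from the Friedmann equations with their label derivatives, and from `c₀ c₃ - c₁² - c₂²
= ε/4` with its label derivative.

To prove `𝓕_eq`, observe that both sides are density modes of the local background: on the right,
differentiate the second Friedmann equation in `ξ`. A mode vanishing near one instant vanishes
throughout, so it suffices to compare them early. During the initial expansion the age of the
background is `t - T = ∫₀^S √s / √N ds` with `N = 2 μ - k₀ s + Λ s³/3`. Differentiating in `ξ`
yields `S_{,ξ}` in terms of `T_{,ξ}` and `μ_{,ξ} ∫ s^{1/2} N^{-3/2}`, and an integration by parts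
turns the latter into the integral that defines the growing mode.

The exact-body property is algebra: the deformation has one nonzero entry, so its second and third
invariants vanish, and that entry is affine in `𝓕`, so it solves the linear Raychaudhuri equation
with the stated source. The class II partner of a class I world line is the model with constant free
functions whose world line at the origin has the prescribed `𝓐` and `β_±`; its local quantities
agree because both are the same functionals of the same data. -/

namespace Szekeres

/-! ### Calculus of coordinate derivatives -/

/-- `φ` has the partial derivative `φ'` in the `i`-th coordinate at `x`. -/
def HasPd {n : ℕ} (i : Fin n) (φ : (Fin n → ℝ) → ℝ) (φ' : ℝ) (x : Fin n → ℝ) : Prop :=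
  HasDerivAt (fun s => φ (Function.update x i s)) φ' (x i)

section pd

variable {n : ℕ} {i : Fin n} {φ ψ : (Fin n → ℝ) → ℝ} {φ' ψ' : ℝ} {x : Fin n → ℝ}

theorem HasPd.pd_eq (h : HasPd i φ φ' x) : pd i φ x = φ' := HasDerivAt.deriv h

theorem hasPd_const (c : ℝ) : HasPd i (fun _ => c) 0 x := hasDerivAt_const _ _

theorem HasPd.congr (h : HasPd i φ φ' x) (e : φ' = ψ') : HasPd i φ ψ' x := e ▸ h

theorem HasPd.add (h : HasPd i φ φ' x) (k : HasPd i ψ ψ' x) :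
    HasPd i (fun y => φ y + ψ y) (φ' + ψ') x := HasDerivAt.add h k

theorem HasPd.sub (h : HasPd i φ φ' x) (k : HasPd i ψ ψ' x) :
    HasPd i (fun y => φ y - ψ y) (φ' - ψ') x := HasDerivAt.sub h k

theorem HasPd.mul (h : HasPd i φ φ' x) (k : HasPd i ψ ψ' x) :
    HasPd i (fun y => φ y * ψ y) (φ' * ψ x + φ x * ψ') x := by
  have := HasDerivAt.mul h k
  simp only [Function.update_eq_self] at this
  exact this

theorem HasPd.const_mul (c : ℝ) (h : HasPd i φ φ' x) : HasPd i (fun y => c * φ y) (c * φ') x :=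
  HasDerivAt.const_mul c h

theorem HasPd.div (h : HasPd i φ φ' x) (k : HasPd i ψ ψ' x) (h0 : ψ x ≠ 0) :
    HasPd i (fun y => φ y / ψ y) ((φ' * ψ x - φ x * ψ') / ψ x ^ 2) x := by
  have := HasDerivAt.div h k (by simpa [Function.update_eq_self] using h0)
  simp only [Function.update_eq_self] at this
  exact this

theorem HasPd.pow (h : HasPd i φ φ' x) (m : ℕ) :
    HasPd i (fun y => φ y ^ m) (m * φ x ^ (m - 1) * φ') x := by
  have := HasDerivAt.pow h m
  simp only [Function.update_eq_self] at this
  exact this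

theorem hasPd_coord {g : ℝ → ℝ} {g' : ℝ} (k : Fin n) (h : HasDerivAt g g' (x k)) :
    HasPd i (fun y => g (y k)) (if i = k then g' else 0) x := by
  rcases eq_or_ne i k with rfl | hik
  · simpa [HasPd] using h
  · simpa [HasPd, hik, Function.update_of_ne hik.symm] using hasDerivAt_const (x i) (g (x k))

theorem tendsto_update (i : Fin n) (x : Fin n → ℝ) :
    Tendsto (fun s => Function.update x i s) (𝓝 (x i)) (𝓝 x) := by
  have : Continuous (fun s => Function.update x i s) := continuous_const.update i continuous_id
  simpa using this.tendsto (x i)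

theorem pd_congr (h : φ =ᶠ[𝓝 x] ψ) : pd i φ x = pd i ψ x :=
  Filter.EventuallyEq.deriv_eq ((tendsto_update i x).eventually h)

theorem HasPd.congr_of_eventuallyEq (h : HasPd i ψ φ' x) (e : φ =ᶠ[𝓝 x] ψ) : HasPd i φ φ' x :=
  HasDerivAt.congr_of_eventuallyEq h ((tendsto_update i x).eventually e)

theorem hasPd_of_differentiableAt (i : Fin n) (h : DifferentiableAt ℝ φ x) :
    HasPd i φ (fderiv ℝ φ x (Pi.single i 1)) x := by
  have h1 : HasFDerivAt φ (fderiv ℝ φ x) (Function.update x i (x i)) := by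
    simpa using h.hasFDerivAt
  exact h1.comp_hasDerivAt (x i) (hasDerivAt_update x i (x i))

theorem pd_eq_fderiv (i : Fin n) (h : DifferentiableAt ℝ φ x) :
    pd i φ x = fderiv ℝ φ x (Pi.single i 1) := (hasPd_of_differentiableAt i h).pd_eq

theorem hasPd_pd (i : Fin n) (h : DifferentiableAt ℝ φ x) : HasPd i φ (pd i φ x) x :=
  (hasPd_of_differentiableAt i h).congr (pd_eq_fderiv i h).symm

theorem eventually_differentiableAt (h : ContDiffAt ℝ 2 φ x) :
    ∀ᶠ y in 𝓝 x, DifferentiableAt ℝ φ y :=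
  (h.eventually (by simp)).mono fun _ hy => hy.differentiableAt (by norm_num)

theorem eventuallyEq_pd_fderiv (i : Fin n) (h : ContDiffAt ℝ 2 φ x) :
    pd i φ =ᶠ[𝓝 x] fun y => fderiv ℝ φ y (Pi.single i 1) :=
  (eventually_differentiableAt h).mono fun _ hy => pd_eq_fderiv i hy

theorem contDiffAt_pd (i : Fin n) (h : ContDiffAt ℝ 2 φ x) : ContDiffAt ℝ 1 (pd i φ) x := by
  have h1 : ContDiffAt ℝ 1 (fderiv ℝ φ) x := h.fderiv_right (by norm_num)
  exact (h1.clm_apply contDiffAt_const).congr_of_eventuallyEq (eventuallyEq_pd_fderiv i h)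

/-- Both iterated partial derivatives are values of the second Fréchet derivative on basis vectors,
which is symmetric for a `C²` function. -/
theorem pd_comm (i j : Fin n) (h : ContDiffAt ℝ 2 φ x) :
    pd i (pd j φ) x = pd j (pd i φ) x := by
  have h1 : DifferentiableAt ℝ (fderiv ℝ φ) x :=
    (h.fderiv_right (m := 1) (by norm_num)).differentiableAt (by norm_num)
  have key : ∀ i j : Fin n, pd i (pd j φ) x
      = fderiv ℝ (fderiv ℝ φ) x (Pi.single i 1) (Pi.single j 1) := by
    intro i j
    rw [pd_congr (eventuallyEq_pd_fderiv j h),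
      pd_eq_fderiv i (h1.clm_apply (differentiableAt_const _)),
      fderiv_clm_apply h1 (differentiableAt_const _)]
    simp
  rw [key, key]
  exact (h.isSymmSndFDerivAt (by simp)).eq _ _

end pd

/-! ### Curvature of diagonal metrics -/

section diagonal

variable {n : ℕ}

/-- Christoffel symbols of the metric `∑ₖ sₖ Lₖ² dxₖ²`. -/
noncomputable def diagChristoffel (s ℓ : Fin n → ℝ) (d : Fin n → Fin n → ℝ) (k i j : Fin n) : ℝ :=
  (if j = k then d k i / ℓ k else 0) + (if i = k then d k j / ℓ k else 0)
    - (if i = j then s i / s k * (ℓ i * d i k / ℓ k ^ 2) else 0)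

/-- Derivatives of the Christoffel symbols of the metric `∑ₖ sₖ Lₖ² dxₖ²`. -/
noncomputable def diagChristoffelDeriv (s ℓ : Fin n → ℝ) (d : Fin n → Fin n → ℝ)
    (dd : Fin n → Fin n → Fin n → ℝ) (p k i j : Fin n) : ℝ :=
  (if j = k then (dd k p i * ℓ k - d k i * d k p) / ℓ k ^ 2 else 0)
    + (if i = k then (dd k p j * ℓ k - d k j * d k p) / ℓ k ^ 2 else 0)
    - (if i = j then s i / s k * (((d i p * d i k + ℓ i * dd i p k) * ℓ k ^ 2
        - ℓ i * d i k * (2 * ℓ k * d k p)) / (ℓ k ^ 2) ^ 2) else 0)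

/-- Riemann tensor of the metric `∑ₖ sₖ Lₖ² dxₖ²`. -/
noncomputable def diagRiemann (s ℓ : Fin n → ℝ) (d : Fin n → Fin n → ℝ)
    (dd : Fin n → Fin n → Fin n → ℝ) (k l i j : Fin n) : ℝ :=
  diagChristoffelDeriv s ℓ d dd i k j l - diagChristoffelDeriv s ℓ d dd j k i l
    + ∑ m, (diagChristoffel s ℓ d k i m * diagChristoffel s ℓ d m j l
      - diagChristoffel s ℓ d k j m * diagChristoffel s ℓ d m i l)

variable {g : (Fin n → ℝ) → Matrix (Fin n) (Fin n) ℝ} {s : Fin n → ℝ}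
  {L : Fin n → (Fin n → ℝ) → ℝ} {x : Fin n → ℝ}

/-- The constants `s k` carry the signature, so the same formula serves the Lorentzian spacetime and
the Riemannian slices. -/
theorem christoffel_diagonal (hg : g =ᶠ[𝓝 x] fun y => Matrix.diagonal fun k => s k * L k y ^ 2)
    (hs : ∀ k, s k ≠ 0) (hL : ∀ k, DifferentiableAt ℝ (L k) x) (h0 : ∀ k, L k x ≠ 0)
    (k i j : Fin n) :
    christoffel g k i j x
      = diagChristoffel s (fun k => L k x) (fun k i => pd i (L k) x) k i j := by
  have hne : ∀ k, s k * L k x ^ 2 ≠ 0 := fun k => mul_ne_zero (hs k) (pow_ne_zero 2 (h0 k))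
  have hinv : (g x)⁻¹ = Matrix.diagonal fun k => (s k * L k x ^ 2)⁻¹ := by
    rw [hg.eq_of_nhds]
    refine Matrix.inv_eq_left_inv ?_
    rw [Matrix.diagonal_mul_diagonal, ← Matrix.diagonal_one]
    congr 1
    funext k
    exact inv_mul_cancel₀ (hne k)
  have hpd : ∀ i a b, pd i (fun y => g y a b) x
      = if a = b then s b * (2 * L b x * pd i (L b) x) else 0 := by
    intro i a b
    have e : (fun y => g y a b) =ᶠ[𝓝 x] fun y => if a = b then s b * L b y ^ 2 else 0 := by
      filter_upwards [hg] with y hy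
      rw [hy]
      by_cases hab : a = b <;> simp [hab]
    rw [pd_congr e]
    by_cases hab : a = b
    · simp only [hab, if_true]
      exact (((hasPd_pd i (hL b)).pow 2).const_mul (s b)).pd_eq.trans (by norm_num)
    · simp only [hab, if_false]
      exact (hasPd_const 0).pd_eq
  unfold christoffel diagChristoffel
  simp only [hinv, hpd]
  rw [Finset.sum_eq_single k]
  · rw [Matrix.diagonal_apply_eq]
    have h1 := h0 k
    have h2 := hs k
    have e3 : (if i = j then s j * (2 * L j x * pd k (L j) x) else 0)
        = if i = j then s i * (2 * L i x * pd k (L i) x) else 0 := by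
      split_ifs with h
      · rw [h]
      · rfl
    rw [e3]
    split_ifs <;> field_simp <;> ring
  · intro b _ hb
    rw [Matrix.diagonal_apply_ne _ hb.symm, zero_mul]
  · simp

/-- The hypotheses of `christoffel_diagonal` are open conditions once the `L k` are `C²`, so its
formula holds near `x` and may be differentiated there. -/
theorem riemann_diagonal (hg : g =ᶠ[𝓝 x] fun y => Matrix.diagonal fun k => s k * L k y ^ 2)
    (hs : ∀ k, s k ≠ 0) (hL : ∀ k, ContDiffAt ℝ 2 (L k) x) (h0 : ∀ k, L k x ≠ 0)
    (k l i j : Fin n) :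
    riemann g k l i j x
      = diagRiemann s (fun k => L k x) (fun k i => pd i (L k) x)
          (fun k p i => pd p (pd i (L k)) x) k l i j := by
  have hd : ∀ k, DifferentiableAt ℝ (L k) x := fun k => (hL k).differentiableAt (by norm_num)
  have hdd : ∀ k i, DifferentiableAt ℝ (pd i (L k)) x := fun k i =>
    (contDiffAt_pd i (hL k)).differentiableAt (by norm_num)
  have hev : ∀ k i j, christoffel g k i j =ᶠ[𝓝 x]
      fun y => diagChristoffel s (fun k => L k y) (fun k i => pd i (L k) y) k i j := by
    intro k i j
    have h1 : ∀ᶠ y in 𝓝 x, ∀ k, DifferentiableAt ℝ (L k) y :=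
      eventually_all.2 fun k => eventually_differentiableAt (hL k)
    have h2 : ∀ᶠ y in 𝓝 x, ∀ k, L k y ≠ 0 :=
      eventually_all.2 fun k => (hL k).continuousAt.eventually_ne (h0 k)
    filter_upwards [eventually_eventually_nhds.2 hg, h1, h2] with y hy1 hy2 hy3
    exact christoffel_diagonal hy1 hs hy2 hy3 k i j
  have hpd : ∀ p k i j, pd p (christoffel g k i j) x
      = diagChristoffelDeriv s (fun k => L k x) (fun k i => pd i (L k) x)
          (fun k p i => pd p (pd i (L k)) x) p k i j := by
    intro p k i j
    rw [pd_congr (hev k i j)]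
    have a1 : ∀ i k, HasPd p (fun y => pd i (L k) y / L k y)
        ((pd p (pd i (L k)) x * L k x - pd i (L k) x * pd p (L k) x) / L k x ^ 2) x := fun i k =>
      (hasPd_pd p (hdd k i)).div (hasPd_pd p (hd k)) (h0 k)
    have a2 := (((hasPd_pd p (hd i)).mul (hasPd_pd p (hdd i k))).div
      ((hasPd_pd p (hd k)).pow 2) (pow_ne_zero 2 (h0 k))).const_mul (s i / s k)
    have b : ∀ (P : Prop) [Decidable P] (φ : (Fin n → ℝ) → ℝ) (φ' : ℝ), HasPd p φ φ' x →
        HasPd p (fun y => if P then φ y else 0) (if P then φ' else 0) x := by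
      intro P _ φ φ' h
      split_ifs
      · exact h
      · exact hasPd_const 0
    refine ((((b (j = k) _ _ (a1 i k)).add (b (i = k) _ _ (a1 j k))).sub
      (b (i = j) _ _ a2)).congr ?_).pd_eq
    simp [diagChristoffelDeriv]
  unfold riemann diagRiemann
  simp only [hpd, (hev _ _ _).eq_of_nhds]

end diagonal

end Szekeres

namespace Szekeres

/-! ### Algebra of the curvature of `-dt² + a² (dx² + dy²) + b² dz²` -/

/-- Pointwise relations between the first and second derivatives of the metric coefficients
of `-dt² + a² (dx² + dy²) + b² dz²` that characterize a Szekeres dust spacetime. -/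
structure SzekeresJet (a b : ℝ) (da db : Fin 4 → ℝ) (dda ddb : Fin 4 → Fin 4 → ℝ)
    (H s γ₁ γ₂ k : ℝ) : Prop where
  a_ne : a ≠ 0
  b_ne : b ≠ 0
  dda_symm : ∀ i j, dda i j = dda j i
  ddb_symm : ∀ i j, ddb i j = ddb j i
  a_t : da 0 = H * a
  b_t : db 0 = (H + γ₁) * b
  a_tt : dda 0 0 = s * a
  b_tt : ddb 0 0 = (s + 2 * H * γ₁ + γ₂) * b
  a_tx : dda 0 1 = H * da 1
  a_ty : dda 0 2 = H * da 2
  a_tz : dda 0 3 = (H + γ₁) * da 3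
  b_tx : ddb 0 1 = H * db 1
  b_ty : ddb 0 2 = H * db 2
  b_xy : ddb 1 2 = (db 1 * da 2 + db 2 * da 1) / a
  a_xz : dda 1 3 = da 1 * da 3 / a + da 3 * db 1 / b
  a_yz : dda 2 3 = da 2 * da 3 / a + da 3 * db 2 / b
  k_xy : dda 2 2 = -dda 1 1 + (da 1 ^ 2 + da 2 ^ 2) / a - da 3 ^ 2 * a / b ^ 2 - k * a ^ 3
  k_xz : ddb 1 1 = (da 1 * db 1 - da 2 * db 2) / a - (dda 3 3 - da 3 * db 3 / b) * a / b
    - (k - (3 * H * γ₁ + γ₂)) * a ^ 2 * b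
  k_yz : ddb 2 2 = (da 2 * db 2 - da 1 * db 1) / a - (dda 3 3 - da 3 * db 3 / b) * a / b
    - (k - (3 * H * γ₁ + γ₂)) * a ^ 2 * b

section jets

variable {a b : ℝ} {da db : Fin 4 → ℝ} {dda ddb : Fin 4 → Fin 4 → ℝ} {H s γ₁ γ₂ k : ℝ}

/-- The Riemann tensor of `-dt² + a² (dx² + dy²) + b² dz²`. -/
noncomputable def riemannST (a b : ℝ) (da db : Fin 4 → ℝ) (dda ddb : Fin 4 → Fin 4 → ℝ) :
    Fin 4 → Fin 4 → Fin 4 → Fin 4 → ℝ :=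
  diagRiemann ![-1, 1, 1, 1] ![1, a, a, b] ![0, da, da, db] ![0, dda, dda, ddb]

-- The relations `k_xy`, `k_xz`, `k_yz` fix the sectional curvatures of the slice as `k`, `k - X`,
-- `k - X` with `X = 3 H γ₁ + γ₂`. The mixed spatial relations remove the off-diagonal spatial
-- components, and the mixed time relations remove the time-space components. After substitution
-- every entry is an identity of rational functions.
set_option maxHeartbeats 4000000 in
theorem SzekeresJet.ricci (h : SzekeresJet a b da db dda ddb H s γ₁ γ₂ k) (i j : Fin 4) :
    ∑ m, riemannST a b da db dda ddb m i m j = Matrix.diagonal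
      ![-(3 * s + 2 * H * γ₁ + γ₂),
        a ^ 2 * (s + 2 * k + 2 * H ^ 2 - 2 * H * γ₁ - γ₂),
        a ^ 2 * (s + 2 * k + 2 * H ^ 2 - 2 * H * γ₁ - γ₂),
        b ^ 2 * (s + 2 * k + 2 * H ^ 2 - 2 * H * γ₁ - γ₂)] i j := by
  have ha := h.a_ne
  have hb := h.b_ne
  fin_cases i <;> fin_cases j <;>
  simp [riemannST, diagRiemann, diagChristoffel, diagChristoffelDeriv, Fin.sum_univ_four,
    h.a_t, h.b_t, h.a_tt, h.b_tt, h.a_tx, h.a_ty, h.a_tz, h.b_tx, h.b_ty, h.b_xy, h.a_xz, h.a_yz,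
    h.k_xy, h.k_xz, h.k_yz, h.dda_symm 1 0, h.dda_symm 2 0, h.dda_symm 3 0, h.dda_symm 2 1,
    h.dda_symm 3 1, h.dda_symm 3 2, h.ddb_symm 1 0, h.ddb_symm 2 0, h.ddb_symm 3 0,
    h.ddb_symm 2 1, h.ddb_symm 3 1, h.ddb_symm 3 2] <;>
  (try field_simp) <;> (try ring)

-- These are tidal components with the first index raised, so no factors `a²`, `b²` occur: the
-- diagonal entries are `-ä/a` and `-b̈/b`.
set_option maxHeartbeats 4000000 in
theorem SzekeresJet.electric (h : SzekeresJet a b da db dda ddb H s γ₁ γ₂ k) (i j : Fin 3) :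
    riemannST a b da db dda ddb i.succ 0 j.succ 0
      = Matrix.diagonal ![-s, -s, -(s + 2 * H * γ₁ + γ₂)] i j := by
  have ha := h.a_ne
  have hb := h.b_ne
  fin_cases i <;> fin_cases j <;>
  simp [riemannST, diagRiemann, diagChristoffel, diagChristoffelDeriv, Fin.sum_univ_four,
    h.a_t, h.b_t, h.a_tt, h.b_tt, h.b_xy, h.a_xz, h.a_yz,
    h.k_xy, h.k_xz, h.k_yz, h.dda_symm 2 1,
    h.dda_symm 3 1, h.dda_symm 3 2,
    h.ddb_symm 2 1, h.ddb_symm 3 1, h.ddb_symm 3 2] <;>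
  (try field_simp) <;> (try ring)

-- By the Codazzi equation these components are antisymmetrized covariant derivatives of the
-- expansion tensor; the relations from `a_tx` to `b_ty` make them vanish.
set_option maxHeartbeats 4000000 in
theorem SzekeresJet.magnetic (h : SzekeresJet a b da db dda ddb H s γ₁ γ₂ k) (m l j : Fin 3) :
    riemannST a b da db dda ddb m.succ l.succ j.succ 0 = 0 := by
  have ha := h.a_ne
  have hb := h.b_ne
  fin_cases m <;> fin_cases l <;> fin_cases j <;>
  simp [riemannST, diagRiemann, diagChristoffel, diagChristoffelDeriv, Fin.sum_univ_four,
    h.a_t, h.b_t, h.a_tx, h.a_ty, h.a_tz, h.b_tx, h.b_ty,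
    h.dda_symm 1 0, h.dda_symm 2 0, h.dda_symm 3 0,
    h.ddb_symm 1 0, h.ddb_symm 2 0, h.ddb_symm 3 0] <;>
  (try field_simp) <;> (try ring)

set_option maxHeartbeats 4000000 in
theorem SzekeresJet.spatialRicci (h : SzekeresJet a b da db dda ddb H s γ₁ γ₂ k) (i j : Fin 3) :
    ∑ m, diagRiemann ![1, 1, 1] ![a, a, b]
        (fun n i => ![da, da, db] n i.succ) (fun n p i => ![dda, dda, ddb] n p.succ i.succ) m i m j
      = Matrix.diagonal
        ![a ^ 2 * (2 * k - (3 * H * γ₁ + γ₂)), a ^ 2 * (2 * k - (3 * H * γ₁ + γ₂)),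
          b ^ 2 * (2 * k - 2 * (3 * H * γ₁ + γ₂))] i j := by
  have ha := h.a_ne
  have hb := h.b_ne
  fin_cases i <;> fin_cases j <;>
  simp [diagRiemann, diagChristoffel, diagChristoffelDeriv, Fin.sum_univ_three,
    h.b_xy, h.a_xz, h.a_yz,
    h.k_xy, h.k_xz, h.k_yz, h.dda_symm 2 1,
    h.dda_symm 3 1, h.dda_symm 3 2,
    h.ddb_symm 2 1, h.ddb_symm 3 1, h.ddb_symm 3 2] <;>
  (try field_simp) <;> (try ring)

-- The traced Codazzi equation. The first diagonal matrix holds the spatial derivatives of the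
-- expansion rates `Ȧ/A, Ȧ/A, Ḃ/B`, expressed through jets.
set_option maxHeartbeats 4000000 in
theorem SzekeresJet.momentum (h : SzekeresJet a b da db dda ddb H s γ₁ γ₂ k) (j : Fin 3) :
    ∑ i, (Matrix.diagonal ![(dda i.succ 0 * a - da 0 * da i.succ) / a ^ 2,
            (dda i.succ 0 * a - da 0 * da i.succ) / a ^ 2,
            (ddb i.succ 0 * b - db 0 * db i.succ) / b ^ 2] i j
        + ∑ m, (diagChristoffel ![1, 1, 1] ![a, a, b] (fun n i => ![da, da, db] n i.succ) i i m
            * Matrix.diagonal ![H, H, H + γ₁] m j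
          - diagChristoffel ![1, 1, 1] ![a, a, b] (fun n i => ![da, da, db] n i.succ) m i j
            * Matrix.diagonal ![H, H, H + γ₁] i m))
      = (dda j.succ 0 * a - da 0 * da j.succ) / a ^ 2
        + (dda j.succ 0 * a - da 0 * da j.succ) / a ^ 2
        + (ddb j.succ 0 * b - db 0 * db j.succ) / b ^ 2 := by
  have ha := h.a_ne
  have hb := h.b_ne
  fin_cases j <;>
  simp [diagChristoffel, Fin.sum_univ_three,
    h.a_t, h.b_t, h.a_tx, h.a_ty, h.a_tz, h.b_tx, h.b_ty,
    h.dda_symm 1 0, h.dda_symm 2 0, h.dda_symm 3 0,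
    h.ddb_symm 1 0, h.ddb_symm 2 0, h.ddb_symm 3 0] <;>
  (try field_simp) <;> (try ring)

end jets
end Szekeres

namespace Szekeres

/-! ### From the jets of the metric coefficients to the local quantities -/

theorem cons_apply_three (t : ℝ) (x : Fin 3 → ℝ) : (Fin.cons t x : Fin 4 → ℝ) 3 = x 2 := rfl

theorem contDiff_cons {n : WithTop ℕ∞} (t : ℝ) :
    ContDiff ℝ n (fun y : Fin 3 → ℝ => (Fin.cons t y : Fin 4 → ℝ)) := by
  refine contDiff_pi.2 fun i => ?_
  refine Fin.cases ?_ (fun j => ?_) i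
  · exact contDiff_const
  · exact contDiff_apply ℝ ℝ j

theorem pd_zero_cons (φ : (Fin 4 → ℝ) → ℝ) (t : ℝ) (x : Fin 3 → ℝ) :
    pd 0 φ (Fin.cons t x) = deriv (fun s => φ (Fin.cons s x)) t := by
  simp [pd]

theorem pd_succ_cons (φ : (Fin 4 → ℝ) → ℝ) (t : ℝ) (x : Fin 3 → ℝ) (i : Fin 3) :
    pd i (fun y => φ (Fin.cons t y)) x = pd i.succ φ (Fin.cons t x) := by
  simp [pd, Fin.cons_update]

theorem pd_pd_succ_cons (φ : (Fin 4 → ℝ) → ℝ) (t : ℝ) (x : Fin 3 → ℝ) (i j : Fin 3) :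
    pd i (pd j (fun y => φ (Fin.cons t y))) x = pd i.succ (pd j.succ φ) (Fin.cons t x) := by
  rw [← pd_succ_cons]
  congr 1
  funext y
  exact pd_succ_cons φ t y j

section core

variable {h : SpatialMetric} {A B : (Fin 4 → ℝ) → ℝ} {t : ℝ} {x : Fin 3 → ℝ}

theorem spacetimeMetric_eq_diagonal
    (hh : ∀ᶠ q in 𝓝 (Fin.cons t x : Fin 4 → ℝ),
      h (q 0) (Fin.tail q) = Matrix.diagonal ![A q ^ 2, A q ^ 2, B q ^ 2]) :
    spacetimeMetric h =ᶠ[𝓝 (Fin.cons t x : Fin 4 → ℝ)] fun q => Matrix.diagonal fun k =>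
      (![-1, 1, 1, 1] : Fin 4 → ℝ) k * (![fun _ => 1, A, A, B] : Fin 4 → _) k q ^ 2 := by
  filter_upwards [hh] with q hq
  ext i j
  refine Fin.cases ?_ (fun i => ?_) i <;> refine Fin.cases ?_ (fun j => ?_) j
  · simp [spacetimeMetric]
  · simp [spacetimeMetric, Matrix.diagonal]
    exact fun h => absurd h (Fin.succ_ne_zero j).symm
  · simp [spacetimeMetric, Matrix.diagonal]
  · simp only [spacetimeMetric, Matrix.of_apply, Fin.cons_succ, hq]
    fin_cases i <;> fin_cases j <;> simp [Matrix.diagonal]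

theorem spatialMetric_eventually
    (hh : ∀ᶠ q in 𝓝 (Fin.cons t x : Fin 4 → ℝ),
      h (q 0) (Fin.tail q) = Matrix.diagonal ![A q ^ 2, A q ^ 2, B q ^ 2]) :
    h t =ᶠ[𝓝 x] fun y => Matrix.diagonal fun k => (![1, 1, 1] : Fin 3 → ℝ) k *
      (fun y => (![A, A, B] : Fin 3 → _) k (Fin.cons t y)) y ^ 2 := by
  have hc : Tendsto (fun y : Fin 3 → ℝ => (Fin.cons t y : Fin 4 → ℝ)) (𝓝 x) (𝓝 (Fin.cons t x)) :=
    (contDiff_cons (n := 0) t).continuous.tendsto x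
  filter_upwards [hc.eventually hh] with y hy
  simp only [Fin.cons_zero, Fin.tail_cons] at hy
  rw [hy]
  congr 1
  funext k
  fin_cases k <;> simp

theorem riemann_spacetime
    (hh : ∀ᶠ q in 𝓝 (Fin.cons t x : Fin 4 → ℝ),
      h (q 0) (Fin.tail q) = Matrix.diagonal ![A q ^ 2, A q ^ 2, B q ^ 2])
    (hA : ContDiffAt ℝ 2 A (Fin.cons t x)) (hB : ContDiffAt ℝ 2 B (Fin.cons t x))
    (hA0 : A (Fin.cons t x) ≠ 0) (hB0 : B (Fin.cons t x) ≠ 0) (k l i j : Fin 4) :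
    riemann (spacetimeMetric h) k l i j (Fin.cons t x)
      = riemannST (A (Fin.cons t x)) (B (Fin.cons t x))
          (fun i => pd i A (Fin.cons t x)) (fun i => pd i B (Fin.cons t x))
          (fun i j => pd i (pd j A) (Fin.cons t x)) (fun i j => pd i (pd j B) (Fin.cons t x))
          k l i j := by
  have hc : ∀ i : Fin 4, pd i (fun _ : Fin 4 → ℝ => (1 : ℝ)) = fun _ => 0 := fun i =>
    funext fun y => (hasPd_const 1).pd_eq
  have hc0 : ∀ (i : Fin 4) q, pd i (fun _ : Fin 4 → ℝ => (0 : ℝ)) q = 0 := fun i q =>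
    (hasPd_const 0).pd_eq
  rw [riemann_diagonal (spacetimeMetric_eq_diagonal hh)]
  · unfold riemannST
    congr 1
    · funext k; fin_cases k <;> rfl
    · funext k; fin_cases k <;> simp [hc]; rfl
    · funext k; fin_cases k <;> simp [hc, hc0]; rfl
  · intro k; fin_cases k <;> simp
  · intro k; fin_cases k <;> simp [hA, hB, contDiffAt_const]
  · intro k; fin_cases k <;> simp [hA0, hB0]

theorem contDiffAt_slice (hA : ContDiffAt ℝ 2 A (Fin.cons t x)) :
    ContDiffAt ℝ 2 (fun y => A (Fin.cons t y)) x :=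
  ContDiffAt.comp x hA (contDiff_cons t).contDiffAt

/-- A slice is a level set of the coordinate `0`, so the jets of its metric coefficients are the
spacetime jets at successor indices. -/
theorem riemann_slice
    (hh : ∀ᶠ q in 𝓝 (Fin.cons t x : Fin 4 → ℝ),
      h (q 0) (Fin.tail q) = Matrix.diagonal ![A q ^ 2, A q ^ 2, B q ^ 2])
    (hA : ContDiffAt ℝ 2 A (Fin.cons t x)) (hB : ContDiffAt ℝ 2 B (Fin.cons t x))
    (hA0 : A (Fin.cons t x) ≠ 0) (hB0 : B (Fin.cons t x) ≠ 0) (k l i j : Fin 3) :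
    riemann (h t) k l i j x
      = diagRiemann ![1, 1, 1] ![A (Fin.cons t x), A (Fin.cons t x), B (Fin.cons t x)]
        (fun n i => ![fun i => pd i A (Fin.cons t x), fun i => pd i A (Fin.cons t x),
          fun i => pd i B (Fin.cons t x)] n i.succ)
        (fun n p i => ![fun i j => pd i (pd j A) (Fin.cons t x),
          fun i j => pd i (pd j A) (Fin.cons t x),
          fun i j => pd i (pd j B) (Fin.cons t x)] n p.succ i.succ) k l i j := by
  rw [riemann_diagonal (spatialMetric_eventually hh)]
  · congr 1
    · funext k; fin_cases k <;> rfl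
    · funext k i; fin_cases k <;> exact pd_succ_cons _ t x i
    · funext k p i; fin_cases k <;> exact pd_pd_succ_cons _ t x p i
  · intro k; fin_cases k <;> simp
  · intro k; fin_cases k
    exacts [contDiffAt_slice hA, contDiffAt_slice hA, contDiffAt_slice hB]
  · intro k; fin_cases k <;> simp [hA0, hB0]

theorem christoffel_slice
    (hh : ∀ᶠ q in 𝓝 (Fin.cons t x : Fin 4 → ℝ),
      h (q 0) (Fin.tail q) = Matrix.diagonal ![A q ^ 2, A q ^ 2, B q ^ 2])
    (hA : ContDiffAt ℝ 2 A (Fin.cons t x)) (hB : ContDiffAt ℝ 2 B (Fin.cons t x))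
    (hA0 : A (Fin.cons t x) ≠ 0) (hB0 : B (Fin.cons t x) ≠ 0) (k i j : Fin 3) :
    christoffel (h t) k i j x
      = diagChristoffel ![1, 1, 1] ![A (Fin.cons t x), A (Fin.cons t x), B (Fin.cons t x)]
        (fun n i => ![fun i => pd i A (Fin.cons t x), fun i => pd i A (Fin.cons t x),
          fun i => pd i B (Fin.cons t x)] n i.succ) k i j := by
  rw [christoffel_diagonal (spatialMetric_eventually hh)]
  · congr 1
    · funext k; fin_cases k <;> rfl
    · funext k i; fin_cases k <;> exact pd_succ_cons _ t x i
  · intro k; fin_cases k <;> simp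
  · intro k
    have h2 : (2 : WithTop ℕ∞) ≠ 0 := by norm_num
    fin_cases k
    exacts [(contDiffAt_slice hA).differentiableAt h2, (contDiffAt_slice hA).differentiableAt h2,
      (contDiffAt_slice hB).differentiableAt h2]
  · intro k; fin_cases k <;> simp [hA0, hB0]

theorem inv_diagonal_sq {u v w : ℝ} (hu : u ≠ 0) (hv : v ≠ 0) (hw : w ≠ 0) :
    (Matrix.diagonal ![u, v, w])⁻¹ = Matrix.diagonal ![u⁻¹, v⁻¹, w⁻¹] := by
  refine Matrix.inv_eq_left_inv ?_
  rw [Matrix.diagonal_mul_diagonal, ← Matrix.diagonal_one]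
  congr 1
  funext k
  fin_cases k <;> simp [hu, hv, hw]

/-- Only the metric along a single world line enters. This is why the exact-body conditions can be
checked without spatial derivatives. -/
theorem expansionTensor_eq_of_hasDerivAt {u v w : ℝ → ℝ} {u' v' w' t : ℝ}
    (hh : ∀ᶠ s in 𝓝 t, h s x = Matrix.diagonal ![u s, v s, w s])
    (hu : HasDerivAt u u' t) (hv : HasDerivAt v v' t) (hw : HasDerivAt w w' t)
    (hu0 : u t ≠ 0) (hv0 : v t ≠ 0) (hw0 : w t ≠ 0) :
    expansionTensor h t x
      = Matrix.diagonal ![u' / (2 * u t), v' / (2 * v t), w' / (2 * w t)] := by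
  have key : (Matrix.of fun i j => (1 / 2) * deriv (fun s => h s x i j) t)
      = Matrix.diagonal ![u' / 2, v' / 2, w' / 2] := by
    ext i j
    have e : (fun s => h s x i j) =ᶠ[𝓝 t] fun s => Matrix.diagonal ![u s, v s, w s] i j :=
      hh.mono fun s hs => congrFun (congrFun hs i) j
    rw [Matrix.of_apply, e.deriv_eq]
    fin_cases i <;> fin_cases j <;>
      simp [Matrix.diagonal, hu.deriv, hv.deriv, hw.deriv] <;> ring
  rw [expansionTensor, key, hh.self_of_nhds, inv_diagonal_sq hu0 hv0 hw0,
    Matrix.diagonal_mul_diagonal]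
  congr 1
  funext k
  fin_cases k <;> simp <;> field_simp

theorem expansionTensor_eq
    (hh : ∀ᶠ q in 𝓝 (Fin.cons t x : Fin 4 → ℝ),
      h (q 0) (Fin.tail q) = Matrix.diagonal ![A q ^ 2, A q ^ 2, B q ^ 2])
    (hA : DifferentiableAt ℝ A (Fin.cons t x)) (hB : DifferentiableAt ℝ B (Fin.cons t x))
    (hA0 : A (Fin.cons t x) ≠ 0) (hB0 : B (Fin.cons t x) ≠ 0) :
    expansionTensor h t x = Matrix.diagonal
      ![pd 0 A (Fin.cons t x) / A (Fin.cons t x), pd 0 A (Fin.cons t x) / A (Fin.cons t x),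
        pd 0 B (Fin.cons t x) / B (Fin.cons t x)] := by
  have hA' : HasDerivAt (fun s => A (Fin.cons s x)) (pd 0 A (Fin.cons t x)) t := by
    simpa [HasPd] using hasPd_pd 0 hA
  have hB' : HasDerivAt (fun s => B (Fin.cons s x)) (pd 0 B (Fin.cons t x)) t := by
    simpa [HasPd] using hasPd_pd 0 hB
  have hc : Tendsto (fun s : ℝ => (Fin.cons s x : Fin 4 → ℝ)) (𝓝 t) (𝓝 (Fin.cons t x)) := by
    simpa using tendsto_update 0 (Fin.cons t x : Fin 4 → ℝ)
  have := expansionTensor_eq_of_hasDerivAt (h := h) (x := x)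
    ((hc.eventually hh).mono fun s hs => by simpa using hs)
    (hA'.pow 2) (hA'.pow 2) (hB'.pow 2) (pow_ne_zero 2 hA0) (pow_ne_zero 2 hA0)
    (pow_ne_zero 2 hB0)
  rw [this]
  congr 1
  funext k
  fin_cases k <;> simp <;> field_simp

end core
end Szekeres

namespace Szekeres

/-! ### Curvature, local quantities and field equations of a Szekeres jet -/

section core

variable {h : SpatialMetric} {A B : (Fin 4 → ℝ) → ℝ} {t : ℝ} {x : Fin 3 → ℝ}
  {H s γ₁ γ₂ k : ℝ} {ρ : ℝ → (Fin 3 → ℝ) → ℝ}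

/-- The metric `-dt² + A² (dx² + dy²) + B² dz²` has Szekeres jets at the event `(t, x)`. -/
structure IsSzekeresAt (h : SpatialMetric) (A B : (Fin 4 → ℝ) → ℝ) (t : ℝ) (x : Fin 3 → ℝ)
    (H s γ₁ γ₂ k : ℝ) : Prop where
  metric_eq : ∀ᶠ q in 𝓝 (Fin.cons t x : Fin 4 → ℝ),
    h (q 0) (Fin.tail q) = Matrix.diagonal ![A q ^ 2, A q ^ 2, B q ^ 2]
  contDiff_A : ContDiffAt ℝ 2 A (Fin.cons t x)
  contDiff_B : ContDiffAt ℝ 2 B (Fin.cons t x)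
  jet : SzekeresJet (A (Fin.cons t x)) (B (Fin.cons t x))
    (fun i => pd i A (Fin.cons t x)) (fun i => pd i B (Fin.cons t x))
    (fun i j => pd i (pd j A) (Fin.cons t x)) (fun i j => pd i (pd j B) (Fin.cons t x))
    H s γ₁ γ₂ k

namespace IsSzekeresAt

theorem metric_at (hS : IsSzekeresAt h A B t x H s γ₁ γ₂ k) :
    h t x = Matrix.diagonal
    ![A (Fin.cons t x) ^ 2, A (Fin.cons t x) ^ 2, B (Fin.cons t x) ^ 2] := by
  simpa using hS.metric_eq.self_of_nhds

theorem spacetimeMetric_at (hS : IsSzekeresAt h A B t x H s γ₁ γ₂ k) :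
    spacetimeMetric h (Fin.cons t x) = Matrix.diagonal
    ![-1, A (Fin.cons t x) ^ 2, A (Fin.cons t x) ^ 2, B (Fin.cons t x) ^ 2] := by
  rw [(spacetimeMetric_eq_diagonal hS.metric_eq).eq_of_nhds]
  congr 1
  funext k
  fin_cases k <;> simp

theorem spacetimeMetric_inv_at (hS : IsSzekeresAt h A B t x H s γ₁ γ₂ k) :
    (spacetimeMetric h (Fin.cons t x))⁻¹ = Matrix.diagonal
    ![-1, (A (Fin.cons t x) ^ 2)⁻¹, (A (Fin.cons t x) ^ 2)⁻¹, (B (Fin.cons t x) ^ 2)⁻¹] := by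
  rw [hS.spacetimeMetric_at]
  refine Matrix.inv_eq_left_inv ?_
  rw [Matrix.diagonal_mul_diagonal, ← Matrix.diagonal_one]
  have h1 := hS.jet.a_ne
  have h2 := hS.jet.b_ne
  congr 1
  funext k
  fin_cases k <;> simp [h1, h2]

theorem riemann_at
    (hS : IsSzekeresAt h A B t x H s γ₁ γ₂ k)
    (k l i j : Fin 4) : riemann (spacetimeMetric h) k l i j (Fin.cons t x)
    = riemannST (A (Fin.cons t x)) (B (Fin.cons t x))
          (fun i => pd i A (Fin.cons t x)) (fun i => pd i B (Fin.cons t x))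
          (fun i j => pd i (pd j A) (Fin.cons t x)) (fun i j => pd i (pd j B) (Fin.cons t x))
          k l i j :=
  riemann_spacetime hS.metric_eq hS.contDiff_A hS.contDiff_B hS.jet.a_ne hS.jet.b_ne k l i j

theorem ricci_at
    (hS : IsSzekeresAt h A B t x H s γ₁ γ₂ k)
    (i j : Fin 4) : ricci (spacetimeMetric h) i j (Fin.cons t x) = Matrix.diagonal
      ![-(3 * s + 2 * H * γ₁ + γ₂),
        A (Fin.cons t x) ^ 2 * (s + 2 * k + 2 * H ^ 2 - 2 * H * γ₁ - γ₂),
        A (Fin.cons t x) ^ 2 * (s + 2 * k + 2 * H ^ 2 - 2 * H * γ₁ - γ₂),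
        B (Fin.cons t x) ^ 2 * (s + 2 * k + 2 * H ^ 2 - 2 * H * γ₁ - γ₂)] i j := by
  rw [← hS.jet.ricci i j]
  exact Finset.sum_congr rfl fun m _ => hS.riemann_at m i m j

theorem scalarCurvature_at (hS : IsSzekeresAt h A B t x H s γ₁ γ₂ k) :
    scalarCurvature (spacetimeMetric h) (Fin.cons t x)
    = (3 * s + 2 * H * γ₁ + γ₂) + 3 * (s + 2 * k + 2 * H ^ 2 - 2 * H * γ₁ - γ₂) := by
  have h1 := hS.jet.a_ne
  have h2 := hS.jet.b_ne
  simp only [scalarCurvature, hS.ricci_at, hS.spacetimeMetric_inv_at]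
  simp [Fin.sum_univ_four, Matrix.diagonal]
  field_simp
  ring

/-- The isotropic part, in `s`, `k` and `H²`, cancels between Riemann, Ricci and scalar curvature.
What remains is the trace-free tidal tensor generated by `2 H γ₁ + γ₂`. -/
theorem weyl_electric
    (hS : IsSzekeresAt h A B t x H s γ₁ γ₂ k)
    (i j : Fin 3) :
    weyl (spacetimeMetric h) i.succ 0 j.succ 0 (Fin.cons t x) = Matrix.diagonal
      ![A (Fin.cons t x) ^ 2 * ((2 * H * γ₁ + γ₂) / 3),
        A (Fin.cons t x) ^ 2 * ((2 * H * γ₁ + γ₂) / 3),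
        B (Fin.cons t x) ^ 2 * (-2 * (2 * H * γ₁ + γ₂) / 3)] i j := by
  have e : ∑ m, spacetimeMetric h (Fin.cons t x) i.succ m
      * riemann (spacetimeMetric h) m 0 j.succ 0 (Fin.cons t x)
      = spacetimeMetric h (Fin.cons t x) i.succ i.succ
        * Matrix.diagonal ![-s, -s, -(s + 2 * H * γ₁ + γ₂)] i j := by
    rw [Finset.sum_eq_single i.succ]
    · rw [hS.riemann_at, hS.jet.electric]
    · intro b _ hb
      rw [hS.spacetimeMetric_at, Matrix.diagonal_apply_ne _ hb.symm, zero_mul]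
    · simp
  rw [weyl, e]
  simp only [hS.ricci_at, hS.scalarCurvature_at, hS.spacetimeMetric_at]
  fin_cases i <;> fin_cases j <;> simp [Matrix.diagonal] <;> ring

/-- The metric and the Ricci tensor have no time-space components, so the Weyl component reduces to
the Riemann component, which vanishes. -/
theorem weyl_magnetic
    (hS : IsSzekeresAt h A B t x H s γ₁ γ₂ k)
    (m n j : Fin 3) :
    weyl (spacetimeMetric h) m.succ n.succ j.succ 0 (Fin.cons t x) = 0 := by
  have e : ∑ l, spacetimeMetric h (Fin.cons t x) m.succ l
      * riemann (spacetimeMetric h) l n.succ j.succ 0 (Fin.cons t x) = 0 := by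
    rw [Finset.sum_eq_single m.succ]
    · rw [hS.riemann_at, hS.jet.magnetic, mul_zero]
    · intro b _ hb
      rw [hS.spacetimeMetric_at, Matrix.diagonal_apply_ne _ hb.symm, zero_mul]
    · simp
  rw [weyl, e]
  simp only [hS.ricci_at, hS.spacetimeMetric_at,
    Matrix.diagonal_apply_ne _ (Fin.succ_ne_zero _)]
  ring

theorem inv_metric_at (hS : IsSzekeresAt h A B t x H s γ₁ γ₂ k) :
    (h t x)⁻¹ = Matrix.diagonal
    ![(A (Fin.cons t x) ^ 2)⁻¹, (A (Fin.cons t x) ^ 2)⁻¹, (B (Fin.cons t x) ^ 2)⁻¹] := by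
  rw [hS.metric_at]
  exact inv_diagonal_sq (pow_ne_zero 2 hS.jet.a_ne) (pow_ne_zero 2 hS.jet.a_ne)
    (pow_ne_zero 2 hS.jet.b_ne)

theorem gravitoelectric_at (hS : IsSzekeresAt h A B t x H s γ₁ γ₂ k) :
    gravitoelectric h t x
    = ((2 * H * γ₁ + γ₂) / 3) • Matrix.diagonal ![1, 1, -2] := by
  have h1 := hS.jet.a_ne
  have h2 := hS.jet.b_ne
  have e : (Matrix.of fun i j : Fin 3 =>
      weyl (spacetimeMetric h) i.succ 0 j.succ 0 (Fin.cons t x)) = Matrix.diagonal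
      ![A (Fin.cons t x) ^ 2 * ((2 * H * γ₁ + γ₂) / 3),
        A (Fin.cons t x) ^ 2 * ((2 * H * γ₁ + γ₂) / 3),
        B (Fin.cons t x) ^ 2 * (-2 * (2 * H * γ₁ + γ₂) / 3)] :=
    Matrix.ext hS.weyl_electric
  rw [gravitoelectric, e, hS.inv_metric_at, Matrix.diagonal_mul_diagonal, ← Matrix.diagonal_smul]
  congr 1
  funext k
  fin_cases k <;> simp [h1, h2]; ring

theorem gravitomagnetic_at (hS : IsSzekeresAt h A B t x H s γ₁ γ₂ k) :
    gravitomagnetic h t x = 0 := by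
  have e : ∀ m n j : Fin 3, weyl (spacetimeMetric h) m.succ n.succ j.succ 0 (Fin.cons t x) = 0 :=
    hS.weyl_magnetic
  simp only [gravitomagnetic, e, mul_zero, Finset.sum_const_zero]
  exact mul_zero _

theorem ricci_slice
    (hS : IsSzekeresAt h A B t x H s γ₁ γ₂ k)
    (i j : Fin 3) : ricci (h t) i j x = Matrix.diagonal
      ![A (Fin.cons t x) ^ 2 * (2 * k - (3 * H * γ₁ + γ₂)),
        A (Fin.cons t x) ^ 2 * (2 * k - (3 * H * γ₁ + γ₂)),
        B (Fin.cons t x) ^ 2 * (2 * k - 2 * (3 * H * γ₁ + γ₂))] i j := by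
  rw [← hS.jet.spatialRicci i j]
  exact Finset.sum_congr rfl fun m _ =>
    riemann_slice hS.metric_eq hS.contDiff_A hS.contDiff_B hS.jet.a_ne hS.jet.b_ne m i m j

theorem spatialRicci_at (hS : IsSzekeresAt h A B t x H s γ₁ γ₂ k) :
    spatialRicci h t x = Matrix.diagonal
    ![2 * k - (3 * H * γ₁ + γ₂), 2 * k - (3 * H * γ₁ + γ₂), 2 * k - 2 * (3 * H * γ₁ + γ₂)] := by
  have h1 := hS.jet.a_ne
  have h2 := hS.jet.b_ne
  have e : (Matrix.of fun i j : Fin 3 => ricci (h t) i j x) = _ := Matrix.ext hS.ricci_slice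
  rw [spatialRicci, e, hS.inv_metric_at, Matrix.diagonal_mul_diagonal]
  congr 1
  funext k
  fin_cases k <;> simp [h1, h2]

theorem scalarCurvature_slice (hS : IsSzekeresAt h A B t x H s γ₁ γ₂ k) :
    scalarCurvature (h t) x = 6 * k - 4 * (3 * H * γ₁ + γ₂) := by
  have h1 := hS.jet.a_ne
  have h2 := hS.jet.b_ne
  simp only [scalarCurvature, hS.ricci_slice, hS.inv_metric_at]
  simp [Fin.sum_univ_three, Matrix.diagonal]
  field_simp
  ring

theorem expansionTensor_at (hS : IsSzekeresAt h A B t x H s γ₁ γ₂ k) :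
    expansionTensor h t x = Matrix.diagonal ![H, H, H + γ₁] := by
  have h1 := hS.jet.a_ne
  have h2 := hS.jet.b_ne
  have h3 := hS.jet.a_t
  have h4 := hS.jet.b_t
  rw [expansionTensor_eq hS.metric_eq (hS.contDiff_A.differentiableAt two_ne_zero)
    (hS.contDiff_B.differentiableAt two_ne_zero) h1 h2]
  rw [h3, h4, mul_div_cancel_right₀ _ h1, mul_div_cancel_right₀ _ h2]

theorem trace_expansionTensor_at (hS : IsSzekeresAt h A B t x H s γ₁ γ₂ k) :
    (expansionTensor h t x).trace = 3 * H + γ₁ := by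
  simp [hS.expansionTensor_at, Matrix.trace_diagonal, Fin.sum_univ_three]
  ring

theorem localQuantities_at (hS : IsSzekeresAt h A B t x H s γ₁ γ₂ k) :
    localQuantities h ρ t x =
    { density := ρ t x
      expansion := 3 * H + γ₁
      expansionTensor := Matrix.diagonal ![H, H, H + γ₁]
      shear := Matrix.diagonal ![H, H, H + γ₁] - ((1 / 3) * (3 * H + γ₁)) • 1
      gravitoelectric := ((2 * H * γ₁ + γ₂) / 3) • Matrix.diagonal ![1, 1, -2]
      gravitomagnetic := 0
      spatialRicci := Matrix.diagonal ![2 * k - (3 * H * γ₁ + γ₂), 2 * k - (3 * H * γ₁ + γ₂),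
        2 * k - 2 * (3 * H * γ₁ + γ₂)]
      spatialScalar := 6 * k - 4 * (3 * H * γ₁ + γ₂)
      traceFreeRicci := ((3 * H * γ₁ + γ₂) / 3) • Matrix.diagonal ![1, 1, -2] } := by
  unfold localQuantities
  rw [hS.trace_expansionTensor_at, hS.expansionTensor_at, hS.gravitoelectric_at,
    hS.gravitomagnetic_at, hS.spatialRicci_at, hS.scalarCurvature_slice]
  congr 1
  rw [← Matrix.diagonal_one, ← Matrix.diagonal_smul, ← Matrix.diagonal_smul, Matrix.diagonal_sub]
  congr 1
  funext k
  fin_cases k <;> simp <;> ring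

/-- The jet relations hold only at the event itself, whereas the momentum constraint differentiates
the expansion tensor. The unreduced form `Ȧ/A, Ȧ/A, Ḃ/B` is available at all nearby points. -/
theorem expansionTensor_eventually (hS : IsSzekeresAt h A B t x H s γ₁ γ₂ k) :
    ∀ᶠ y in 𝓝 x, expansionTensor h t y = Matrix.diagonal
      ![pd 0 A (Fin.cons t y) / A (Fin.cons t y), pd 0 A (Fin.cons t y) / A (Fin.cons t y),
        pd 0 B (Fin.cons t y) / B (Fin.cons t y)] := by
  have hc : Tendsto (fun y : Fin 3 → ℝ => (Fin.cons t y : Fin 4 → ℝ)) (𝓝 x) (𝓝 (Fin.cons t x)) :=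
    (contDiff_cons (n := 0) t).continuous.tendsto x
  filter_upwards [hc.eventually (eventually_eventually_nhds.2 hS.metric_eq),
    hc.eventually (eventually_differentiableAt hS.contDiff_A),
    hc.eventually (eventually_differentiableAt hS.contDiff_B),
    hc.eventually (hS.contDiff_A.continuousAt.eventually_ne hS.jet.a_ne),
    hc.eventually (hS.contDiff_B.continuousAt.eventually_ne hS.jet.b_ne)] with y h1 h2 h3 h4 h5
  exact expansionTensor_eq h1 h2 h3 h4 h5

theorem hasPd_rate {C : (Fin 4 → ℝ) → ℝ} (hC : ContDiffAt ℝ 2 C (Fin.cons t x))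
    (h0 : C (Fin.cons t x) ≠ 0) (i : Fin 3) :
    HasPd i (fun y : Fin 3 → ℝ => pd 0 C (Fin.cons t y) / C (Fin.cons t y))
      ((pd i.succ (pd 0 C) (Fin.cons t x) * C (Fin.cons t x)
        - pd 0 C (Fin.cons t x) * pd i.succ C (Fin.cons t x)) / C (Fin.cons t x) ^ 2) x := by
  have h1 := (hasPd_pd i.succ ((contDiffAt_pd 0 hC).differentiableAt one_ne_zero)).div
    (hasPd_pd i.succ (hC.differentiableAt two_ne_zero)) h0
  simpa [HasPd, Fin.cons_update] using h1

theorem momentum_at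
    (hS : IsSzekeresAt h A B t x H s γ₁ γ₂ k)
    (j : Fin 3) :
    ∑ i, (pd i (fun y => expansionTensor h t y i j) x
        + ∑ m, (christoffel (h t) i i m x * expansionTensor h t x m j
          - christoffel (h t) m i j x * expansionTensor h t x i m))
      = pd j (fun y => (expansionTensor h t y).trace) x := by
  have hA := fun i => hasPd_rate hS.contDiff_A hS.jet.a_ne i
  have hB := fun i => hasPd_rate hS.contDiff_B hS.jet.b_ne i
  have e1 : ∀ i, pd i (fun y => expansionTensor h t y i j) x = _ := fun i =>
    pd_congr (φ := fun y => expansionTensor h t y i j)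
      (hS.expansionTensor_eventually.mono fun y hy => congrFun (congrFun hy i) j)
  have e2 : pd j (fun y => (expansionTensor h t y).trace) x = _ :=
    pd_congr (φ := fun y => (expansionTensor h t y).trace)
      (hS.expansionTensor_eventually.mono fun y hy => congrArg Matrix.trace hy)
  have e3 := ((hA j).add (hA j)).add (hB j)
  have e4 : ∀ i, HasPd i (fun y => Matrix.diagonal
      ![pd 0 A (Fin.cons t y) / A (Fin.cons t y), pd 0 A (Fin.cons t y) / A (Fin.cons t y),
        pd 0 B (Fin.cons t y) / B (Fin.cons t y)] i j) (Matrix.diagonal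
        ![(pd i.succ (pd 0 A) (Fin.cons t x) * A (Fin.cons t x)
            - pd 0 A (Fin.cons t x) * pd i.succ A (Fin.cons t x)) / A (Fin.cons t x) ^ 2,
          (pd i.succ (pd 0 A) (Fin.cons t x) * A (Fin.cons t x)
            - pd 0 A (Fin.cons t x) * pd i.succ A (Fin.cons t x)) / A (Fin.cons t x) ^ 2,
          (pd i.succ (pd 0 B) (Fin.cons t x) * B (Fin.cons t x)
            - pd 0 B (Fin.cons t x) * pd i.succ B (Fin.cons t x)) / B (Fin.cons t x) ^ 2] i j)
        x := by
    intro i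
    by_cases hij : i = j
    · subst hij
      simp only [Matrix.diagonal_apply_eq]
      fin_cases i
      exacts [hA 0, hA 1, hB 2]
    · simp only [Matrix.diagonal_apply_ne _ hij]
      exact hasPd_const 0
  have e5 := hS.jet.momentum j
  simp only [Matrix.trace_diagonal, Fin.sum_univ_three (f := fun i => (![_, _, _] : Fin 3 → ℝ) i),
    Matrix.cons_val] at e2
  rw [e2, e3.pd_eq, ← e5]
  refine Finset.sum_congr rfl fun i _ => ?_
  rw [e1, (e4 i).pd_eq, hS.expansionTensor_at]
  congr 1
  refine Finset.sum_congr rfl fun m _ => ?_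
  rw [christoffel_slice hS.metric_eq hS.contDiff_A hS.contDiff_B hS.jet.a_ne hS.jet.b_ne,
    christoffel_slice hS.metric_eq hS.contDiff_A hS.contDiff_B hS.jet.a_ne hS.jet.b_ne]

/-- With `m = μ/S³`, `h1` and `h2` are the two Friedmann equations and `h3` is a Poisson-type
equation: the density exceeds that of the background by `-(𝓖̈ + 2 H 𝓖̇)/𝓖`, up to the factor `4 π`.
-/
theorem isDustSolutionAt
    (hS : IsSzekeresAt h A B t x H s γ₁ γ₂ k)
    {Λ m : ℝ} (h1 : H ^ 2 = -k + 2 * m + Λ / 3) (h2 : s = -m + Λ / 3)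
    (h3 : 4 * Real.pi * ρ t x = 3 * m - (2 * H * γ₁ + γ₂)) :
    IsDustSolutionAt Λ h ρ t x where
  einstein a b := by
    have h4 : 8 * Real.pi * ρ t x = 2 * (3 * m - (2 * H * γ₁ + γ₂)) := by rw [← h3]; ring
    rw [einsteinTensor, hS.ricci_at, hS.scalarCurvature_at, hS.spacetimeMetric_at, h4, h1, h2]
    fin_cases a <;> fin_cases b <;>
      simp [Matrix.diagonal, fourVelocity] <;> ring
  energy := by
    have h4 : 16 * Real.pi * ρ t x = 4 * (3 * m - (2 * H * γ₁ + γ₂)) := by rw [← h3]; ring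
    rw [hS.scalarCurvature_slice, hS.trace_expansionTensor_at, hS.expansionTensor_at, h4,
      Matrix.diagonal_mul_diagonal, Matrix.trace_diagonal, Fin.sum_univ_three]
    simp only [Matrix.cons_val]
    linear_combination 6 * h1
  momentum := hS.momentum_at

theorem christoffel_zero_zero
    (hS : IsSzekeresAt h A B t x H s γ₁ γ₂ k)
    (a : Fin 4) :
    christoffel (spacetimeMetric h) a 0 0 (Fin.cons t x) = 0 := by
  have hc : ∀ i : Fin 4, pd i (fun _ : Fin 4 → ℝ => (1 : ℝ)) (Fin.cons t x) = 0 := fun i =>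
    (hasPd_const 1).pd_eq
  rw [christoffel_diagonal (spacetimeMetric_eq_diagonal hS.metric_eq)]
  · fin_cases a <;> simp [diagChristoffel, hc]
  · intro k; fin_cases k <;> simp
  · have h1 := hS.contDiff_A.differentiableAt two_ne_zero
    have h2 := hS.contDiff_B.differentiableAt two_ne_zero
    intro k; fin_cases k <;> simp [h1, h2]
  · intro k; fin_cases k <;> simp [hS.jet.a_ne, hS.jet.b_ne]

theorem isGeodesicAt (hS : IsSzekeresAt h A B t x H s γ₁ γ₂ k) :
    IsGeodesicAt (spacetimeMetric h) (worldLineCurve x) t := by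
  have d0 : ∀ s, deriv (fun s => worldLineCurve x s 0) s = 1 := fun s => by simp [worldLineCurve]
  have d1 : ∀ (i : Fin 3) s, deriv (fun s => worldLineCurve x s i.succ) s = 0 := fun i s => by
    simp [worldLineCurve]
  have d2 : ∀ a, deriv (deriv fun s => worldLineCurve x s a) t = 0 := by
    intro a
    refine Fin.cases ?_ (fun i => ?_) a
    · rw [show deriv (fun s => worldLineCurve x s 0) = fun _ => 1 from funext d0]; simp
    · rw [show deriv (fun s => worldLineCurve x s i.succ) = fun _ => 0 from funext (d1 i)]; simp
  intro a
  rw [d2, Fin.sum_univ_succ]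
  simp only [Fin.sum_univ_succ (n := 3), d0, d1, mul_zero, Finset.sum_const_zero, zero_mul]
  rw [show worldLineCurve x t = Fin.cons t x from rfl, hS.christoffel_zero_zero]
  simp

theorem spacetimeMetric_worldLineCurve_eq_neg_one :
    ∑ a, ∑ b, spacetimeMetric h (worldLineCurve x t) a b
      * deriv (fun s => worldLineCurve x s a) t * deriv (fun s => worldLineCurve x s b) t = -1 := by
  have d0 : deriv (fun s => worldLineCurve x s 0) t = 1 := by simp [worldLineCurve]
  have d1 : ∀ i : Fin 3, deriv (fun s => worldLineCurve x s i.succ) t = 0 := fun i => by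
    simp [worldLineCurve]
  simp [Fin.sum_univ_succ (n := 3), d0, d1, spacetimeMetric]

end IsSzekeresAt
end core
end Szekeres

namespace Szekeres

/-! ### The exact body along a world line -/

theorem matrixDeriv_diagonal (v : ℝ → Fin 3 → ℝ) (t : ℝ) :
    matrixDeriv (fun s => Matrix.diagonal (v s)) t
      = Matrix.diagonal fun i => deriv (fun s => v s i) t := by
  ext i j
  rw [matrixDeriv, Matrix.of_apply]
  by_cases hij : i = j
  · subst hij
    simp only [Matrix.diagonal_apply_eq]
  · simp only [Matrix.diagonal_apply_ne _ hij, deriv_const]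

section

variable (α : ℝ) (F : ℝ → ℝ) (tᵢ : ℝ)

theorem deformationTrace_gwDeformation :
    deformationTrace (gwDeformation α F tᵢ) = fun t => -(F t - F tᵢ) / (α - F tᵢ) := by
  funext t
  simp [deformationTrace, gwDeformation, Matrix.trace_diagonal, Fin.sum_univ_three]

theorem deriv_deformationTrace :
    deriv (deformationTrace (gwDeformation α F tᵢ)) = fun t => -deriv F t / (α - F tᵢ) := by
  funext t
  rw [deformationTrace_gwDeformation, deriv_div_const, deriv.fun_neg, deriv_sub_const]

theorem deriv_deriv_deformationTrace (t : ℝ) :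
    deriv (deriv (deformationTrace (gwDeformation α F tᵢ))) t
      = -deriv (deriv F) t / (α - F tᵢ) := by
  rw [deriv_deformationTrace, deriv_div_const, deriv.fun_neg]

theorem matrixDeriv_gwDeformation :
    matrixDeriv (gwDeformation α F tᵢ)
      = fun t => Matrix.diagonal ![0, 0, -deriv F t / (α - F tᵢ)] := by
  funext t
  have h := matrixDeriv_diagonal (fun t => ![0, 0, -(F t - F tᵢ) / (α - F tᵢ)]) t
  refine h.trans ?_
  congr 1
  funext i
  fin_cases i
  · exact deriv_const _ _
  · exact deriv_const _ _
  · exact congrFun ((deformationTrace_gwDeformation α F tᵢ) ▸ deriv_deformationTrace α F tᵢ) t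

theorem matrixDeriv_matrixDeriv_gwDeformation (t : ℝ) :
    matrixDeriv (matrixDeriv (gwDeformation α F tᵢ)) t
      = Matrix.diagonal ![0, 0, -deriv (deriv F) t / (α - F tᵢ)] := by
  rw [matrixDeriv_gwDeformation]
  refine (matrixDeriv_diagonal (fun t => ![0, 0, -deriv F t / (α - F tᵢ)]) t).trans ?_
  congr 1
  funext i
  fin_cases i
  · exact deriv_const _ _
  · exact deriv_const _ _
  · exact (congrArg (fun f => deriv f t) (deriv_deformationTrace α F tᵢ).symm).trans
      (deriv_deriv_deformationTrace α F tᵢ t)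

theorem coframe_gwDeformation (S : ℝ → ℝ) :
    coframe S (gwDeformation α F tᵢ) = fun t =>
      Matrix.diagonal ![S t, S t, S t * (1 + -(F t - F tᵢ) / (α - F tᵢ))] := by
  funext t
  rw [coframe, gwDeformation, ← Matrix.diagonal_one, Matrix.diagonal_add, ← Matrix.diagonal_smul]
  congr 1
  funext i
  fin_cases i <;> simp

variable {α F tᵢ}

theorem one_add_deformation (h0 : α - F tᵢ ≠ 0) (t : ℝ) :
    1 + -(F t - F tᵢ) / (α - F tᵢ) = (α - F t) / (α - F tᵢ) := by
  field_simp
  ring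

/-- Division by `𝔍 = (α - F t) / (α - F tᵢ)` cancels the initial normalization, so apart from the
density the initial time disappears. The result has the normal form of
`IsSzekeresAt.localQuantities_at` with `k = k₀/S²`. -/
theorem exactBodyFunctionals_gwDeformation (k₀ : ℝ) (S : ℝ → ℝ) (ρᵢ t : ℝ) {H γ₁ γ₂ : ℝ}
    (hi : α - F tᵢ ≠ 0) (ht : α - F t ≠ 0) (hH : H = hubble S t)
    (h1 : γ₁ = -deriv F t / (α - F t)) (h2 : γ₂ = -deriv (deriv F) t / (α - F t)) :
    exactBodyFunctionals k₀ S (gwDeformation α F tᵢ) ρᵢ tᵢ t =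
    { density := ρᵢ * (S t ^ 3 * ((α - F t) / (α - F tᵢ)) / S tᵢ ^ 3)⁻¹
      expansion := 3 * H + γ₁
      expansionTensor := Matrix.diagonal ![H, H, H + γ₁]
      shear := Matrix.diagonal ![H, H, H + γ₁] - ((1 / 3) * (3 * H + γ₁)) • 1
      gravitoelectric := ((2 * H * γ₁ + γ₂) / 3) • Matrix.diagonal ![1, 1, -2]
      gravitomagnetic := 0
      spatialRicci := Matrix.diagonal ![2 * (k₀ / S t ^ 2) - (3 * H * γ₁ + γ₂),
        2 * (k₀ / S t ^ 2) - (3 * H * γ₁ + γ₂), 2 * (k₀ / S t ^ 2) - 2 * (3 * H * γ₁ + γ₂)]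
      spatialScalar := 6 * (k₀ / S t ^ 2) - 4 * (3 * H * γ₁ + γ₂)
      traceFreeRicci := ((3 * H * γ₁ + γ₂) / 3) • Matrix.diagonal ![1, 1, -2] } := by
  have e1 : -deriv F t / (α - F tᵢ) / ((α - F t) / (α - F tᵢ)) = γ₁ := by rw [h1]; field_simp
  have eX : (3 * H * (-deriv F t / (α - F tᵢ)) + -deriv (deriv F) t / (α - F tᵢ))
      / ((α - F t) / (α - F tᵢ)) = 3 * H * γ₁ + γ₂ := by rw [h1, h2]; field_simp
  have eE : (2 * H * (-deriv F t / (α - F tᵢ)) + -deriv (deriv F) t / (α - F tᵢ))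
      / (3 * ((α - F t) / (α - F tᵢ))) = (2 * H * γ₁ + γ₂) / 3 := by rw [h1, h2]; field_simp
  have e0 : 1 + deformationTrace (gwDeformation α F tᵢ) t = (α - F t) / (α - F tᵢ) := by
    rw [deformationTrace_gwDeformation]; exact one_add_deformation hi t
  have ei : 1 + deformationTrace (gwDeformation α F tᵢ) tᵢ = 1 := by
    rw [deformationTrace_gwDeformation]; simp
  have d1 : deriv (deformationTrace (gwDeformation α F tᵢ)) t = -deriv F t / (α - F tᵢ) := by
    rw [deriv_deformationTrace]
  simp only [exactBodyFunctionals, e0, ei, deriv_deriv_deformationTrace, d1, ← hH,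
    matrixDeriv_gwDeformation, e1, eX, eE, mul_one, mul_div_assoc 2 k₀, mul_div_assoc 6 k₀]
  congr 1
  rw [← Matrix.diagonal_one, ← Matrix.diagonal_smul, ← Matrix.diagonal_smul, Matrix.diagonal_sub,
    ← Matrix.diagonal_smul, Matrix.diagonal_sub]
  congr 1
  funext i
  fin_cases i <;> simp [h1] <;> field_simp <;> ring

theorem gwMetric_ne_zero {S G W e : ℝ} (hS : S ≠ 0) (he : e ≠ 0) (hG : G ≠ 0) (hW : W ≠ 0) :
    S ^ 2 * e ^ 2 ≠ 0 ∧ S ^ 2 * G ^ 2 * W ^ 2 ≠ 0 := by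
  constructor <;> positivity

theorem IsBackground.differentiableAt {Λ k₀ μ T : ℝ} {L : Set ℝ} {S : ℝ → ℝ}
    (hb : IsBackground Λ k₀ μ T L S) {t : ℝ} (ht : t ∈ L) : DifferentiableAt ℝ S t :=
  (hb.smooth.contDiffAt (hb.isOpen.mem_nhds ht)).differentiableAt (by simp)

theorem IsDensityMode.differentiableAt {μ : ℝ} {L : Set ℝ} {S : ℝ → ℝ} (hL : IsOpen L)
    (hF : IsDensityMode μ L S F) {t : ℝ} (ht : t ∈ L) : DifferentiableAt ℝ F t :=
  (hF.1.contDiffAt (hL.mem_nhds ht)).differentiableAt (by simp)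

theorem expansionTensor_gwMetric {Λ k₀ μ T : ℝ} {L : Set ℝ} {S : ℝ → ℝ} {h : SpatialMetric}
    {x : Fin 3 → ℝ} {W e : ℝ} (hb : IsBackground Λ k₀ μ T L S) (hF : IsDensityMode μ L S F)
    (hh : ∀ s, h s x = gwMetric (S s) (α - F s) W e) (hW : W ≠ 0) (he : e ≠ 0)
    {t : ℝ} (ht : t ∈ L) (hG : α - F t ≠ 0) :
    expansionTensor h t x - hubble S t • 1 = Matrix.diagonal ![0, 0, -deriv F t / (α - F t)] := by
  have hS : S t ≠ 0 := (hb.pos t ht).ne'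
  have dS := (hb.differentiableAt ht).hasDerivAt
  have dG := (hF.differentiableAt hb.isOpen ht).hasDerivAt.const_sub α
  have d1 := (dS.pow 2).mul_const (e ^ 2)
  have d2 := ((dS.pow 2).mul (dG.pow 2)).mul_const (W ^ 2)
  have hne := gwMetric_ne_zero hS he hG hW
  rw [expansionTensor_eq_of_hasDerivAt (Eventually.of_forall fun s => hh s) d1 d1 d2 hne.1 hne.1
    hne.2, ← Matrix.diagonal_one, ← Matrix.diagonal_smul, Matrix.diagonal_sub]
  congr 1
  funext i
  fin_cases i <;> simp [hubble] <;> field_simp <;> ring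

/-- All matrices are diagonal and the deformation has a single nonzero entry, affine in the mode
`F`. Algebra settles everything except the sign of the Jacobian, where connectedness of the time
interval enters. -/
theorem isExactBodyLine_gwMetric {Λ k₀ μ T : ℝ} {L J : Set ℝ} {S : ℝ → ℝ} {h : SpatialMetric}
    {x : Fin 3 → ℝ} {W e : ℝ} (hb : IsBackground Λ k₀ μ T L S) (hF : IsDensityMode μ L S F)
    (hh : ∀ s, h s x = gwMetric (S s) (α - F s) W e) (hW : 0 < W) (he : 0 < e)
    (hi : tᵢ ∈ L ∧ α - F tᵢ ≠ 0) (hJ : ∀ t ∈ J, ∀ s ∈ uIcc tᵢ t, s ∈ L ∧ α - F s ≠ 0) :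
    IsExactBodyLine Λ k₀ μ T L S h x tᵢ (gwDeformation α F tᵢ) J := by
  have hJt : ∀ t ∈ J, t ∈ L ∧ α - F t ≠ 0 := fun t ht => hJ t ht t right_mem_uIcc
  have hSi := hb.pos tᵢ hi.1
  have hgram : gram h S tᵢ x
      = Matrix.diagonal ![e ^ 2, e ^ 2, (α - F tᵢ) ^ 2 * W ^ 2] := by
    rw [gram, hh, gwMetric, ← Matrix.diagonal_smul]
    congr 1
    funext i
    fin_cases i <;> simp <;> field_simp
  -- The ratio of square roots of determinants only sees `|𝔍|`. Since `𝔍` is `1` at `tᵢ` and has no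
  -- zero between `tᵢ` and `t`, it stays positive.
  have hpos : ∀ t ∈ J, 0 < (α - F t) / (α - F tᵢ) := by
    intro t ht
    have hc : ContinuousOn (fun s => (α - F s) / (α - F tᵢ)) (uIcc tᵢ t) := fun s hs =>
      ((continuousAt_const.sub (hF.differentiableAt hb.isOpen (hJ t ht s hs).1).continuousAt).div_const
        _).continuousWithinAt
    by_contra hneg
    have h1 : (0 : ℝ) ∈ uIcc ((α - F tᵢ) / (α - F tᵢ)) ((α - F t) / (α - F tᵢ)) := by
      rw [div_self hi.2]
      exact mem_uIcc.2 (Or.inr ⟨not_lt.1 hneg, zero_le_one⟩)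
    obtain ⟨s, hs, h0⟩ := intermediate_value_uIcc hc h1
    exact (div_ne_zero (hJ t ht s hs).2 hi.2) h0
  have hacc : initialAcceleration S (gwDeformation α F tᵢ) tᵢ = Matrix.diagonal
      ![0, 0, -deriv (deriv F) tᵢ / (α - F tᵢ)
        + 2 * hubble S tᵢ * (-deriv F tᵢ / (α - F tᵢ))] := by
    rw [initialAcceleration, matrixDeriv_matrixDeriv_gwDeformation, matrixDeriv_gwDeformation,
      ← Matrix.diagonal_smul, Matrix.diagonal_add]
    congr 1
    funext i
    fin_cases i <;> simp
  refine ⟨hb, fun t ht => (hJt t ht).1, ?_, ?_, ?_, ?_, ?_, ?_, ?_, ?_, ?_, ?_, ?_⟩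
  · intro t ht
    simp only [coframe_gwDeformation, one_add_deformation hi.2]
    rw [hh, hgram, Matrix.diagonal_transpose,
      Matrix.diagonal_mul_diagonal, Matrix.diagonal_mul_diagonal, gwMetric]
    have := hi.2
    congr 1
    funext i
    fin_cases i <;> simp <;> field_simp
  · intro t _
    rw [hgram, coframe_gwDeformation, matrixDeriv_diagonal, Matrix.diagonal_transpose,
      Matrix.diagonal_mul_diagonal, Matrix.diagonal_mul_diagonal]
    exact Matrix.isSymm_diagonal _
  · rw [gwDeformation]
    simp
  · rw [hgram, matrixDeriv_gwDeformation, Matrix.diagonal_mul_diagonal]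
    exact Matrix.isSymm_diagonal _
  · rw [hgram, hacc, Matrix.diagonal_mul_diagonal]
    exact Matrix.isSymm_diagonal _
  · intro t _
    rw [secondInvariant, gwDeformation, Matrix.diagonal_mul_diagonal, Matrix.trace_diagonal,
      Matrix.trace_diagonal]
    simp [Fin.sum_univ_three]
    ring
  · intro t _
    rw [gwDeformation, Matrix.det_diagonal]
    simp [Fin.prod_univ_three]
  · intro t ht
    have hS := hb.pos t (hJt t ht).1
    rw [deformationTrace_gwDeformation]
    refine ⟨?_, ?_⟩
    · rw [coframe_gwDeformation, Matrix.det_diagonal]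
      simp [Fin.prod_univ_three]
      ring
    · simp only [one_add_deformation hi.2]
      rw [← Real.sqrt_div' _ (by rw [hgram, Matrix.det_diagonal]; simp [Fin.prod_univ_three]; positivity),
        hgram, hh, gwMetric, Matrix.det_diagonal, Matrix.det_diagonal]
      refine (Real.sqrt_eq_iff_mul_self_eq_of_pos (mul_pos (pow_pos hS 3) (hpos t ht))).2 ?_
      have := hi.2
      simp [Fin.prod_univ_three]
      field_simp
  · intro t ht
    have hS := hb.pos t (hJt t ht).1
    have m1 := hF.2 t (hJt t ht).1
    have m2 := hF.2 tᵢ hi.1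
    -- The mode equation at `tᵢ` evaluates the source `W`. Rescaled by `S³`, it matches the term
    -- that the constant `F tᵢ` in the numerator of `P` leaves over in the mode equation at `t`.
    have htr : (initialAcceleration S (gwDeformation α F tᵢ) tᵢ).trace
        = -(3 * μ / S tᵢ ^ 3 * F tᵢ) / (α - F tᵢ) := by
      rw [hacc, Matrix.trace_diagonal]
      simp only [Fin.sum_univ_three, Matrix.cons_val]
      rw [show 3 * μ / S tᵢ ^ 3 * F tᵢ = deriv (deriv F) tᵢ + 2 * hubble S tᵢ * deriv F tᵢ by
        linear_combination -m2]
      ring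
    rw [htr, deriv_deriv_deformationTrace, deriv_deformationTrace, deformationTrace_gwDeformation]
    have hρ : 4 * Real.pi * backgroundDensity μ S t = 3 * μ / S t ^ 3 := by
      have := Real.pi_ne_zero
      rw [backgroundDensity]
      field_simp
    rw [hρ]
    have : deriv (deriv F) t = 3 * μ / S t ^ 3 * F t - 2 * hubble S t * deriv F t := by
      linear_combination m1
    simp only [this]
    have := hi.2
    field_simp
    ring
  · intro t ht
    rw [expansionTensor_gwMetric hb hF hh hW.ne' he.ne' (hJt t ht).1 (hJt t ht).2,
      secondInvariant, Matrix.diagonal_mul_diagonal, Matrix.trace_diagonal, Matrix.trace_diagonal]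
    simp [Fin.sum_univ_three]
    ring
  · intro t ht
    rw [expansionTensor_gwMetric hb hF hh hW.ne' he.ne' (hJt t ht).1 (hJt t ht).2,
      Matrix.det_diagonal]
    simp [Fin.prod_univ_three]

end

end Szekeres

namespace Szekeres

/-! ### Friedmann backgrounds and their density modes -/

theorem eq_of_hasDerivAt_zero {U : Set ℝ} {φ : ℝ → ℝ} (hU : IsOpen U) (hc : IsPreconnected U)
    (h : ∀ t ∈ U, HasDerivAt φ 0 t) {s t : ℝ} (hs : s ∈ U) (ht : t ∈ U) : φ s = φ t :=
  hU.is_const_of_deriv_eq_zero hc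
    (fun u hu => (h u hu).differentiableAt.differentiableWithinAt) (fun u hu => (h u hu).deriv)
    hs ht

section background

variable {Λ k₀ μ T : ℝ} {L : Set ℝ} {S F G : ℝ → ℝ}

namespace IsBackground

theorem isPreconnected (hb : IsBackground Λ k₀ μ T L S) : IsPreconnected L := by
  refine OrdConnected.isPreconnected ⟨fun s hs t ht u hu => ?_⟩
  exact hb.past t ht ⟨(hb.bang_lt s hs).trans_le hu.1, hu.2⟩

theorem hasDerivAt (hb : IsBackground Λ k₀ μ T L S) {t : ℝ} (ht : t ∈ L) :
    HasDerivAt S (deriv S t) t := (hb.differentiableAt ht).hasDerivAt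

theorem contDiffOn_deriv (hb : IsBackground Λ k₀ μ T L S) : ContDiffOn ℝ ∞ (deriv S) L :=
  hb.smooth.deriv_of_isOpen hb.isOpen (by simp)

theorem hasDerivAt_deriv (hb : IsBackground Λ k₀ μ T L S) {t : ℝ} (ht : t ∈ L) :
    HasDerivAt (deriv S) (deriv (deriv S) t) t :=
  ((hb.contDiffOn_deriv.contDiffAt (hb.isOpen.mem_nhds ht)).differentiableAt (by simp)).hasDerivAt

/-- The first Friedmann equation also admits constant solutions, which need not satisfy the second.
They are excluded by the bang, since a positive constant does not tend to `0`. -/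
theorem not_constant (hb : IsBackground Λ k₀ μ T L S) {t : ℝ} (ht : t ∈ L) :
    ¬ ∀ s ∈ L, deriv S s = 0 := by
  intro h0
  have hc : ∀ s ∈ L, S s = S t := fun s hs =>
    eq_of_hasDerivAt_zero hb.isOpen hb.isPreconnected
      (fun u hu => (hb.hasDerivAt hu).congr_deriv (h0 u hu)) hs ht
  have hev : ∀ᶠ s in 𝓝[>] T, S s = S t := by
    filter_upwards [Ioc_mem_nhdsGT (hb.bang_lt t ht)] with s hs
    exact hc s (hb.past t ht hs)
  have h1 : Tendsto S (𝓝[>] T) (𝓝 (S t)) :=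
    tendsto_const_nhds.congr' (hev.mono fun s hs => hs.symm)
  exact (hb.pos t ht).ne (tendsto_nhds_unique hb.bang h1)

/-- The second Friedmann equation. -/
theorem acceleration (hb : IsBackground Λ k₀ μ T L S) {t : ℝ} (ht : t ∈ L) :
    deriv (deriv S) t = -μ / S t ^ 2 + Λ / 3 * S t := by
  -- `D` is the defect of the second equation. Differentiating the first gives only `D Ṡ = 0`, which
  -- is silent where `Ṡ` vanishes.
  set D : ℝ → ℝ := fun t => deriv (deriv S) t - (-μ / S t ^ 2 + Λ / 3 * S t) with hD
  have hDS : ∀ s ∈ L, D s * deriv S s = 0 := by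
    intro s hs
    have hp := (hb.pos s hs).ne'
    have e1 := (hb.hasDerivAt_deriv hs).pow 2
    have e2 := (((hb.hasDerivAt hs).inv hp).const_mul (2 * μ)).const_add (-k₀) |>.add
      (((hb.hasDerivAt hs).pow 2).const_mul (Λ / 3))
    have e3 : (deriv S ^ 2) =ᶠ[𝓝 s] ((fun x => -k₀ + 2 * μ * S⁻¹ x) + fun y => Λ / 3 * (S ^ 2) y) := by
      filter_upwards [hb.isOpen.mem_nhds hs] with u hu
      have := hb.friedmann u hu
      simp only [Pi.pow_apply, Pi.add_apply, Pi.inv_apply, this]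
      ring
    have e4 := e1.unique (e2.congr_of_eventuallyEq e3)
    simp only [hD]
    field_simp at e4 ⊢
    linear_combination e4 / 2
  have hDc : ContinuousOn D L := by
    have h2 : ContinuousOn (deriv (deriv S)) L :=
      (hb.contDiffOn_deriv.deriv_of_isOpen (m := 0) hb.isOpen (by simp)).continuousOn
    have h3 := hb.smooth.continuousOn
    exact h2.sub ((continuousOn_const.div (h3.pow 2) fun s hs =>
      pow_ne_zero 2 (hb.pos s hs).ne').add (continuousOn_const.mul h3))
  by_contra hne
  have hd : D t ≠ 0 := sub_ne_zero.2 hne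
  -- Near a point with `D ≠ 0` the velocity vanishes identically, so `S`, and with it `D`, is
  -- locally constant.
  have hloc : ∀ s ∈ L, D s ≠ 0 → ∀ᶠ u in 𝓝 s, D u = D s := by
    intro s hs h0
    obtain ⟨r, hr, hball⟩ := Metric.mem_nhds_iff.1
      ((hDc.isOpen_inter_preimage hb.isOpen isOpen_compl_singleton).mem_nhds ⟨hs, h0⟩)
    have hz : ∀ u ∈ Metric.ball s r, deriv S u = 0 := fun u hu =>
      (mul_eq_zero.1 (hDS u (hball hu).1)).resolve_left (hball hu).2
    have hz2 : ∀ u ∈ Metric.ball s r, deriv (deriv S) u = 0 := by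
      intro u hu
      have : deriv S =ᶠ[𝓝 u] fun _ => 0 :=
        (Metric.isOpen_ball.eventually_mem hu).mono hz
      rw [this.deriv_eq, deriv_const]
    filter_upwards [Metric.ball_mem_nhds s hr] with u hu
    have hs' := Metric.mem_ball_self (x := s) hr
    have : S u = S s := eq_of_hasDerivAt_zero Metric.isOpen_ball
      (convex_ball s r).isPreconnected
      (fun v hv => (hb.hasDerivAt (hball hv).1).congr_deriv (hz v hv)) hu hs'
    simp only [hD, hz2 u hu, hz2 s hs', this]
  -- By connectedness a nonzero value of `D` spreads over all of `L`, which forces `Ṡ = 0`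
  -- everywhere and contradicts `not_constant`.
  have hsub := hb.isPreconnected.subset_left_of_subset_union
    (isOpen_interior (s := {s | D s = D t}))
    (hDc.isOpen_inter_preimage hb.isOpen (isOpen_compl_singleton (x := D t)))
    (disjoint_left.2 fun s h1 h2 => h2.2 (interior_subset (s := {s | D s = D t}) h1))
    (fun s hs => by
      by_cases hst : D s = D t
      · exact Or.inl (mem_interior_iff_mem_nhds.2
          ((hloc s hs (hst ▸ hd)).mono fun u hu => hu.trans hst))
      · exact Or.inr ⟨hs, hst⟩)
    ⟨t, ht, mem_interior_iff_mem_nhds.2 (hloc t ht hd)⟩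
  refine hb.not_constant ht fun s hs => ?_
  have : D s = D t := interior_subset (s := {s | D s = D t}) (hsub hs)
  exact (mul_eq_zero.1 (hDS s hs)).resolve_left (this ▸ hd)

theorem hubble_sq (hb : IsBackground Λ k₀ μ T L S) {t : ℝ} (ht : t ∈ L) :
    hubble S t ^ 2 = -(k₀ / S t ^ 2) + 2 * (μ / S t ^ 3) + Λ / 3 := by
  have hp := (hb.pos t ht).ne'
  rw [hubble, div_pow, hb.friedmann t ht]
  field_simp

theorem hasDerivAt_hubble (hb : IsBackground Λ k₀ μ T L S) {t : ℝ} (ht : t ∈ L) :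
    HasDerivAt (hubble S) (k₀ / S t ^ 2 - 3 * μ / S t ^ 3) t := by
  have hp := (hb.pos t ht).ne'
  refine ((hb.hasDerivAt_deriv ht).div (hb.hasDerivAt ht) hp).congr_deriv ?_
  rw [hb.acceleration ht, ← pow_two, hb.friedmann t ht]
  field_simp
  ring

theorem isDensityMode_hubble (hb : IsBackground Λ k₀ μ T L S) :
    IsDensityMode μ L S (hubble S) := by
  refine ⟨(hb.contDiffOn_deriv.div hb.smooth fun t ht => (hb.pos t ht).ne').of_le
    ENat.LEInfty.out, fun t ht => ?_⟩
  have hp := (hb.pos t ht).ne'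
  have e1 : deriv (hubble S) =ᶠ[𝓝 t] fun u => k₀ / S u ^ 2 - 3 * μ / S u ^ 3 :=
    (hb.isOpen.eventually_mem ht).mono fun u hu => (hb.hasDerivAt_hubble hu).deriv
  have e2 := ((hasDerivAt_const t k₀).div ((hb.hasDerivAt ht).pow 2) (pow_ne_zero 2 hp)).sub
    ((hasDerivAt_const t (3 * μ)).div ((hb.hasDerivAt ht).pow 3) (pow_ne_zero 3 hp))
  have e3 : deriv (deriv (hubble S)) t = _ := e1.deriv_eq.trans e2.deriv
  rw [e3, (hb.hasDerivAt_hubble ht).deriv, hubble]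
  simp only [Pi.pow_apply]
  field_simp
  ring

/-- Abel's identity: the damping term `2 H` integrates to the factor `S²`. -/
theorem wronskian_eq (hb : IsBackground Λ k₀ μ T L S) (hF : IsDensityMode μ L S F)
    (hG : IsDensityMode μ L S G) {s t : ℝ} (hs : s ∈ L) (ht : t ∈ L) :
    S s ^ 2 * (F s * deriv G s - deriv F s * G s)
      = S t ^ 2 * (F t * deriv G t - deriv F t * G t) := by
  have hd : ∀ {F : ℝ → ℝ}, IsDensityMode μ L S F → ∀ u ∈ L,
      HasDerivAt F (deriv F u) u ∧ HasDerivAt (deriv F) (deriv (deriv F) u) u := by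
    intro F hF u hu
    refine ⟨(hF.differentiableAt hb.isOpen hu).hasDerivAt, ?_⟩
    have : ContDiffOn ℝ 1 (deriv F) L := hF.1.deriv_of_isOpen hb.isOpen (by norm_num)
    exact ((this.contDiffAt (hb.isOpen.mem_nhds hu)).differentiableAt one_ne_zero).hasDerivAt
  refine eq_of_hasDerivAt_zero (φ := fun u => S u ^ 2 * (F u * deriv G u - deriv F u * G u))
    hb.isOpen hb.isPreconnected (fun u hu => ?_) hs ht
  obtain ⟨f1, f2⟩ := hd hF u hu
  obtain ⟨g1, g2⟩ := hd hG u hu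
  refine (((hb.hasDerivAt hu).pow 2).mul ((f1.mul g2).sub (f2.mul g1))).congr_deriv ?_
  have hp := (hb.pos u hu).ne'
  have m1 := hF.2 u hu
  have m2 := hG.2 u hu
  have e1 : deriv (deriv F) u = 3 * μ / S u ^ 3 * F u - 2 * hubble S u * deriv F u := by
    linear_combination m1
  have e2 : deriv (deriv G) u = 3 * μ / S u ^ 3 * G u - 2 * hubble S u * deriv G u := by
    linear_combination m2
  simp only [e1, e2, hubble, Pi.mul_apply, Pi.pow_apply, Pi.sub_apply]
  field_simp
  ring

/-- The potential of the Friedmann equation stays positive during the initial expansion. -/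
theorem expanding_of_potential_pos (hb : IsBackground Λ k₀ μ T L S) {t : ℝ} (ht : t ∈ L)
    (hV : ∀ s ∈ Ioc 0 (S t), 0 < -k₀ + 2 * μ / s + Λ / 3 * s ^ 2) (h0 : 0 < deriv S t) :
    ∀ s ∈ Ioc T t, 0 < deriv S s := by
  intro s hs
  by_contra hneg
  have hsub : Icc s t ⊆ L := fun u hu => hb.past t ht ⟨hs.1.trans_le hu.1, hu.2⟩
  have hcont : ContinuousOn (deriv S) (Icc s t) := hb.contDiffOn_deriv.continuousOn.mono hsub
  have hcomp : IsCompact {u ∈ Icc s t | deriv S u ≤ 0} :=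
    isCompact_Icc.of_isClosed_subset
      (hcont.preimage_isClosed_of_isClosed isClosed_Icc isClosed_Iic) (fun u hu => hu.1)
  -- `u` is the last instant before `t` at which `S` does not expand. Afterwards `S` increases, so
  -- `S u < S t` and the potential is positive at `S u`; thus `Ṡ u ≠ 0`. The intermediate value
  -- theorem, however, leaves `u` as the only possible zero of `Ṡ` on `[u, t]`.
  obtain ⟨u, ⟨hu1, hu2⟩, hmax⟩ := hcomp.exists_isGreatest
    ⟨s, left_mem_Icc.2 hs.2, not_lt.1 hneg⟩
  have hut : u < t := lt_of_le_of_ne hu1.2 fun h => hu2.not_gt (h ▸ h0)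
  have hpos : ∀ v ∈ Ioc u t, 0 < deriv S v := fun v hv => by
    by_contra h
    exact hv.1.not_ge (hmax ⟨⟨hu1.1.trans hv.1.le, hv.2⟩, not_lt.1 h⟩)
  have hsub' : Icc u t ⊆ Icc s t := Icc_subset_Icc_left hu1.1
  have hmono : S u < S t := by
    refine strictMonoOn_of_deriv_pos (convex_Icc u t)
      (hb.smooth.continuousOn.mono (hsub'.trans hsub)) (fun v hv => ?_)
      (left_mem_Icc.2 hut.le) (right_mem_Icc.2 hut.le) hut
    rw [interior_Icc] at hv
    exact hpos v ⟨hv.1, hv.2.le⟩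
  have hne : deriv S u ≠ 0 := fun h => by
    have h1 := hb.friedmann u (hsub hu1)
    have h2 := hV (S u) ⟨hb.pos u (hsub hu1), hmono.le⟩
    rw [h] at h1
    linarith
  obtain ⟨v, hv, hv0⟩ := intermediate_value_Icc hut.le (hcont.mono hsub')
    (show (0 : ℝ) ∈ Icc (deriv S u) (deriv S t) from ⟨hu2, h0.le⟩)
  rcases hv.1.eq_or_lt with rfl | h
  · exact hne hv0
  · exact (hpos v ⟨h, hv.2⟩).ne' hv0

end IsBackground

/-- The term `2 m / s` dominates for small `s`. Uniformity over `m > μ / 2` lets one bound `a` serve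
all labels near a given one, as differentiation in the label requires. -/
theorem exists_potential_pos (hμ : 0 < μ) (Λ k₀ : ℝ) :
    ∃ a > 0, ∀ m > μ / 2, ∀ s ∈ Ioc 0 a, 0 < -k₀ + 2 * m / s + Λ / 3 * s ^ 2 := by
  have hc : Tendsto (fun s : ℝ => μ - k₀ * s + Λ / 3 * s ^ 3) (𝓝 0) (𝓝 μ) := by
    have : Continuous (fun s : ℝ => μ - k₀ * s + Λ / 3 * s ^ 3) := by fun_prop
    simpa using this.tendsto 0
  obtain ⟨r, hr, hball⟩ := Metric.mem_nhds_iff.1 (hc.eventually (lt_mem_nhds hμ))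
  refine ⟨r / 2, by positivity, fun m hm s hs => ?_⟩
  have h1 : 0 < μ - k₀ * s + Λ / 3 * s ^ 3 := hball (by
    rw [Metric.mem_ball, Real.dist_eq, sub_zero, abs_of_pos hs.1]
    linarith [hs.2])
  have hs0 := hs.1
  have h2 : -k₀ + 2 * m / s + Λ / 3 * s ^ 2 = (2 * m - k₀ * s + Λ / 3 * s ^ 3) / s := by
    field_simp
    ring
  rw [h2]
  exact div_pos (by linarith) hs0

/-- As `S → 0` at the bang, an instant near it has a smaller value of `S` than a later one; the mean
value theorem provides an instant of positive velocity between them. -/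
theorem IsBackground.exists_expanding (hb : IsBackground Λ k₀ μ T L S) (hL : L.Nonempty)
    {a : ℝ} (ha : 0 < a) : ∃ t ∈ L, S t < a ∧ 0 < deriv S t := by
  obtain ⟨t₀, ht₀⟩ := hL
  have hT := hb.bang_lt t₀ ht₀
  have h1 : ∀ᶠ s in 𝓝[>] T, S s < a := hb.bang.eventually (gt_mem_nhds ha)
  obtain ⟨t₁, ht₁, hsub⟩ := mem_nhdsGT_iff_exists_Ioc_subset.1
    (inter_mem h1 (Ioc_mem_nhdsGT hT))
  have ht₁' : T < t₁ := ht₁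
  have hsubL : Ioc T t₁ ⊆ L := fun s hs => hb.past t₀ ht₀ (hsub hs).2
  have ht₁L : t₁ ∈ L := hsubL ⟨ht₁', le_rfl⟩
  have h2 : ∀ᶠ s in 𝓝[>] T, S s < S t₁ := hb.bang.eventually (gt_mem_nhds (hb.pos t₁ ht₁L))
  obtain ⟨s, hs1, hs2⟩ := (h2.and (Ioo_mem_nhdsGT ht₁')).exists
  have hsub2 : Icc s t₁ ⊆ L := fun u hu => hsubL ⟨hs2.1.trans_le hu.1, hu.2⟩
  obtain ⟨c, hc, hd⟩ := exists_deriv_eq_slope S hs2.2 (hb.smooth.continuousOn.mono hsub2)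
    (fun u hu => (hb.differentiableAt (hsub2 ⟨hu.1.le, hu.2.le⟩)).differentiableWithinAt)
  have hcT : c ∈ Ioc T t₁ := ⟨hs2.1.trans hc.1, hc.2.le⟩
  refine ⟨c, hsubL hcT, (hsub hcT).1, ?_⟩
  rw [hd]
  exact div_pos (sub_pos.2 hs1) (sub_pos.2 hs2.2)

end background
end Szekeres

namespace Szekeres

/-! ### The time integral of a background and its parameter derivatives -/

/-- `s` times the potential of the Friedmann equation, `2 m - k s + Λ s³ / 3`. -/
noncomputable def potential (Λ k m s : ℝ) : ℝ := 2 * m - k * s + Λ / 3 * s ^ 3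

theorem potential_div {Λ k m s : ℝ} (hs : s ≠ 0) :
    -k + 2 * m / s + Λ / 3 * s ^ 2 = potential Λ k m s / s := by
  rw [potential]
  field_simp
  ring

theorem continuous_potential (Λ k : ℝ) : Continuous fun p : ℝ × ℝ => potential Λ k p.1 p.2 := by
  unfold potential
  fun_prop

theorem continuous_potential_right (Λ k m : ℝ) : Continuous (potential Λ k m) :=
  (continuous_potential Λ k).comp (by fun_prop : Continuous fun s : ℝ => (m, s))

section

variable {Λ k m : ℝ}

theorem hasDerivAt_primitive {g : ℝ → ℝ} {U : Set ℝ} (hU : IsOpen U) (hg : ContinuousOn g U)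
    {a : ℝ} (ha : uIcc 0 a ⊆ U) : HasDerivAt (fun u => ∫ s in (0 : ℝ)..u, g s) (g a) a :=
  intervalIntegral.integral_hasDerivAt_right ((hg.mono ha).intervalIntegrable)
    (hg.stronglyMeasurableAtFilter hU a (ha right_mem_uIcc))
    (hg.continuousAt (hU.mem_nhds (ha right_mem_uIcc)))

theorem isOpen_potential_pos : IsOpen {s | 0 < potential Λ k m s} :=
  isOpen_lt continuous_const (continuous_potential_right Λ k m)

/-- One family covers the integrands of the age `(1,1)`, of the growing mode `(3,3)` and of the mass
derivative `(1,3)`. Written with `potential` they have no singularity at `s = 0`; as `√` is `0` on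
negative numbers, they are even continuous on a neighbourhood of `0` when `m > 0`. -/
theorem continuousOn_sqrt_pow_div (i j : ℕ) :
    ContinuousOn (fun s => √s ^ i / √(potential Λ k m s) ^ j) {s | 0 < potential Λ k m s} := by
  refine ((Real.continuous_sqrt.pow i).continuousOn).div
    ((Real.continuous_sqrt.comp (continuous_potential_right Λ k m)).pow j).continuousOn ?_
  intro s hs
  exact pow_ne_zero j (Real.sqrt_ne_zero'.2 hs)

theorem uIcc_subset_of_pos {a : ℝ} (ha : 0 < a) (hpos : ∀ s ∈ Icc 0 a, 0 < potential Λ k m s) :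
    uIcc 0 a ⊆ {s | 0 < potential Λ k m s} := by
  rw [uIcc_of_le ha.le]
  exact hpos

/-- Differentiation of the time integral with respect to the scale factor. -/
theorem hasDerivAt_integral_sqrt {a : ℝ} (ha : 0 < a)
    (hpos : ∀ s ∈ Icc 0 a, 0 < potential Λ k m s) (i j : ℕ) :
    HasDerivAt (fun u => ∫ s in (0 : ℝ)..u, √s ^ i / √(potential Λ k m s) ^ j)
      (√a ^ i / √(potential Λ k m a) ^ j) a :=
  hasDerivAt_primitive isOpen_potential_pos (continuousOn_sqrt_pow_div i j)
    (uIcc_subset_of_pos ha hpos)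

theorem tendsto_integral_sqrt (hm : 0 < m) (i j : ℕ) :
    Tendsto (fun u => ∫ s in (0 : ℝ)..u, √s ^ i / √(potential Λ k m s) ^ j) (𝓝 0) (𝓝 0) := by
  have h : HasDerivAt (fun u => ∫ s in (0 : ℝ)..u, √s ^ i / √(potential Λ k m s) ^ j) _ 0 :=
    hasDerivAt_primitive isOpen_potential_pos (continuousOn_sqrt_pow_div i j)
      (by simp [potential, hm])
  simpa using h.continuousAt.tendsto

/-- The integral in the definition of the growing mode. -/
theorem integral_growing_eq {a : ℝ} (ha : 0 < a) :
    ∫ s in (0 : ℝ)..a, (√(-k + 2 * m / s + Λ / 3 * s ^ 2) ^ 3)⁻¹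
      = ∫ s in (0 : ℝ)..a, √s ^ 3 / √(potential Λ k m s) ^ 3 := by
  refine intervalIntegral.integral_congr_ae (Eventually.of_forall fun s hs => ?_)
  rw [uIoc_of_le ha.le] at hs
  rw [potential_div hs.1.ne', Real.sqrt_div' _ hs.1.le, div_pow, inv_div]

/-- Integration by parts of the time integral. -/
theorem sqrt_div_eq_integral {a : ℝ} (ha : 0 < a)
    (hpos : ∀ s ∈ Icc 0 a, 0 < potential Λ k m s) :
    √a ^ 3 / √(potential Λ k m a)
      = 3 * m * (∫ s in (0 : ℝ)..a, √s ^ 1 / √(potential Λ k m s) ^ 3)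
        - k * ∫ s in (0 : ℝ)..a, √s ^ 3 / √(potential Λ k m s) ^ 3 := by
  have hU := uIcc_subset_of_pos ha hpos
  have i1 := ((continuousOn_sqrt_pow_div (Λ := Λ) (k := k) (m := m) 1 3).mono
    hU).intervalIntegrable (μ := MeasureTheory.volume)
  have i3 := ((continuousOn_sqrt_pow_div (Λ := Λ) (k := k) (m := m) 3 3).mono
    hU).intervalIntegrable (μ := MeasureTheory.volume)
  have hc : ContinuousOn (fun s => √s ^ 3 / √(potential Λ k m s)) (Icc 0 a) := by
    have := (continuousOn_sqrt_pow_div (Λ := Λ) (k := k) (m := m) 3 1).mono hU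
    rw [uIcc_of_le ha.le] at this
    simpa using this
  -- With `N` the potential, `3 N - s N' = 6 m - 2 k s`: the terms in `Λ` cancel, which is why only
  -- the exponents `1` and `3` survive in the numerators.
  have hd : ∀ s ∈ Ioo 0 a, HasDerivAt (fun s => √s ^ 3 / √(potential Λ k m s))
      (3 * m * (√s ^ 1 / √(potential Λ k m s) ^ 3) - k * (√s ^ 3 / √(potential Λ k m s) ^ 3)) s := by
    intro s hs
    have hN := hpos s ⟨hs.1.le, hs.2.le⟩
    have dN : HasDerivAt (potential Λ k m) (-k + Λ * s ^ 2) s := by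
      have := (((hasDerivAt_id s).const_mul k).const_sub (2 * m)).add
        (((hasDerivAt_id s).pow 3).const_mul (Λ / 3))
      refine this.congr_deriv ?_
      simp
      ring
    have h1 := (((hasDerivAt_id s).sqrt hs.1.ne').pow 3).div (dN.sqrt hN.ne')
      (Real.sqrt_ne_zero'.2 hN)
    refine h1.congr_deriv ?_
    have e1 : s = √s ^ 2 := (Real.sq_sqrt hs.1.le).symm
    have e2 : 2 * m - k * √s ^ 2 + Λ / 3 * (√s ^ 2) ^ 3 = √(potential Λ k m s) ^ 2 := by
      rw [Real.sq_sqrt hN.le, ← e1, potential]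
    have p1 : √s ≠ 0 := Real.sqrt_ne_zero'.2 hs.1
    have p2 : √(potential Λ k m s) ≠ 0 := Real.sqrt_ne_zero'.2 hN
    simp only [id, Pi.pow_apply]
    rw [show (-k + Λ * s ^ 2) = -k + Λ * (√s ^ 2) ^ 2 by rw [← e1]]
    set q := √(potential Λ k m s)
    set p := √s
    field_simp
    push_cast
    linear_combination (-3 * p ^ 2) * e2
  have := intervalIntegral.integral_eq_sub_of_hasDerivAt_of_le ha.le hc hd
    ((i1.const_mul (3 * m)).sub (i3.const_mul k))
  rw [intervalIntegral.integral_sub (i1.const_mul _) (i3.const_mul _),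
    intervalIntegral.integral_const_mul, intervalIntegral.integral_const_mul] at this
  rw [this]
  simp

/-- Differentiation of the time integral with respect to the mass parameter. -/
theorem hasDerivAt_integral_mass {a : ℝ} (ha : 0 < a)
    (hpos : ∀ s ∈ Icc 0 a, 0 < potential Λ k m s) :
    HasDerivAt (fun m' => ∫ s in (0 : ℝ)..a, √s / √(potential Λ k m' s))
      (-∫ s in (0 : ℝ)..a, √s ^ 1 / √(potential Λ k m s) ^ 3) m := by
  obtain ⟨s₀, hs₀, hmin⟩ := isCompact_Icc.exists_isMinOn (nonempty_Icc.2 ha.le)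
    (continuous_potential_right Λ k m).continuousOn
  set δ := potential Λ k m s₀ with hδ
  have hδ0 : 0 < δ := hpos s₀ hs₀
  -- The potential is affine in the mass with slope `2`, so lowering `m` by less than `δ / 4` costs
  -- less than `δ / 2`. This gives the uniform dominating function.
  have hlow : ∀ m' ∈ Ioi (m - δ / 4), ∀ s ∈ Icc 0 a, δ / 2 ≤ potential Λ k m' s := by
    intro m' hm' s hs
    have h1 : δ ≤ potential Λ k m s := hmin hs
    have h2 : m - δ / 4 < m' := hm'
    unfold potential at h1 ⊢
    linarith
  have hUm : ∀ m' ∈ Ioi (m - δ / 4), ∀ s ∈ Icc 0 a, 0 < potential Λ k m' s :=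
    fun m' hm' s hs => (half_pos hδ0).trans_le (hlow m' hm' s hs)
  have hnhds : Ioi (m - δ / 4) ∈ 𝓝 m := Ioi_mem_nhds (by linarith)
  have hcont : ∀ m' ∈ Ioi (m - δ / 4), ∀ i j : ℕ, ContinuousOn
      (fun s => √s ^ i / √(potential Λ k m' s) ^ j) (uIcc 0 a) := fun m' hm' i j =>
    (continuousOn_sqrt_pow_div i j).mono (uIcc_subset_of_pos ha (hUm m' hm'))
  have hcont1 : ∀ m' ∈ Ioi (m - δ / 4), ContinuousOn
      (fun s => √s / √(potential Λ k m' s)) (uIcc 0 a) := fun m' hm' => by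
    simpa using hcont m' hm' 1 1
  have key := intervalIntegral.hasDerivAt_integral_of_dominated_loc_of_deriv_le
    (μ := MeasureTheory.volume) (a := 0) (b := a) (x₀ := m)
    (F := fun m' s => √s / √(potential Λ k m' s))
    (F' := fun m' s => -(√s ^ 1 / √(potential Λ k m' s) ^ 3))
    (bound := fun s => √s ^ 1 / √(δ / 2) ^ 3) hnhds
    (Filter.eventually_of_mem hnhds fun m' hm' =>
      (((hcont1 m' hm').mono uIoc_subset_uIcc).aestronglyMeasurable measurableSet_uIoc))
    ((hcont1 m (mem_of_mem_nhds hnhds)).intervalIntegrable)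
    ((((hcont m (mem_of_mem_nhds hnhds) 1 3).neg).mono uIoc_subset_uIcc).aestronglyMeasurable
      measurableSet_uIoc)
    (Eventually.of_forall fun s hs m' hm' => by
      rw [uIoc_of_le ha.le] at hs
      have h1 := hlow m' hm' s ⟨hs.1.le, hs.2⟩
      rw [norm_neg, Real.norm_of_nonneg (by positivity)]
      have h2 : 0 < √(δ / 2) := Real.sqrt_pos.2 (half_pos hδ0)
      gcongr)
    ((Continuous.continuousOn (by fun_prop)).intervalIntegrable)
    (Eventually.of_forall fun s hs m' hm' => by
      rw [uIoc_of_le ha.le] at hs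
      have hN := hUm m' hm' s ⟨hs.1.le, hs.2⟩
      have dN : HasDerivAt (fun m' => potential Λ k m' s) 2 m' := by
        have := (((hasDerivAt_id m').const_mul 2).sub_const (k * s)).add_const (Λ / 3 * s ^ 3)
        simpa [potential] using this
      have p2 : √(potential Λ k m' s) ≠ 0 := Real.sqrt_ne_zero'.2 hN
      refine ((hasDerivAt_const m' (√s)).div (dN.sqrt hN.ne') p2).congr_deriv ?_
      field_simp
      ring)
  exact key.2.congr_deriv intervalIntegral.integral_neg

/-- Total derivative of the time integral. -/
theorem hasDerivAt_integral_total {σ M : ℝ → ℝ} {σ' M' ξ : ℝ} (hσ : HasDerivAt σ σ' ξ)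
    (hM : HasDerivAt M M' ξ) (h0 : 0 < σ ξ)
    (hpos : ∀ s ∈ Icc 0 (σ ξ), 0 < potential Λ k (M ξ) s) :
    HasDerivAt (fun ζ => ∫ s in (0 : ℝ)..σ ζ, √s / √(potential Λ k (M ζ) s))
      (√(σ ξ) / √(potential Λ k (M ξ) (σ ξ)) * σ'
        - M' * ∫ s in (0 : ℝ)..σ ξ, √s ^ 1 / √(potential Λ k (M ξ) s) ^ 3) ξ := by
  have h1 := (hasDerivAt_integral_mass h0 hpos).comp ξ hM
  set τ : ℝ × ℝ → ℝ := fun p => √p.2 / √(potential Λ k p.1 p.2) with hτ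
  have hN := hpos (σ ξ) ⟨h0.le, le_rfl⟩
  have hτc : ContinuousAt τ (M ξ, σ ξ) := by
    refine (Real.continuous_sqrt.comp continuous_snd).continuousAt.div
      (Real.continuous_sqrt.comp (continuous_potential Λ k)).continuousAt ?_
    exact Real.sqrt_ne_zero'.2 hN
  -- In the contribution of the moving end point the integrand varies with `ζ` too, but joint
  -- continuity at `(M ξ, σ ξ)` makes its deviation from the value there negligible to first order.
  have h2 : HasDerivAt (fun ζ => ∫ s in σ ξ..σ ζ, √s / √(potential Λ k (M ζ) s))
      (τ (M ξ, σ ξ) * σ') ξ := by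
    rw [hasDerivAt_iff_isLittleO]
    have e1 : (fun ζ => (∫ s in σ ξ..σ ζ, √s / √(potential Λ k (M ζ) s))
        - τ (M ξ, σ ξ) * (σ ζ - σ ξ)) =o[𝓝 ξ] fun ζ => ζ - ξ := by
      refine Asymptotics.IsLittleO.trans_isBigO (g := fun ζ => σ ζ - σ ξ) ?_
        hσ.differentiableAt.isBigO_sub
      rw [Asymptotics.isLittleO_iff]
      intro ε hε
      obtain ⟨r, hr, hball⟩ := Metric.mem_nhds_iff.1
        (inter_mem (hτc.eventually (Metric.ball_mem_nhds _ hε))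
          (((continuous_potential Λ k).tendsto (M ξ, σ ξ)).eventually (lt_mem_nhds hN)))
      have c1 := hM.continuousAt.eventually (Metric.ball_mem_nhds _ hr)
      have c2 := hσ.continuousAt.eventually (Metric.ball_mem_nhds _ hr)
      filter_upwards [c1, c2] with ζ hζ1 hζ2
      have hin : ∀ s ∈ uIcc (σ ξ) (σ ζ), (M ζ, s) ∈ Metric.ball (M ξ, σ ξ) r := by
        intro s hs
        rw [← ball_prod_same]
        refine ⟨hζ1, ?_⟩
        exact (convex_ball (σ ξ) r).ordConnected.uIcc_subset (Metric.mem_ball_self hr) hζ2 hs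
      have hint : IntervalIntegrable (fun s => √s / √(potential Λ k (M ζ) s))
          MeasureTheory.volume (σ ξ) (σ ζ) := by
        refine ContinuousOn.intervalIntegrable ?_
        have := (continuousOn_sqrt_pow_div (Λ := Λ) (k := k) (m := M ζ) 1 1).mono
          (fun s hs => (hball (hin s hs)).2)
        simpa using this
      have e2 : (∫ s in σ ξ..σ ζ, √s / √(potential Λ k (M ζ) s)) - τ (M ξ, σ ξ) * (σ ζ - σ ξ)
          = ∫ s in σ ξ..σ ζ, (√s / √(potential Λ k (M ζ) s) - τ (M ξ, σ ξ)) := by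
        rw [intervalIntegral.integral_sub hint (by simp), intervalIntegral.integral_const,
          smul_eq_mul, mul_comm]
      rw [e2, Real.norm_eq_abs (σ ζ - σ ξ)]
      refine intervalIntegral.norm_integral_le_of_norm_le_const fun s hs => ?_
      have := (hball (hin s (uIoc_subset_uIcc hs))).1
      exact (mem_ball_iff_norm.1 this).le
    have e3 := (hasDerivAt_iff_isLittleO.1 hσ).const_mul_left (τ (M ξ, σ ξ))
    refine (e1.add e3).congr_left fun ζ => ?_
    simp only [intervalIntegral.integral_same, smul_eq_mul]
    ring
  have h3 := (h1.add h2).congr_deriv (g' := √(σ ξ) / √(potential Λ k (M ξ) (σ ξ)) * σ'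
    - M' * ∫ s in (0 : ℝ)..σ ξ, √s ^ 1 / √(potential Λ k (M ξ) s) ^ 3) (by
      simp only [hτ]
      ring)
  -- Splitting the integral at `σ ξ` needs a positive potential for the mass `M ζ` on both pieces,
  -- which holds only for `ζ` near `ξ`.
  refine h3.congr_of_eventuallyEq ?_
  have hlim : Tendsto (fun ζ => (M ζ, σ ζ)) (𝓝 ξ) (𝓝 (M ξ, σ ξ)) :=
    hM.continuousAt.prodMk_nhds hσ.continuousAt
  obtain ⟨s₀, hs₀, hmin⟩ := isCompact_Icc.exists_isMinOn (nonempty_Icc.2 h0.le)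
    (continuous_potential_right Λ k (M ξ)).continuousOn
  set δ := potential Λ k (M ξ) s₀
  have hδ0 : 0 < δ := hpos s₀ hs₀
  have hM2 : ∀ᶠ ζ in 𝓝 ξ, M ξ - δ / 4 < M ζ :=
    hM.continuousAt.eventually (lt_mem_nhds (by linarith))
  obtain ⟨r, hr, hball⟩ := Metric.mem_nhds_iff.1
    (((continuous_potential Λ k).tendsto (M ξ, σ ξ)).eventually (lt_mem_nhds hN))
  filter_upwards [hM2, hM.continuousAt.eventually (Metric.ball_mem_nhds _ hr),
    hσ.continuousAt.eventually (Metric.ball_mem_nhds _ hr)] with ζ hζ hζ1 hζ2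
  have p1 : ∀ s ∈ uIcc 0 (σ ξ), 0 < potential Λ k (M ζ) s := by
    intro s hs
    rw [uIcc_of_le h0.le] at hs
    have : δ ≤ potential Λ k (M ξ) s := hmin hs
    unfold potential at this ⊢
    linarith
  have p2 : ∀ s ∈ uIcc (σ ξ) (σ ζ), 0 < potential Λ k (M ζ) s := by
    intro s hs
    refine hball (a := (M ζ, s)) ?_
    rw [← ball_prod_same]
    exact ⟨hζ1, (convex_ball (σ ξ) r).ordConnected.uIcc_subset (Metric.mem_ball_self hr) hζ2 hs⟩
  have q : ∀ u v : ℝ, (∀ s ∈ uIcc u v, 0 < potential Λ k (M ζ) s) →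
      IntervalIntegrable (fun s => √s / √(potential Λ k (M ζ) s)) MeasureTheory.volume u v := by
    intro u v h
    refine ContinuousOn.intervalIntegrable ?_
    simpa using (continuousOn_sqrt_pow_div (Λ := Λ) (k := k) (m := M ζ) 1 1).mono h
  exact (intervalIntegral.integral_add_adjacent_intervals (q _ _ p1) (q _ _ p2)).symm

end

section background

variable {Λ k₀ μ T : ℝ} {L : Set ℝ} {S F : ℝ → ℝ}

/-- Every `s` in `(0, S t]` is the scale factor at some earlier time, where the potential equals `s
Ṡ² > 0`; at `s = 0` it is `2 μ`. -/
theorem potential_pos_of_expanding (hb : IsBackground Λ k₀ μ T L S) {t : ℝ} (ht : t ∈ L)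
    (he : ∀ s ∈ Ioc T t, 0 < deriv S s) :
    ∀ s ∈ Icc 0 (S t), 0 < potential Λ k₀ μ s := by
  intro s hs
  rcases hs.1.eq_or_lt with rfl | h0
  · simp [potential, hb.mu_pos]
  have hT := hb.bang_lt t ht
  obtain ⟨u, hu, hu2⟩ := ((hb.bang.eventually (gt_mem_nhds h0)).and
    (Ioo_mem_nhdsGT hT)).exists
  have hsub : Icc u t ⊆ Ioc T t := fun v hv => ⟨hu2.1.trans_le hv.1, hv.2⟩
  obtain ⟨v, hv, rfl⟩ := intermediate_value_Icc hu2.2.le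
    (hb.smooth.continuousOn.mono (hsub.trans (hb.past t ht))) (⟨hu.le, hs.2⟩ : s ∈ Icc (S u) (S t))
  have h1 := hb.friedmann v (hb.past t ht (hsub hv))
  rw [potential_div h0.ne'] at h1
  have h2 : 0 < potential Λ k₀ μ (S v) / S v := h1 ▸ pow_pos (he v (hsub hv)) 2
  exact (div_pos_iff_of_pos_right h0).1 h2

theorem deriv_eq_sqrt (hb : IsBackground Λ k₀ μ T L S) {t : ℝ} (ht : t ∈ L)
    (he : 0 < deriv S t) : deriv S t = √(potential Λ k₀ μ (S t)) / √(S t) := by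
  rw [← Real.sqrt_div' _ (hb.pos t ht).le, ← potential_div (hb.pos t ht).ne', ← hb.friedmann t ht,
    Real.sqrt_sq he.le]

/-- The Friedmann equation is separable: the integral up to `S u` minus `u` has derivative zero
while `S` expands, and tends to `-T` at the bang. -/
theorem age_eq_integral (hb : IsBackground Λ k₀ μ T L S) {t : ℝ} (ht : t ∈ L)
    (he : ∀ s ∈ Ioc T t, 0 < deriv S s) :
    ∫ s in (0 : ℝ)..S t, √s / √(potential Λ k₀ μ s) = t - T := by
  have hT := hb.bang_lt t ht
  set φ : ℝ → ℝ := fun u => (∫ s in (0 : ℝ)..S u, √s ^ 1 / √(potential Λ k₀ μ s) ^ 1) - u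
  have hd : ∀ u ∈ Ioc T t, HasDerivAt φ 0 u := by
    intro u hu
    have huL := hb.past t ht hu
    have hpos := potential_pos_of_expanding hb huL fun v hv => he v ⟨hv.1, hv.2.trans hu.2⟩
    have hS := hb.pos u huL
    have hN := hpos (S u) ⟨hS.le, le_rfl⟩
    refine (((hasDerivAt_integral_sqrt hS hpos 1 1).comp u (hb.hasDerivAt huL)).sub
      (hasDerivAt_id u)).congr_deriv ?_
    rw [deriv_eq_sqrt hb huL (he u hu)]
    have p1 : √(S u) ≠ 0 := Real.sqrt_ne_zero'.2 hS
    have p2 : √(potential Λ k₀ μ (S u)) ≠ 0 := Real.sqrt_ne_zero'.2 hN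
    field_simp
    ring
  have hconst : ∀ u ∈ Ioc T t, φ u = φ t := by
    intro u hu
    rcases hu.2.eq_or_lt with rfl | h
    · rfl
    have hc : ContinuousOn φ (Icc u t) := fun v hv =>
      (hd v ⟨hu.1.trans_le hv.1, hv.2⟩).continuousAt.continuousWithinAt
    obtain ⟨c, hc, hs⟩ := exists_hasDerivAt_eq_slope φ (fun _ => 0) h hc fun v hv =>
      hd v ⟨hu.1.trans hv.1, hv.2.le⟩
    have := (div_eq_zero_iff.1 hs.symm).resolve_right (sub_ne_zero.2 h.ne')
    linarith
  have h1 : Tendsto φ (𝓝[>] T) (𝓝 (0 - T)) :=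
    ((tendsto_integral_sqrt hb.mu_pos 1 1).comp hb.bang).sub
      (tendsto_id.mono_left nhdsWithin_le_nhds)
  have h2 : Tendsto φ (𝓝[>] T) (𝓝 (φ t)) := by
    refine tendsto_const_nhds.congr' ?_
    filter_upwards [Ioc_mem_nhdsGT hT] with u hu
    exact (hconst u hu).symm
  have h3 := tendsto_nhds_unique h1 h2
  simp only [φ, pow_one] at h3
  linarith

theorem growing_eq (hb : IsBackground Λ k₀ μ T L S) (hF : IsGrowingMode Λ k₀ μ T L S F) {t : ℝ}
    (ht : t ∈ L) (he : ∀ s ∈ Ioc T t, 0 < deriv S s) :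
    F t = hubble S t * ∫ s in (0 : ℝ)..S t, √s ^ 3 / √(potential Λ k₀ μ s) ^ 3 := by
  rw [hF.2 t ht he, integral_growing_eq (hb.pos t ht)]

/-- The Wronskian of the decaying and the growing mode. -/
theorem wronskian_growing (hb : IsBackground Λ k₀ μ T L S) (hF : IsGrowingMode Λ k₀ μ T L S F)
    {t : ℝ} (ht : t ∈ L) :
    S t ^ 2 * (hubble S t * deriv F t - (k₀ / S t ^ 2 - 3 * μ / S t ^ 3) * F t) = 1 := by
  obtain ⟨a, ha, hV⟩ := exists_potential_pos hb.mu_pos Λ k₀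
  obtain ⟨t₁, h1, h2, h3⟩ := hb.exists_expanding ⟨t, ht⟩ ha
  have he := hb.expanding_of_potential_pos h1
    (fun s hs => hV μ (half_lt_self hb.mu_pos) s ⟨hs.1, hs.2.trans h2.le⟩) h3
  have hT := hb.bang_lt t₁ h1
  have hw := hb.wronskian_eq hb.isDensityMode_hubble hF.1 ht h1
  rw [(hb.hasDerivAt_hubble ht).deriv, (hb.hasDerivAt_hubble h1).deriv] at hw
  rw [hw]
  clear hw
  -- At an interior instant the closed form of the growing mode holds in a neighbourhood and may be
  -- differentiated. There the integrand is `Ṡ⁻³`, so the Wronskian is `S² H² Ṡ⁻³ Ṡ = 1`.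
  obtain ⟨u, hu⟩ := nonempty_Ioo.2 hT
  have huL : u ∈ L := hb.past t₁ h1 ⟨hu.1, hu.2.le⟩
  have hw := hb.wronskian_eq hb.isDensityMode_hubble hF.1 h1 huL
  rw [(hb.hasDerivAt_hubble huL).deriv, (hb.hasDerivAt_hubble h1).deriv] at hw
  rw [hw]
  have hpos := potential_pos_of_expanding hb huL fun v hv => he v ⟨hv.1, hv.2.trans hu.2.le⟩
  have hS := hb.pos u huL
  have hN := hpos (S u) ⟨hS.le, le_rfl⟩
  have d1 := (hb.hasDerivAt_hubble huL).mul
    ((hasDerivAt_integral_sqrt hS hpos 3 3).comp u (hb.hasDerivAt huL))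
  have hev : F =ᶠ[𝓝 u] (hubble S) *
      ((fun a => ∫ s in (0 : ℝ)..a, √s ^ 3 / √(potential Λ k₀ μ s) ^ 3) ∘ S) := by
    filter_upwards [Ioo_mem_nhds hu.1 hu.2] with v hv
    exact growing_eq hb hF (hb.past t₁ h1 ⟨hv.1, hv.2.le⟩)
      fun w hw => he w ⟨hw.1, hw.2.trans hv.2.le⟩
  rw [hev.deriv_eq, d1.deriv, hev.eq_of_nhds]
  simp only [Pi.mul_apply, Function.comp_apply, hubble]
  rw [deriv_eq_sqrt hb huL (he u ⟨hu.1, hu.2.le⟩)]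
  have p1 : √(S u) ≠ 0 := Real.sqrt_ne_zero'.2 hS
  have p2 : √(potential Λ k₀ μ (S u)) ≠ 0 := Real.sqrt_ne_zero'.2 hN
  field_simp
  ring

end background
end Szekeres

namespace Szekeres

/-! ### Smooth partial derivatives, uniqueness of density modes, and the label derivative of the
scale factor -/

section smooth

variable {n : ℕ} {φ φ₁ : (Fin n → ℝ) → ℝ} {U : Set (Fin n → ℝ)}

theorem contDiffOn_pd (i : Fin n) (hU : IsOpen U) (h : ContDiffOn ℝ ∞ φ U) :
    ContDiffOn ℝ ∞ (pd i φ) U := by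
  have h1 : ContDiffOn ℝ ∞ (fun y => fderiv ℝ φ y (Pi.single i 1)) U :=
    (h.fderiv_of_isOpen hU (by simp)).clm_apply contDiffOn_const
  exact h1.congr fun y hy =>
    pd_eq_fderiv i ((h.contDiffAt (hU.mem_nhds hy)).differentiableAt (by simp))

theorem hasPd_of_contDiffOn (i : Fin n) (hU : IsOpen U) (h : ContDiffOn ℝ ∞ φ U) {x : Fin n → ℝ}
    (hx : x ∈ U) : HasPd i φ (pd i φ x) x :=
  hasPd_pd i ((h.contDiffAt (hU.mem_nhds hx)).differentiableAt (by simp))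

theorem pd_comm_of_contDiffOn (i j : Fin n) (hU : IsOpen U) (h : ContDiffOn ℝ ∞ φ U)
    {x : Fin n → ℝ} (hx : x ∈ U) : pd i (pd j φ) x = pd j (pd i φ) x :=
  pd_comm i j ((h.contDiffAt (hU.mem_nhds hx)).of_le ENat.LEInfty.out)

theorem pd_pd_eq {i j : Fin n} {c : ℝ} {x : Fin n → ℝ} (hU : IsOpen U) (hx : x ∈ U)
    (h : ∀ y ∈ U, HasPd i φ (φ₁ y) y) (h1 : HasPd j φ₁ c x) : pd j (pd i φ) x = c :=
  (pd_congr ((hU.eventually_mem hx).mono fun y hy => (h y hy).pd_eq)).trans h1.pd_eq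

end smooth

section modes

variable {Λ k₀ μ T : ℝ} {L : Set ℝ} {S F G : ℝ → ℝ}

theorem IsDensityMode.hasDerivAt (hL : IsOpen L) (hF : IsDensityMode μ L S F) {t : ℝ}
    (ht : t ∈ L) : HasDerivAt F (deriv F t) t :=
  (hF.differentiableAt hL ht).hasDerivAt

theorem IsDensityMode.hasDerivAt_deriv (hL : IsOpen L) (hF : IsDensityMode μ L S F) {t : ℝ}
    (ht : t ∈ L) : HasDerivAt (deriv F) (deriv (deriv F) t) t := by
  have : ContDiffOn ℝ 1 (deriv F) L := hF.1.deriv_of_isOpen hL (by norm_num)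
  exact ((this.contDiffAt (hL.mem_nhds ht)).differentiableAt one_ne_zero).hasDerivAt

theorem IsDensityMode.linear_combination (hL : IsOpen L) (hF : IsDensityMode μ L S F)
    (hG : IsDensityMode μ L S G) (a b : ℝ) :
    IsDensityMode μ L S (fun t => a * F t + b * G t) := by
  refine ⟨(contDiffOn_const.mul hF.1).add (contDiffOn_const.mul hG.1), fun t ht => ?_⟩
  have d1 : ∀ u ∈ L, HasDerivAt (fun t => a * F t + b * G t) (a * deriv F u + b * deriv G u) u :=
    fun u hu => ((hF.hasDerivAt hL hu).const_mul a).add ((hG.hasDerivAt hL hu).const_mul b)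
  have d2 : HasDerivAt (fun u => a * deriv F u + b * deriv G u)
      (a * deriv (deriv F) t + b * deriv (deriv G) t) t :=
    ((hF.hasDerivAt_deriv hL ht).const_mul a).add ((hG.hasDerivAt_deriv hL ht).const_mul b)
  have e : deriv (fun t => a * F t + b * G t) =ᶠ[𝓝 t] fun u => a * deriv F u + b * deriv G u :=
    (hL.eventually_mem ht).mono fun u hu => (d1 u hu).deriv
  rw [e.deriv_eq, d2.deriv, (d1 t ht).deriv]
  linear_combination a * hF.2 t ht + b * hG.2 t ht

/-- A density mode that vanishes near one instant vanishes. -/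
theorem IsDensityMode.eq_zero (hb : IsBackground Λ k₀ μ T L S) (hF : IsGrowingMode Λ k₀ μ T L S F)
    (hG : IsDensityMode μ L S G) {u : ℝ} (hu : u ∈ L) (h0 : G =ᶠ[𝓝 u] fun _ => 0) {t : ℝ}
    (ht : t ∈ L) : G t = 0 := by
  have e0 : G u = 0 := h0.eq_of_nhds
  have e1 : deriv G u = 0 := by rw [h0.deriv_eq, deriv_const]
  have w1 := hb.wronskian_eq hb.isDensityMode_hubble hG ht hu
  have w2 := hb.wronskian_eq hF.1 hG ht hu
  have w3 := wronskian_growing hb hF ht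
  rw [e0, e1, (hb.hasDerivAt_hubble ht).deriv] at w1
  rw [e0, e1] at w2
  have hp : S t ^ 2 ≠ 0 := pow_ne_zero 2 (hb.pos t ht).ne'
  have v1 : hubble S t * deriv G t - (k₀ / S t ^ 2 - 3 * μ / S t ^ 3) * G t = 0 := by
    refine (mul_eq_zero.1 (w1.trans ?_)).resolve_left hp
    ring
  have v2 : F t * deriv G t - deriv F t * G t = 0 := by
    refine (mul_eq_zero.1 (w2.trans ?_)).resolve_left hp
    ring
  -- The Wronskians of `G` with `H` and with `F` vanish; eliminating `Ġ` leaves `G` times the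
  -- Wronskian of `H` and `F`, which is `1`.
  linear_combination S t ^ 2 * F t * v1 - S t ^ 2 * hubble S t * v2 - G t * w3

end modes

namespace ClassI

variable {Λ : ℝ} (M : ClassI Λ)

/-! ### The local scale factor of a class I model -/

/-- The events at which the scale factor is defined. -/
def domain : Set (Fin 4 → ℝ) := {p | (p 0, p 3) ∈ M.Ω}

/-- The scale factor as a function of the event. -/
def scale (p : Fin 4 → ℝ) : ℝ := M.S (p 0) (p 3)

theorem continuous_tz : Continuous fun p : Fin 4 → ℝ => (p 0, p 3) := by fun_prop

theorem isOpen_domain : IsOpen M.domain := M.Ω_open.preimage continuous_tz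

theorem isOpen_labels : IsOpen (Prod.snd '' M.Ω) := isOpenMap_snd _ M.Ω_open

theorem label_mem {p : Fin 4 → ℝ} (hp : p ∈ M.domain) : p 3 ∈ Prod.snd '' M.Ω := ⟨_, hp, rfl⟩

theorem contDiffOn_scale : ContDiffOn ℝ ∞ M.scale M.domain :=
  M.S_smooth.comp ((contDiff_apply ℝ ℝ 0).prodMk (contDiff_apply ℝ ℝ 3)).contDiffOn
    fun _ hp => hp

theorem hasDerivAt_of_smooth {g : ℝ → ℝ} (hg : ContDiffOn ℝ ∞ g (Prod.snd '' M.Ω)) {ξ : ℝ}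
    (hξ : ξ ∈ Prod.snd '' M.Ω) : HasDerivAt g (deriv g ξ) ξ :=
  ((hg.contDiffAt (M.isOpen_labels.mem_nhds hξ)).differentiableAt (by simp)).hasDerivAt

theorem background_at {p : Fin 4 → ℝ} (hp : p ∈ M.domain) :
    IsBackground Λ M.k₀ (M.μ (p 3)) (M.T (p 3)) (M.lifeSpan (p 3)) (fun t => M.S t (p 3)) :=
  M.background _ (M.label_mem hp)

theorem pd_zero_scale : pd 0 M.scale = fun p => deriv (fun t => M.S t (p 3)) (p 0) := by
  funext p
  simp [pd, scale]

theorem pd_zero_pd_zero_scale :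
    pd 0 (pd 0 M.scale) = fun p => deriv (deriv fun t => M.S t (p 3)) (p 0) := by
  rw [pd_zero_scale]
  funext p
  simp [pd]

theorem pd_three_scale (p : Fin 4 → ℝ) : pd 3 M.scale p = deriv (fun z => M.S (p 0) z) (p 3) := by
  simp [pd, scale]

theorem scale_pos {p : Fin 4 → ℝ} (hp : p ∈ M.domain) : 0 < M.scale p :=
  (M.background_at hp).pos _ hp

theorem pd_scale_friedmann {p : Fin 4 → ℝ} (hp : p ∈ M.domain) :
    pd 0 M.scale p ^ 2 = -M.k₀ + 2 * M.μ (p 3) / M.scale p + Λ / 3 * M.scale p ^ 2 := by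
  rw [pd_zero_scale]
  exact (M.background_at hp).friedmann _ hp

theorem pd_scale_acceleration {p : Fin 4 → ℝ} (hp : p ∈ M.domain) :
    pd 0 (pd 0 M.scale) p = -M.μ (p 3) / M.scale p ^ 2 + Λ / 3 * M.scale p := by
  rw [pd_zero_pd_zero_scale]
  exact (M.background_at hp).acceleration hp

theorem hasPd_scale {i : Fin 4} {p : Fin 4 → ℝ} (hp : p ∈ M.domain) :
    HasPd i M.scale (pd i M.scale p) p :=
  hasPd_of_contDiffOn i M.isOpen_domain M.contDiffOn_scale hp

theorem hasPd_μ {p : Fin 4 → ℝ} (hp : p ∈ M.domain) :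
    HasPd 3 (fun p : Fin 4 → ℝ => M.μ (p 3)) (deriv M.μ (p 3)) p := by
  simpa using hasPd_coord (i := 3) (x := p) 3 (M.hasDerivAt_of_smooth M.μ_smooth (M.label_mem hp))

/-- The derivative of the Friedmann equation with respect to the label. -/
theorem pd_scale_friedmann_label {p : Fin 4 → ℝ} (hp : p ∈ M.domain) :
    2 * pd 0 M.scale p * pd 0 (pd 3 M.scale) p = 2 * deriv M.μ (p 3) / M.scale p
      - 2 * M.μ (p 3) * pd 3 M.scale p / M.scale p ^ 2
      + 2 * Λ / 3 * M.scale p * pd 3 M.scale p := by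
  have hs := (M.scale_pos hp).ne'
  have h1 := (hasPd_of_contDiffOn 3 M.isOpen_domain
    (contDiffOn_pd 0 M.isOpen_domain M.contDiffOn_scale) hp).pow 2
  have h2 := ((hasPd_const (-M.k₀)).add (((M.hasPd_μ hp).const_mul 2).div (M.hasPd_scale hp) hs)).add
    (((M.hasPd_scale (i := 3) hp).pow 2).const_mul (Λ / 3))
  have e := h1.pd_eq.symm.trans ((pd_congr ((M.isOpen_domain.eventually_mem hp).mono
    fun q hq => M.pd_scale_friedmann hq)).trans h2.pd_eq)
  rw [pd_comm_of_contDiffOn 3 0 M.isOpen_domain M.contDiffOn_scale hp] at e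
  push_cast at e
  field_simp at e ⊢
  linear_combination e / 2

/-- The derivative of the second Friedmann equation with respect to the label. -/
theorem pd_scale_acceleration_label {p : Fin 4 → ℝ} (hp : p ∈ M.domain) :
    pd 0 (pd 0 (pd 3 M.scale)) p = -deriv M.μ (p 3) / M.scale p ^ 2
      + 2 * M.μ (p 3) * pd 3 M.scale p / M.scale p ^ 3 + Λ / 3 * pd 3 M.scale p := by
  have hs := (M.scale_pos hp).ne'
  have hc := contDiffOn_pd 0 M.isOpen_domain M.contDiffOn_scale
  have h2 := (((M.hasPd_μ hp).const_mul (-1)).div ((M.hasPd_scale (i := 3) hp).pow 2)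
    (pow_ne_zero 2 hs)).add ((M.hasPd_scale (i := 3) hp).const_mul (Λ / 3))
  have e := (pd_congr (i := 3) ((M.isOpen_domain.eventually_mem hp).mono
    fun q hq => (M.pd_scale_acceleration hq).trans (by ring))).trans h2.pd_eq
  have e1 : pd 0 (pd 0 (pd 3 M.scale)) p = pd 3 (pd 0 (pd 0 M.scale)) p := by
    rw [pd_comm_of_contDiffOn 3 0 M.isOpen_domain hc hp]
    exact pd_congr ((M.isOpen_domain.eventually_mem hp).mono fun q hq =>
      pd_comm_of_contDiffOn 0 3 M.isOpen_domain M.contDiffOn_scale hq)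
  rw [e1, e]
  push_cast
  field_simp
  ring

/-- Either `k₀² = 1`, or `k₀ = 0` and the normalization gives `μ_{,ξ} = 0`. The normalization enters
the argument here. -/
theorem μ_deriv_mul {ξ : ℝ} (hξ : ξ ∈ Prod.snd '' M.Ω) :
    M.k₀ ^ 2 * deriv M.μ ξ = deriv M.μ ξ := by
  rcases M.k₀_mem with h | h | h
  · rw [M.μ_flat h ξ hξ, mul_zero]
  · rw [h]; ring
  · rw [h]; ring

/-- The quotient `S_{,ξ}/S` solves the mode equation with the inhomogeneity `-μ_{,ξ}/S³`. This
identity says that adding the constant `k₀ β₊` to `f S_{,ξ}/S` makes the equation homogeneous. -/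
theorem k₀_mul_βPlus {ξ : ℝ} (hξ : ξ ∈ Prod.snd '' M.Ω) :
    3 * M.μ ξ * (M.k₀ * M.βPlus ξ) = -M.f ξ * deriv M.μ ξ := by
  have h := M.μ_deriv_mul hξ
  have hμ := (M.background ξ hξ).mu_pos.ne'
  rw [βPlus]
  field_simp
  linear_combination (-M.f ξ) * h

/-- The label derivative of the scale factor defines a density mode. -/
theorem isDensityMode_label (x : Fin 3 → ℝ) (hx : x 2 ∈ Prod.snd '' M.Ω) :
    IsDensityMode (M.μ (x 2)) (M.lifeSpan (x 2)) (fun t => M.S t (x 2)) (fun t =>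
      M.k₀ * M.βPlus (x 2) + M.f (x 2) *
        (pd 3 M.scale (Fin.cons t x) / M.scale (Fin.cons t x))) := by
  have hb := M.background _ hx
  have hcurve : ContDiff ℝ ∞ fun t : ℝ => (Fin.cons t x : Fin 4 → ℝ) := by
    refine contDiff_pi.2 fun i => ?_
    refine Fin.cases ?_ (fun j => ?_) i
    · exact contDiff_id
    · exact contDiff_const
  have hmem : ∀ t ∈ M.lifeSpan (x 2), (Fin.cons t x : Fin 4 → ℝ) ∈ M.domain := fun t ht => ht
  have hcz := contDiffOn_pd 3 M.isOpen_domain M.contDiffOn_scale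
  have hctz := contDiffOn_pd 0 M.isOpen_domain hcz
  have hslice : ∀ {φ : (Fin 4 → ℝ) → ℝ}, ContDiffOn ℝ ∞ φ M.domain → ∀ t ∈ M.lifeSpan (x 2),
      HasDerivAt (fun t => φ (Fin.cons t x)) (pd 0 φ (Fin.cons t x)) t := by
    intro φ hφ t ht
    simpa [HasPd] using hasPd_of_contDiffOn 0 M.isOpen_domain hφ (hmem t ht)
  refine ⟨?_, fun t ht => ?_⟩
  · refine ContDiffOn.of_le ?_ ENat.LEInfty.out
    refine contDiffOn_const.add (contDiffOn_const.mul (ContDiffOn.div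
      (hcz.comp hcurve.contDiffOn hmem) (M.contDiffOn_scale.comp hcurve.contDiffOn hmem)
      fun t ht => (M.scale_pos (hmem t ht)).ne'))
  have d1 : ∀ u ∈ M.lifeSpan (x 2), HasDerivAt (fun t => M.k₀ * M.βPlus (x 2) + M.f (x 2) *
        (pd 3 M.scale (Fin.cons t x) / M.scale (Fin.cons t x)))
      (M.f (x 2) * ((pd 0 (pd 3 M.scale) (Fin.cons u x) * M.scale (Fin.cons u x)
        - pd 3 M.scale (Fin.cons u x) * pd 0 M.scale (Fin.cons u x))
          / M.scale (Fin.cons u x) ^ 2)) u := fun u hu =>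
    (((hslice hcz u hu).div (hslice M.contDiffOn_scale u hu)
      (M.scale_pos (hmem u hu)).ne').const_mul _).const_add _
  have d2 := ((((hslice hctz t ht).mul (hslice M.contDiffOn_scale t ht)).sub
    ((hslice hcz t ht).mul (hslice (contDiffOn_pd 0 M.isOpen_domain M.contDiffOn_scale) t ht))).div
      ((hslice M.contDiffOn_scale t ht).pow 2)
      (pow_ne_zero 2 (M.scale_pos (hmem t ht)).ne')).const_mul (M.f (x 2))
  have e : deriv (fun t => M.k₀ * M.βPlus (x 2) + M.f (x 2) *
        (pd 3 M.scale (Fin.cons t x) / M.scale (Fin.cons t x))) =ᶠ[𝓝 t] _ :=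
    (hb.isOpen.eventually_mem ht).mono fun u hu => (d1 u hu).deriv
  have hH : hubble (fun t => M.S t (x 2)) t
      = pd 0 M.scale (Fin.cons t x) / M.scale (Fin.cons t x) := by
    rw [pd_zero_scale]
    rfl
  have hs := (M.scale_pos (hmem t ht)).ne'
  have r1 := M.pd_scale_acceleration (hmem t ht)
  have r2 := M.pd_scale_acceleration_label (hmem t ht)
  have r3 := M.k₀_mul_βPlus hx
  rw [cons_apply_three] at r1 r2
  have e3 := e.deriv_eq.trans d2.deriv
  rw [e3, (d1 t ht).deriv, hH]
  simp only [Pi.mul_apply, Pi.sub_apply, Pi.pow_apply,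
    show M.S t (x 2) = M.scale (Fin.cons t x) from rfl]
  rw [r1, r2]
  push_cast
  field_simp
  linear_combination (-3 * M.scale (Fin.cons t x)) * r3

/-- The label derivative of the scale factor during the initial expansion. -/
theorem pd_three_scale_of_expanding {a t ξ : ℝ} (htξ : (t, ξ) ∈ M.Ω)
    (hV : ∀ m > M.μ ξ / 2, ∀ s ∈ Ioc 0 a, 0 < -M.k₀ + 2 * m / s + Λ / 3 * s ^ 2)
    (hSa : M.S t ξ < a) (he : 0 < deriv (fun s => M.S s ξ) t) :
    deriv (fun z => M.S t z) ξ = deriv (fun s => M.S s ξ) t * (-deriv M.T ξ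
      + deriv M.μ ξ * ∫ s in (0 : ℝ)..M.S t ξ, √s ^ 1 / √(potential Λ M.k₀ (M.μ ξ) s) ^ 3) := by
  have hξ : ξ ∈ Prod.snd '' M.Ω := ⟨_, htξ, rfl⟩
  have hb := M.background ξ hξ
  have hμ := M.hasDerivAt_of_smooth M.μ_smooth hξ
  have hT := M.hasDerivAt_of_smooth M.T_smooth hξ
  have hp : (![t, 0, 0, ξ] : Fin 4 → ℝ) ∈ M.domain := htξ
  have hcurve : Tendsto (fun z => (![t, 0, 0, z] : Fin 4 → ℝ)) (𝓝 ξ) (𝓝 ![t, 0, 0, ξ]) := by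
    refine tendsto_pi_nhds.2 fun i => ?_
    fin_cases i
    exacts [tendsto_const_nhds, tendsto_const_nhds, tendsto_const_nhds, tendsto_id]
  have hσ : HasDerivAt (fun z => M.S t z) (deriv (fun z => M.S t z) ξ) ξ := by
    have h1 := M.hasPd_scale (i := 3) hp
    rw [pd_three_scale] at h1
    simpa [HasPd, scale] using h1
  have hdt : ContinuousAt (fun z => deriv (fun s => M.S s z) t) ξ := by
    have h1 := (contDiffOn_pd 0 M.isOpen_domain M.contDiffOn_scale).continuousOn.continuousAt
      (M.isOpen_domain.mem_nhds hp)
    rw [pd_zero_scale] at h1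
    exact ContinuousAt.comp (f := fun z => (![t, 0, 0, z] : Fin 4 → ℝ)) (x := ξ) h1 hcurve
  -- The age formula must hold for all nearby labels before it can be differentiated. By continuity
  -- `S < a`, `Ṡ > 0` and `μ z > μ ξ / 2` persist, so the neighbouring backgrounds are also in their
  -- initial expansion at `t`.
  have hage : ∀ᶠ z in 𝓝 ξ, ∫ s in (0 : ℝ)..M.S t z, √s / √(potential Λ M.k₀ (M.μ z) s)
      = t - M.T z := by
    filter_upwards [hcurve.eventually (M.isOpen_domain.eventually_mem hp),
      hσ.continuousAt.eventually (gt_mem_nhds hSa), hdt.eventually (lt_mem_nhds he),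
      hμ.continuousAt.eventually (lt_mem_nhds (half_lt_self hb.mu_pos))] with z h1 h2 h3 h4
    have hz : (t, z) ∈ M.Ω := h1
    have hbz := M.background z ⟨_, hz, rfl⟩
    exact age_eq_integral hbz hz (hbz.expanding_of_potential_pos hz
      (fun s hs => hV _ h4 s ⟨hs.1, hs.2.trans h2.le⟩) h3)
  have hex := hb.expanding_of_potential_pos htξ
    (fun s hs => hV _ (half_lt_self hb.mu_pos) s ⟨hs.1, hs.2.trans hSa.le⟩) he
  have hpos := potential_pos_of_expanding hb htξ hex
  have hS := hb.pos t htξ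
  have d1 := hasDerivAt_integral_total hσ hμ hS hpos
  have d2 := (hT.const_sub t).congr_of_eventuallyEq hage
  have e := d1.unique d2
  have p1 : √(M.S t ξ) ≠ 0 := Real.sqrt_ne_zero'.2 hS
  have p2 : √(potential Λ M.k₀ (M.μ ξ) (M.S t ξ)) ≠ 0 :=
    Real.sqrt_ne_zero'.2 (hpos _ ⟨hS.le, le_rfl⟩)
  rw [deriv_eq_sqrt hb htξ he]
  rw [← e]
  field_simp
  ring

/-- The superposition of the modes is the label derivative of the scale factor. -/
theorem 𝓕_eq (x : Fin 3 → ℝ) {t : ℝ} (ht : (t, x 2) ∈ M.Ω) :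
    M.𝓕 x t = -(M.k₀ * M.βPlus (x 2) + M.f (x 2) *
        (pd 3 M.scale (Fin.cons t x) / M.scale (Fin.cons t x))) := by
  have hx : x 2 ∈ Prod.snd '' M.Ω := ⟨_, ht, rfl⟩
  have hb := M.background _ hx
  have hg := M.growing _ hx
  -- The difference of the two sides is a single density mode. It is shown to vanish on an open
  -- interval after the bang, where explicit integrals are available, and then vanishes over the
  -- whole life span.
  have hmode := ((hg.1.linear_combination hb.isOpen hb.isDensityMode_hubble (M.βPlus (x 2))
    (M.βMinus (x 2))).linear_combination hb.isOpen (M.isDensityMode_label x hx) 1 1)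
  obtain ⟨a, ha, hV⟩ := exists_potential_pos hb.mu_pos Λ M.k₀
  obtain ⟨t₀, h1, h2, h3⟩ := hb.exists_expanding ⟨t, ht⟩ ha
  have hex := hb.expanding_of_potential_pos h1
    (fun s hs => hV _ (half_lt_self hb.mu_pos) s ⟨hs.1, hs.2.trans h2.le⟩) h3
  obtain ⟨u, hu⟩ := nonempty_Ioo.2 (hb.bang_lt t₀ h1)
  have hzero : ∀ v ∈ Ioo (M.T (x 2)) t₀, 1 * (M.βPlus (x 2) * M.fPlus v (x 2)
      + M.βMinus (x 2) * hubble (fun t => M.S t (x 2)) v) + 1 * (M.k₀ * M.βPlus (x 2)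
      + M.f (x 2) * (pd 3 M.scale (Fin.cons v x) / M.scale (Fin.cons v x))) = 0 := by
    intro v hv
    have hvL := hb.past t₀ h1 ⟨hv.1, hv.2.le⟩
    have hexv : ∀ s ∈ Ioc (M.T (x 2)) v, 0 < deriv (fun t => M.S t (x 2)) s := fun s hs =>
      hex s ⟨hs.1, hs.2.trans hv.2.le⟩
    have hsub : Icc v t₀ ⊆ Ioc (M.T (x 2)) t₀ := fun w hw => ⟨hv.1.trans_le hw.1, hw.2⟩
    have hlt : M.S v (x 2) < M.S t₀ (x 2) := by
      refine strictMonoOn_of_deriv_pos (f := fun t => M.S t (x 2)) (convex_Icc v t₀)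
        (hb.smooth.continuousOn.mono (hsub.trans (hb.past t₀ h1))) (fun w hw => ?_)
        (left_mem_Icc.2 hv.2.le) (right_mem_Icc.2 hv.2.le) hv.2
      exact hex w (hsub (interior_subset hw))
    have hd := hexv v ⟨hv.1, le_rfl⟩
    have e1 := M.pd_three_scale_of_expanding hvL hV (hlt.trans h2) hd
    have e2 := growing_eq hb hg hvL hexv
    have hpos := potential_pos_of_expanding hb hvL hexv
    have hS := hb.pos v hvL
    have e3 := sqrt_div_eq_integral hS hpos
    have e4 := deriv_eq_sqrt hb hvL hd
    have e5 : pd 3 M.scale (Fin.cons v x) = deriv (fun z => M.S v z) (x 2) := by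
      rw [pd_three_scale]
      rfl
    have p1 : 0 < √(M.S v (x 2)) := Real.sqrt_pos.2 hS
    have p2 : 0 < √(potential Λ M.k₀ (M.μ (x 2)) (M.S v (x 2))) :=
      Real.sqrt_pos.2 (hpos _ ⟨hS.le, le_rfl⟩)
    have p3 : M.S v (x 2) = √(M.S v (x 2)) ^ 2 := (Real.sq_sqrt hS.le).symm
    rw [e5, e1, e2, show M.scale (Fin.cons v x) = M.S v (x 2) from rfl, hubble, e4, βPlus, βMinus]
    have hμ := hb.mu_pos.ne'
    have hμ' := M.μ_deriv_mul hx
    generalize (∫ s in (0 : ℝ)..M.S v (x 2),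
      √s ^ 1 / √(potential Λ M.k₀ (M.μ (x 2)) s) ^ 3) = R at *
    generalize (∫ s in (0 : ℝ)..M.S v (x 2),
      √s ^ 3 / √(potential Λ M.k₀ (M.μ (x 2)) s) ^ 3) = Q at *
    generalize √(potential Λ M.k₀ (M.μ (x 2)) (M.S v (x 2))) = q at *
    generalize √(M.S v (x 2)) = r at *
    rw [p3]
    have hq := p2.ne'
    have hr := p1.ne'
    -- `R` comes from the mass derivative of the age and `Q` from the growing mode. The integration
    -- by parts `e6` relates them, and `e8` removes the factor `k₀²` in front of `μ_{,ξ}`.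
    have e6 : 3 * M.μ (x 2) * R - M.k₀ * Q - r ^ 3 / q = 0 := by rw [e3, sub_self]
    have e8 : M.f (x 2) / (3 * M.μ (x 2))
        * (deriv M.μ (x 2) - M.k₀ ^ 2 * deriv M.μ (x 2)) = 0 := by rw [hμ', sub_self, mul_zero]
    rw [← mul_zero (M.f (x 2) * q * deriv M.μ (x 2) / (3 * M.μ (x 2) * r ^ 3)), ← e6,
      ← sub_eq_zero, ← e8]
    field_simp
    ring
  have h := hmode.eq_zero hb hg (u := u) (hb.past t₀ h1 ⟨hu.1, hu.2.le⟩)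
    (by filter_upwards [Ioo_mem_nhds hu.1 hu.2] with v hv using hzero v hv) ht
  have e : M.𝓕 x t = M.βPlus (x 2) * M.fPlus t (x 2)
      + M.βMinus (x 2) * hubble (fun t => M.S t (x 2)) t := rfl
  linear_combination e + h

end ClassI
end Szekeres

namespace Szekeres

/-! ### Quadratic forms with coefficients depending on the label -/

section forms

variable {a b c d : ℝ → ℝ} {a' b' c' d' : ℝ} {p : Fin 4 → ℝ}

/-- A quadratic form in `(p 1, p 2)` with coefficients depending on `p 3`. -/
def quad (a b c d : ℝ → ℝ) (p : Fin 4 → ℝ) : ℝ :=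
  a (p 3) * (p 1 ^ 2 + p 2 ^ 2) + 2 * b (p 3) * p 1 + 2 * c (p 3) * p 2 + d (p 3)

/-- Half a linear form in `p k` with coefficients depending on `p 3`. -/
def lin (a b : ℝ → ℝ) (k : Fin 4) (p : Fin 4 → ℝ) : ℝ := 2 * a (p 3) * p k + 2 * b (p 3)

theorem hasPd_label {g : ℝ → ℝ} {g' : ℝ} (hg : HasDerivAt g g' (p 3)) (i : Fin 4) :
    HasPd i (fun q : Fin 4 → ℝ => g (q 3)) (if i = 3 then g' else 0) p :=
  hasPd_coord 3 hg

theorem hasPd_lin (ha : HasDerivAt a a' (p 3)) (hb : HasDerivAt b b' (p 3)) (k i : Fin 4) :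
    HasPd i (lin a b k) ((if i = 3 then 2 * a' * p k + 2 * b' else 0)
      + if i = k then 2 * a (p 3) else 0) p := by
  refine ((((hasPd_label ha i).const_mul 2).mul (hasPd_coord k (hasDerivAt_id _))).add
    ((hasPd_label hb i).const_mul 2)).congr ?_
  split_ifs <;> simp; ring

theorem hasPd_quad (ha : HasDerivAt a a' (p 3)) (hb : HasDerivAt b b' (p 3))
    (hc : HasDerivAt c c' (p 3)) (hd : HasDerivAt d d' (p 3)) (i : Fin 4) :
    HasPd i (quad a b c d)
      (![0, lin a b 1 p, lin a c 2 p, a' * (p 1 ^ 2 + p 2 ^ 2) + 2 * b' * p 1 + 2 * c' * p 2 + d'] i)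
      p := by
  have h1 := hasPd_coord (i := i) (x := p) 1 (hasDerivAt_id _)
  have h2 := hasPd_coord (i := i) (x := p) 2 (hasDerivAt_id _)
  refine (((((hasPd_label ha i).mul ((h1.pow 2).add (h2.pow 2))).add
    (((hasPd_label hb i).const_mul 2).mul h1)).add (((hasPd_label hc i).const_mul 2).mul h2)).add
      (hasPd_label hd i)).congr ?_
  fin_cases i <;> simp [lin] <;> ring

theorem contDiffOn_label {V : Set ℝ} {U : Set (Fin 4 → ℝ)} {g : ℝ → ℝ} (hg : ContDiffOn ℝ ∞ g V)
    (hU : ∀ p ∈ U, p 3 ∈ V) : ContDiffOn ℝ ∞ (fun p : Fin 4 → ℝ => g (p 3)) U :=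
  hg.comp (contDiff_apply ℝ ℝ 3).contDiffOn hU

theorem contDiffOn_quad {V : Set ℝ} {U : Set (Fin 4 → ℝ)} (ha : ContDiffOn ℝ ∞ a V)
    (hb : ContDiffOn ℝ ∞ b V) (hc : ContDiffOn ℝ ∞ c V) (hd : ContDiffOn ℝ ∞ d V)
    (hU : ∀ p ∈ U, p 3 ∈ V) : ContDiffOn ℝ ∞ (quad a b c d) U := by
  have h1 : ContDiffOn ℝ ∞ (fun p : Fin 4 → ℝ => p 1) U := (contDiff_apply ℝ ℝ 1).contDiffOn
  have h2 : ContDiffOn ℝ ∞ (fun p : Fin 4 → ℝ => p 2) U := (contDiff_apply ℝ ℝ 2).contDiffOn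
  exact ((((contDiffOn_label ha hU).mul ((h1.pow 2).add (h2.pow 2))).add
    ((contDiffOn_const.mul (contDiffOn_label hb hU)).mul h1)).add
      ((contDiffOn_const.mul (contDiffOn_label hc hU)).mul h2)).add (contDiffOn_label hd hU)

end forms

namespace ClassI

/-! ### The denominator of `e^ν` in a class I model -/

variable {Λ : ℝ} (M : ClassI Λ)

/-- The denominator of `e^ν`. -/
def den : (Fin 4 → ℝ) → ℝ := quad M.c₀ M.c₁ M.c₂ M.c₃

/-- The label derivative of the denominator of `e^ν`. -/
noncomputable def denLabel : (Fin 4 → ℝ) → ℝ := quad (deriv M.c₀) (deriv M.c₁) (deriv M.c₂) (deriv M.c₃)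

/-- The events at which `e^ν` and `𝓦` are defined and positive. -/
def chart : Set (Fin 4 → ℝ) :=
  {p | p ∈ M.domain ∧ 0 < M.f (p 3) / M.den p ∧ 0 < M.ε - M.k₀ * M.f (p 3) ^ 2}

theorem contDiffOn_deriv_label {g : ℝ → ℝ} (hg : ContDiffOn ℝ ∞ g (Prod.snd '' M.Ω)) :
    ContDiffOn ℝ ∞ (deriv g) (Prod.snd '' M.Ω) :=
  hg.deriv_of_isOpen M.isOpen_labels (by simp)

theorem contDiffOn_f : ContDiffOn ℝ ∞ (fun p : Fin 4 → ℝ => M.f (p 3)) M.domain :=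
  contDiffOn_label M.f_smooth fun _ hp => M.label_mem hp

theorem contDiffOn_deriv_f : ContDiffOn ℝ ∞ (fun p : Fin 4 → ℝ => deriv M.f (p 3)) M.domain :=
  contDiffOn_label (M.contDiffOn_deriv_label M.f_smooth) fun _ hp => M.label_mem hp

theorem contDiffOn_den : ContDiffOn ℝ ∞ M.den M.domain :=
  contDiffOn_quad M.c₀_smooth M.c₁_smooth M.c₂_smooth M.c₃_smooth fun _ hp => M.label_mem hp

theorem contDiffOn_denLabel : ContDiffOn ℝ ∞ M.denLabel M.domain :=
  contDiffOn_quad (M.contDiffOn_deriv_label M.c₀_smooth) (M.contDiffOn_deriv_label M.c₁_smooth)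
    (M.contDiffOn_deriv_label M.c₂_smooth) (M.contDiffOn_deriv_label M.c₃_smooth)
    fun _ hp => M.label_mem hp

theorem isOpen_chart : IsOpen M.chart := by
  have h1 := ((M.contDiffOn_f.mul M.contDiffOn_den).continuousOn).isOpen_inter_preimage
    M.isOpen_domain isOpen_Ioi (t := Ioi 0)
  have h2 := ((contDiffOn_const (c := M.ε)).sub ((contDiffOn_const (c := M.k₀)).mul
    (M.contDiffOn_f.pow 2))).continuousOn.isOpen_inter_preimage M.isOpen_domain
      isOpen_Ioi (t := Ioi 0)
  have e : M.chart = (M.domain ∩ (fun p => M.f (p 3) * M.den p) ⁻¹' Ioi 0)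
      ∩ (M.domain ∩ (fun p => M.ε - M.k₀ * M.f (p 3) ^ 2) ⁻¹' Ioi 0) := by
    ext p
    have e : 0 < M.f (p 3) / M.den p ↔ 0 < M.f (p 3) * M.den p := by
      rw [div_pos_iff, mul_pos_iff]
    simp only [chart, mem_ofPred_eq, e, mem_inter_iff, mem_preimage, mem_Ioi]
    tauto
  rw [e]
  exact h1.inter h2

section jets

variable {M} {p : Fin 4 → ℝ}

theorem f_ne (hp : p ∈ M.chart) : M.f (p 3) ≠ 0 := fun h => by simpa [h] using hp.2.1

theorem den_ne (hp : p ∈ M.chart) : M.den p ≠ 0 := fun h => by simpa [h] using hp.2.1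

theorem hasPd_den (hp : p ∈ M.domain) (i : Fin 4) : HasPd i M.den
    (![0, lin M.c₀ M.c₁ 1 p, lin M.c₀ M.c₂ 2 p, M.denLabel p] i) p :=
  hasPd_quad (M.hasDerivAt_of_smooth M.c₀_smooth (M.label_mem hp))
    (M.hasDerivAt_of_smooth M.c₁_smooth (M.label_mem hp))
    (M.hasDerivAt_of_smooth M.c₂_smooth (M.label_mem hp))
    (M.hasDerivAt_of_smooth M.c₃_smooth (M.label_mem hp)) i

theorem hasDerivAt_deriv_label {g : ℝ → ℝ} (hg : ContDiffOn ℝ ∞ g (Prod.snd '' M.Ω)) {ξ : ℝ}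
    (hξ : ξ ∈ Prod.snd '' M.Ω) : HasDerivAt (deriv g) (deriv (deriv g) ξ) ξ :=
  M.hasDerivAt_of_smooth (M.contDiffOn_deriv_label hg) hξ

/-- The last entry of the vector is a placeholder, excluded by `hi`: second label derivatives of the
coefficients never have to be computed. -/
theorem hasPd_denLabel (hp : p ∈ M.domain) (i : Fin 4) (hi : i ≠ 3) : HasPd i M.denLabel
    (![0, lin (deriv M.c₀) (deriv M.c₁) 1 p, lin (deriv M.c₀) (deriv M.c₂) 2 p, 0] i) p := by
  refine (hasPd_quad (hasDerivAt_deriv_label M.c₀_smooth (M.label_mem hp))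
    (hasDerivAt_deriv_label M.c₁_smooth (M.label_mem hp))
    (hasDerivAt_deriv_label M.c₂_smooth (M.label_mem hp))
    (hasDerivAt_deriv_label M.c₃_smooth (M.label_mem hp)) i).congr ?_
  fin_cases i <;> first | rfl | exact absurd rfl hi

theorem hasPd_f (hp : p ∈ M.domain) (i : Fin 4) :
    HasPd i (fun q : Fin 4 → ℝ => M.f (q 3)) (if i = 3 then deriv M.f (p 3) else 0) p :=
  hasPd_label (M.hasDerivAt_of_smooth M.f_smooth (M.label_mem hp)) i

theorem hasPd_deriv_f (hp : p ∈ M.domain) (i : Fin 4) (hi : i ≠ 3) :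
    HasPd i (fun q : Fin 4 → ℝ => deriv M.f (q 3)) 0 p := by
  simpa [hi] using hasPd_label (hasDerivAt_deriv_label M.f_smooth (M.label_mem hp)) i

/-- The relation between the coefficients of the denominator of `e^ν`, in terms of its
derivatives. -/
theorem den_relation (hp : p ∈ M.domain) :
    4 * M.c₀ (p 3) * M.den p = lin M.c₀ M.c₁ 1 p ^ 2 + lin M.c₀ M.c₂ 2 p ^ 2 + M.ε := by
  have h := M.c_rel _ (M.label_mem hp)
  simp only [den, quad, lin]
  linear_combination 4 * h

/-- The polarized form of `den_relation`, from differentiating `c₀ c₃ - c₁² - c₂²`, which is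
constant in the label. -/
theorem den_relation_label (hp : p ∈ M.domain) :
    2 * deriv M.c₀ (p 3) * M.den p + 2 * M.c₀ (p 3) * M.denLabel p
      = lin M.c₀ M.c₁ 1 p * lin (deriv M.c₀) (deriv M.c₁) 1 p
        + lin M.c₀ M.c₂ 2 p * lin (deriv M.c₀) (deriv M.c₂) 2 p := by
  have hξ := M.label_mem hp
  have h0 := M.hasDerivAt_of_smooth M.c₀_smooth hξ
  have h1 := M.hasDerivAt_of_smooth M.c₁_smooth hξ
  have h2 := M.hasDerivAt_of_smooth M.c₂_smooth hξ
  have h3 := M.hasDerivAt_of_smooth M.c₃_smooth hξ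
  have h := ((h0.mul h3).sub (h1.pow 2)).sub (h2.pow 2)
  have e := h.unique ((hasDerivAt_const (p 3) (M.ε / 4)).congr_of_eventuallyEq
    ((M.isOpen_labels.eventually_mem hξ).mono fun ξ hξ => M.c_rel ξ hξ))
  push_cast at e
  simp only [den, denLabel, quad, lin]
  linear_combination 2 * e

/-- The derivative of `𝓦`. -/
theorem hasDerivAt_𝓦 {ξ : ℝ} (hξ : ξ ∈ Prod.snd '' M.Ω) (h0 : 0 < M.ε - M.k₀ * M.f ξ ^ 2) :
    HasDerivAt M.𝓦 (M.k₀ * M.f ξ * deriv M.f ξ * M.𝓦 ξ ^ 3) ξ := by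
  have hf := M.hasDerivAt_of_smooth M.f_smooth hξ
  have hs : √(M.ε - M.k₀ * M.f ξ ^ 2) ≠ 0 := Real.sqrt_ne_zero'.2 h0
  have h := ((((hf.pow 2).const_mul M.k₀).const_sub M.ε).sqrt h0.ne').inv hs
  refine h.congr_deriv ?_
  push_cast
  simp only [𝓦, Pi.pow_apply]
  field_simp

theorem 𝓦_pos {ξ : ℝ} (h0 : 0 < M.ε - M.k₀ * M.f ξ ^ 2) : 0 < M.𝓦 ξ :=
  inv_pos.2 (Real.sqrt_pos.2 h0)

theorem 𝓦_sq {ξ : ℝ} (h0 : 0 < M.ε - M.k₀ * M.f ξ ^ 2) :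
    M.𝓦 ξ ^ 2 * (M.ε - M.k₀ * M.f ξ ^ 2) = 1 := by
  rw [𝓦, inv_pow, Real.sq_sqrt h0.le, inv_mul_cancel₀ h0.ne']

end jets
end ClassI
end Szekeres

namespace Szekeres
namespace ClassI

/-! ### The metric coefficients of a class I model -/

variable {Λ : ℝ} (M : ClassI Λ)

/-- The gradient of the denominator of `e^ν`. -/
noncomputable def denGrad (k : Fin 4) (p : Fin 4 → ℝ) : ℝ :=
  ![0, lin M.c₀ M.c₁ 1 p, lin M.c₀ M.c₂ 2 p, M.denLabel p] k

/-- The transversal gradient of the label derivative of the denominator of `e^ν`. -/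
noncomputable def denLabelGrad (k : Fin 4) (p : Fin 4 → ℝ) : ℝ :=
  ![0, lin (deriv M.c₀) (deriv M.c₁) 1 p, lin (deriv M.c₀) (deriv M.c₂) 2 p, 0] k

/-- The function `f ν_{,ξ}`. -/
noncomputable def labelRate (p : Fin 4 → ℝ) : ℝ :=
  deriv M.f (p 3) - M.f (p 3) * (M.denLabel p / M.den p)

/-- The function `S 𝓖`. -/
noncomputable def radialScale (p : Fin 4 → ℝ) : ℝ :=
  M.scale p * M.labelRate p + M.f (p 3) * pd 3 M.scale p

/-- The metric coefficient `S e^ν`. -/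
noncomputable def coeffA (p : Fin 4 → ℝ) : ℝ := M.scale p * (M.f (p 3) / M.den p)

/-- The metric coefficient `S 𝓖 𝓦`. -/
noncomputable def coeffB (p : Fin 4 → ℝ) : ℝ := M.𝓦 (p 3) * M.radialScale p

variable {M} {p : Fin 4 → ℝ}

theorem hasPd_denGrad {k j : Fin 4} (hk : k = 1 ∨ k = 2) (hj : j ≠ 3) (hp : p ∈ M.domain) :
    HasPd j (M.denGrad k) (if j = k then 2 * M.c₀ (p 3) else 0) p := by
  have h0 := M.hasDerivAt_of_smooth M.c₀_smooth (M.label_mem hp)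
  have h1 := M.hasDerivAt_of_smooth M.c₁_smooth (M.label_mem hp)
  have h2 := M.hasDerivAt_of_smooth M.c₂_smooth (M.label_mem hp)
  rcases hk with rfl | rfl
  · exact (hasPd_lin h0 h1 1 j).congr (by simp [hj])
  · exact (hasPd_lin h0 h2 2 j).congr (by simp [hj])

theorem hasPd_denLabelGrad {k j : Fin 4} (hk : k = 1 ∨ k = 2) (hj : j ≠ 3) (hp : p ∈ M.domain) :
    HasPd j (M.denLabelGrad k) (if j = k then 2 * deriv M.c₀ (p 3) else 0) p := by
  have h0 := hasDerivAt_deriv_label M.c₀_smooth (M.label_mem hp)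
  have h1 := hasDerivAt_deriv_label M.c₁_smooth (M.label_mem hp)
  have h2 := hasDerivAt_deriv_label M.c₂_smooth (M.label_mem hp)
  rcases hk with rfl | rfl
  · exact (hasPd_lin h0 h1 1 j).congr (by simp [hj])
  · exact (hasPd_lin h0 h2 2 j).congr (by simp [hj])

theorem hasPd_scale_transversal {k : Fin 4} (hk : k = 1 ∨ k = 2) : HasPd k M.scale 0 p := by
  rcases hk with rfl | rfl <;> simpa [HasPd, scale] using hasDerivAt_const _ _

theorem hasPd_pd_scale_transversal (i : Fin 4) {k : Fin 4} (hi : i = 0 ∨ i = 3)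
    (hk : k = 1 ∨ k = 2) : HasPd k (pd i M.scale) 0 p := by
  rcases hk with rfl | rfl <;> rcases hi with rfl | rfl <;>
    simpa [HasPd, scale, pd] using hasDerivAt_const _ _

theorem contDiffOn_labelRate : ContDiffOn ℝ ∞ M.labelRate M.chart := by
  have hs : M.chart ⊆ M.domain := fun p hp => hp.1
  exact (M.contDiffOn_deriv_f.mono hs).sub ((M.contDiffOn_f.mono hs).mul
    ((M.contDiffOn_denLabel.mono hs).div (M.contDiffOn_den.mono hs) fun p hp => den_ne hp))

theorem contDiffOn_radialScale : ContDiffOn ℝ ∞ M.radialScale M.chart := by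
  have hs : M.chart ⊆ M.domain := fun p hp => hp.1
  exact ((M.contDiffOn_scale.mono hs).mul contDiffOn_labelRate).add ((M.contDiffOn_f.mono hs).mul
    ((contDiffOn_pd 3 M.isOpen_domain M.contDiffOn_scale).mono hs))

theorem contDiffOn_coeffA : ContDiffOn ℝ ∞ M.coeffA M.chart := by
  have hs : M.chart ⊆ M.domain := fun p hp => hp.1
  exact (M.contDiffOn_scale.mono hs).mul ((M.contDiffOn_f.mono hs).div
    (M.contDiffOn_den.mono hs) fun p hp => den_ne hp)

theorem contDiffOn_coeffB : ContDiffOn ℝ ∞ M.coeffB M.chart := by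
  refine ContDiffOn.mul ?_ contDiffOn_radialScale
  have hs : M.chart ⊆ M.domain := fun p hp => hp.1
  have h : ContDiffOn ℝ ∞ (fun p : Fin 4 → ℝ => M.ε - M.k₀ * M.f (p 3) ^ 2) M.chart :=
    contDiffOn_const.sub (contDiffOn_const.mul ((M.contDiffOn_f.mono hs).pow 2))
  exact (h.sqrt fun p hp => hp.2.2.ne').inv fun p hp => Real.sqrt_ne_zero'.2 hp.2.2

/-! #### Derivatives of `f ν_{,ξ}` -/

theorem hasPd_labelRate {k : Fin 4} (hk : k ≠ 3) (hp : p ∈ M.chart) : HasPd k M.labelRate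
    (-(M.f (p 3) * ((M.denLabelGrad k p * M.den p - M.denLabel p * M.denGrad k p)
      / M.den p ^ 2))) p := by
  refine ((hasPd_deriv_f hp.1 k hk).sub ((hasPd_f hp.1 k).mul
    ((hasPd_denLabel hp.1 k hk).div (hasPd_den hp.1 k) (den_ne hp)))).congr ?_
  simp [hk, denLabelGrad, denGrad]

theorem pd_labelRate_time (hp : p ∈ M.chart) : HasPd 0 M.labelRate 0 p :=
  (hasPd_labelRate (by decide) hp).congr (by simp [denLabelGrad, denGrad])

theorem hasPd_pd_labelRate {k j : Fin 4} (hk : k = 1 ∨ k = 2) (hj : j ≠ 3) (hp : p ∈ M.chart) :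
    HasPd j (pd k M.labelRate) (-(M.f (p 3) * (
      ((if j = k then 2 * deriv M.c₀ (p 3) else 0) * M.den p
        + M.denLabelGrad k p * M.denGrad j p - M.denLabelGrad j p * M.denGrad k p
        - M.denLabel p * (if j = k then 2 * M.c₀ (p 3) else 0)) / M.den p ^ 2
      - 2 * (M.denLabelGrad k p * M.den p - M.denLabel p * M.denGrad k p) * M.denGrad j p
        / M.den p ^ 3))) p := by
  have hk3 : k ≠ 3 := by rcases hk with rfl | rfl <;> decide
  have hE := den_ne hp
  have h := ((hasPd_f hp.1 j).mul ((((hasPd_denLabelGrad hk hj hp.1).mul (hasPd_den hp.1 j)).sub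
    ((hasPd_denLabel hp.1 j hj).mul (hasPd_denGrad hk hj hp.1))).div
      ((hasPd_den hp.1 j).pow 2) (pow_ne_zero 2 hE))).const_mul (-1)
  refine (h.congr_of_eventuallyEq ?_).congr ?_
  · filter_upwards [M.isOpen_chart.eventually_mem hp] with q hq
    rw [(hasPd_labelRate hk3 hq).pd_eq, neg_one_mul]
  · rw [show (![0, lin M.c₀ M.c₁ 1 p, lin M.c₀ M.c₂ 2 p, M.denLabel p] : Fin 4 → ℝ) j
        = M.denGrad j p from rfl,
      show (![0, lin (deriv M.c₀) (deriv M.c₁) 1 p, lin (deriv M.c₀) (deriv M.c₂) 2 p, 0]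
        : Fin 4 → ℝ) j = M.denLabelGrad j p from rfl, if_neg hj]
    field_simp
    push_cast
    ring

/-! #### Derivatives of `S 𝓖` -/

theorem hasPd_pd_three_scale (hp : p ∈ M.domain) :
    HasPd 0 (pd 3 M.scale) (pd 0 (pd 3 M.scale) p) p :=
  hasPd_of_contDiffOn 0 M.isOpen_domain (contDiffOn_pd 3 M.isOpen_domain M.contDiffOn_scale) hp

theorem hasPd_radialScale_time (hp : p ∈ M.chart) : HasPd 0 M.radialScale
    (pd 0 M.scale p * M.labelRate p + M.f (p 3) * pd 0 (pd 3 M.scale) p) p := by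
  refine (((M.hasPd_scale hp.1).mul (pd_labelRate_time hp)).add
    ((hasPd_f hp.1 0).mul (hasPd_pd_three_scale hp.1))).congr ?_
  simp

theorem hasPd_radialScale {k : Fin 4} (hk : k = 1 ∨ k = 2) (hp : p ∈ M.chart) :
    HasPd k M.radialScale (M.scale p * pd k M.labelRate p) p := by
  have hk3 : k ≠ 3 := by rcases hk with rfl | rfl <;> decide
  refine (((hasPd_scale_transversal hk).mul (hasPd_of_contDiffOn k M.isOpen_chart
    contDiffOn_labelRate hp)).add ((hasPd_f hp.1 k).mul
      (hasPd_pd_scale_transversal 3 (Or.inr rfl) hk))).congr ?_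
  simp [hk3]

theorem pd_pd_radialScale_time (hp : p ∈ M.chart) : pd 0 (pd 0 M.radialScale) p
    = pd 0 (pd 0 M.scale) p * M.labelRate p + M.f (p 3) * pd 0 (pd 0 (pd 3 M.scale)) p := by
  refine pd_pd_eq M.isOpen_chart hp (fun q hq => hasPd_radialScale_time hq) ?_
  have h0 := contDiffOn_pd 0 M.isOpen_domain M.contDiffOn_scale
  have h3 := contDiffOn_pd 3 M.isOpen_domain M.contDiffOn_scale
  refine (((hasPd_of_contDiffOn 0 M.isOpen_domain h0 hp.1).mul (pd_labelRate_time hp)).add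
    ((hasPd_f hp.1 0).mul (hasPd_of_contDiffOn 0 M.isOpen_domain
      (contDiffOn_pd 0 M.isOpen_domain h3) hp.1))).congr ?_
  simp

theorem pd_time_pd_radialScale {k : Fin 4} (hk : k = 1 ∨ k = 2) (hp : p ∈ M.chart) :
    pd 0 (pd k M.radialScale) p = pd 0 M.scale p * pd k M.labelRate p := by
  refine pd_pd_eq M.isOpen_chart hp (fun q hq => hasPd_radialScale hk hq) ?_
  refine ((M.hasPd_scale hp.1).mul (hasPd_pd_labelRate hk (by decide) hp)).congr ?_
  have : (0 : Fin 4) ≠ k := by rcases hk with rfl | rfl <;> decide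
  simp [this, denGrad, denLabelGrad]

theorem pd_pd_radialScale {j k : Fin 4} (hj : j = 1 ∨ j = 2) (hk : k = 1 ∨ k = 2)
    (hp : p ∈ M.chart) :
    pd j (pd k M.radialScale) p = M.scale p * pd j (pd k M.labelRate) p := by
  refine pd_pd_eq M.isOpen_chart hp (fun q hq => hasPd_radialScale hk hq) ?_
  refine ((hasPd_scale_transversal hj).mul (hasPd_of_contDiffOn j M.isOpen_chart
    (contDiffOn_pd k M.isOpen_chart contDiffOn_labelRate) hp)).congr ?_
  simp

/-! #### Derivatives of `S e^ν` -/

theorem hasPd_coeffA_time (hp : p ∈ M.chart) :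
    HasPd 0 M.coeffA (pd 0 M.scale p * (M.f (p 3) / M.den p)) p := by
  refine ((M.hasPd_scale hp.1).mul ((hasPd_f hp.1 0).div (hasPd_den hp.1 0) (den_ne hp))).congr ?_
  simp

theorem hasPd_coeffA {k : Fin 4} (hk : k = 1 ∨ k = 2) (hp : p ∈ M.chart) :
    HasPd k M.coeffA (-(M.scale p * (M.f (p 3) * M.denGrad k p / M.den p ^ 2))) p := by
  have hk3 : k ≠ 3 := by rcases hk with rfl | rfl <;> decide
  refine ((hasPd_scale_transversal hk).mul
    ((hasPd_f hp.1 k).div (hasPd_den hp.1 k) (den_ne hp))).congr ?_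
  simp [hk3, denGrad]
  ring

/-- The mechanism of class I: `S 𝓖` is the label derivative of `A = S e^ν` times the denominator of
`e^ν`. The mixed relations `a_tz`, `a_xz`, `a_yz` then express derivatives of `A_{,ξ}` through those
of `B`. -/
theorem hasPd_coeffA_label (hp : p ∈ M.chart) :
    HasPd 3 M.coeffA (M.radialScale p / M.den p) p := by
  refine ((M.hasPd_scale hp.1).mul ((hasPd_f hp.1 3).div (hasPd_den hp.1 3) (den_ne hp))).congr ?_
  have hE := den_ne hp
  simp [radialScale, labelRate]
  field_simp
  ring

theorem pd_time_pd_time_coeffA (hp : p ∈ M.chart) :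
    pd 0 (pd 0 M.coeffA) p = pd 0 (pd 0 M.scale) p * (M.f (p 3) / M.den p) := by
  refine pd_pd_eq M.isOpen_chart hp (fun q hq => hasPd_coeffA_time hq) ?_
  refine ((hasPd_of_contDiffOn 0 M.isOpen_domain (contDiffOn_pd 0 M.isOpen_domain
    M.contDiffOn_scale) hp.1).mul ((hasPd_f hp.1 0).div (hasPd_den hp.1 0) (den_ne hp))).congr ?_
  simp

theorem pd_pd_coeffA {j k : Fin 4} (hj : j = 0 ∨ j = 1 ∨ j = 2) (hk : k = 1 ∨ k = 2)
    (hp : p ∈ M.chart) : pd j (pd k M.coeffA) p =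
      -((if j = 0 then pd 0 M.scale p else 0) * (M.f (p 3) * M.denGrad k p / M.den p ^ 2)
        + M.scale p * M.f (p 3) * ((if j = k then 2 * M.c₀ (p 3) else 0) / M.den p ^ 2
          - 2 * M.denGrad k p * M.denGrad j p / M.den p ^ 3)) := by
  have hj3 : j ≠ 3 := by rcases hj with rfl | rfl | rfl <;> decide
  have hE := den_ne hp
  have hs : HasPd j M.scale (if j = 0 then pd 0 M.scale p else 0) p := by
    rcases hj with rfl | rfl | rfl
    · exact M.hasPd_scale hp.1
    · exact hasPd_scale_transversal (Or.inl rfl)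
    · exact hasPd_scale_transversal (Or.inr rfl)
  refine pd_pd_eq M.isOpen_chart hp (fun q hq => (hasPd_coeffA hk hq).congr
    (neg_one_mul _).symm) ?_
  refine ((hs.mul (((hasPd_f hp.1 j).mul (hasPd_denGrad hk hj3 hp.1)).div
    ((hasPd_den hp.1 j).pow 2) (pow_ne_zero 2 hE))).const_mul (-1)).congr ?_
  rw [show (![0, lin M.c₀ M.c₁ 1 p, lin M.c₀ M.c₂ 2 p, M.denLabel p] : Fin 4 → ℝ) j
        = M.denGrad j p from rfl, if_neg hj3]
  field_simp
  push_cast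
  ring

theorem pd_pd_label_coeffA (i : Fin 4) (hp : p ∈ M.chart) : pd i (pd 3 M.coeffA) p
    = (pd i M.radialScale p * M.den p - M.radialScale p * M.denGrad i p) / M.den p ^ 2 := by
  refine pd_pd_eq M.isOpen_chart hp (fun q hq => hasPd_coeffA_label hq) ?_
  exact (hasPd_of_contDiffOn i M.isOpen_chart contDiffOn_radialScale hp).div (hasPd_den hp.1 i)
    (den_ne hp)

/-! #### Derivatives of `S 𝓖 𝓦` -/

theorem hasPd_coeffB {k : Fin 4} (hk : k ≠ 3) (hp : p ∈ M.chart) :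
    HasPd k M.coeffB (M.𝓦 (p 3) * pd k M.radialScale p) p := by
  refine ((hasPd_label (hasDerivAt_𝓦 (M.label_mem hp.1) hp.2.2) k).mul
    (hasPd_of_contDiffOn k M.isOpen_chart contDiffOn_radialScale hp)).congr ?_
  simp [hk]

theorem hasPd_coeffB_label (hp : p ∈ M.chart) :
    HasPd 3 M.coeffB (M.k₀ * M.f (p 3) * deriv M.f (p 3) * M.𝓦 (p 3) ^ 3 * M.radialScale p
      + M.𝓦 (p 3) * pd 3 M.radialScale p) p :=
  (hasPd_label (hasDerivAt_𝓦 (M.label_mem hp.1) hp.2.2) 3).mul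
    (hasPd_of_contDiffOn 3 M.isOpen_chart contDiffOn_radialScale hp)

theorem pd_pd_coeffB {j k : Fin 4} (hj : j ≠ 3) (hk : k ≠ 3) (hp : p ∈ M.chart) :
    pd j (pd k M.coeffB) p = M.𝓦 (p 3) * pd j (pd k M.radialScale) p := by
  refine pd_pd_eq M.isOpen_chart hp (fun q hq => hasPd_coeffB hk hq) ?_
  refine ((hasPd_label (hasDerivAt_𝓦 (M.label_mem hp.1) hp.2.2) j).mul
    (hasPd_of_contDiffOn j M.isOpen_chart (contDiffOn_pd k M.isOpen_chart
      contDiffOn_radialScale) hp)).congr ?_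
  simp [hj]

end ClassI
end Szekeres

namespace Szekeres
namespace ClassI

/-! ### Class I models are Szekeres spacetimes -/

variable {Λ : ℝ} (M : ClassI Λ)

/-- The local expansion rate. -/
noncomputable def rate (p : Fin 4 → ℝ) : ℝ := pd 0 M.scale p / M.scale p

/-- The logarithmic time derivative of `𝓖`. -/
noncomputable def rate₁ (p : Fin 4 → ℝ) : ℝ :=
  pd 0 M.radialScale p / M.radialScale p - M.rate p

/-- The second time derivative of `𝓖` divided by `𝓖`. -/
noncomputable def rate₂ (p : Fin 4 → ℝ) : ℝ :=
  pd 0 (pd 0 M.radialScale) p / M.radialScale p - pd 0 (pd 0 M.scale) p / M.scale p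
    - 2 * M.rate p * M.rate₁ p

variable {M} {p : Fin 4 → ℝ}

/-- Multiplied by `S 𝓖 = S f ν_{,ξ} + f S_{,ξ}`, the curvature becomes linear in `ν_{,ξ}` and
`S_{,ξ}`. The Friedmann equation and its label derivative cancel the `S_{,ξ}` part. -/
theorem curvature_identity (hp : p ∈ M.chart) (hG : M.radialScale p ≠ 0) :
    (M.k₀ / M.scale p ^ 2 - (3 * M.rate p * M.rate₁ p + M.rate₂ p)) * M.radialScale p
      = M.k₀ * M.labelRate p / M.scale p := by
  have hs := (M.scale_pos hp.1).ne'
  have r0 := M.pd_scale_friedmann hp.1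
  have r1 := M.pd_scale_acceleration hp.1
  have r2 := M.pd_scale_friedmann_label hp.1
  have r3 := M.pd_scale_acceleration_label hp.1
  have g1 := (hasPd_radialScale_time hp).pd_eq
  have g2 := pd_pd_radialScale_time hp
  have e : (M.k₀ / M.scale p ^ 2 - (3 * M.rate p * M.rate₁ p + M.rate₂ p)) * M.radialScale p
      = M.k₀ / M.scale p ^ 2 * M.radialScale p - pd 0 M.scale p / M.scale p
        * (pd 0 M.radialScale p - pd 0 M.scale p / M.scale p * M.radialScale p)
        - pd 0 (pd 0 M.radialScale) p + pd 0 (pd 0 M.scale) p / M.scale p * M.radialScale p := by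
    simp only [rate₂, rate₁, rate]
    field_simp
    ring
  rw [e, g1, g2, radialScale, r1, r3]
  field_simp at r0 r2 ⊢
  linear_combination (M.f (p 3) * pd 3 M.scale p) * r0
    - M.f (p 3) * r2

/-- `k_xy` is the relation between the `c`'s together with the definition of `𝓦`; `k_xz` and `k_yz`
use in addition its label derivative and `curvature_identity`. The other relations follow from the
product structure of `A` and `B`. -/
theorem szekeresJet (hp : p ∈ M.chart) (hG : M.radialScale p ≠ 0) :
    SzekeresJet (M.coeffA p) (M.coeffB p) (fun i => pd i M.coeffA p) (fun i => pd i M.coeffB p)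
      (fun i j => pd i (pd j M.coeffA) p) (fun i j => pd i (pd j M.coeffB) p)
      (M.rate p) (pd 0 (pd 0 M.scale) p / M.scale p) (M.rate₁ p) (M.rate₂ p)
      (M.k₀ / M.scale p ^ 2) := by
  have hs := (M.scale_pos hp.1).ne'
  have hE := den_ne hp
  have hf := f_ne hp
  have hW := (𝓦_pos hp.2.2).ne'
  have a0 := (hasPd_coeffA_time hp).pd_eq
  have a1 := (hasPd_coeffA (Or.inl rfl) hp).pd_eq
  have a2 := (hasPd_coeffA (Or.inr rfl) hp).pd_eq
  have a3 := (hasPd_coeffA_label hp).pd_eq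
  have b0 := (hasPd_coeffB (k := 0) (by decide) hp).pd_eq
  have b1 := (hasPd_coeffB (k := 1) (by decide) hp).pd_eq
  have b2 := (hasPd_coeffB (k := 2) (by decide) hp).pd_eq
  have b3 := (hasPd_coeffB_label hp).pd_eq
  have g1 := (hasPd_radialScale (Or.inl rfl) hp).pd_eq
  have g2 := (hasPd_radialScale (Or.inr rfl) hp).pd_eq
  have n1 := (hasPd_labelRate (k := 1) (by decide) hp).pd_eq
  have n2 := (hasPd_labelRate (k := 2) (by decide) hp).pd_eq
  have w := 𝓦_sq hp.2.2
  have p1 := den_relation hp.1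
  have p2 := den_relation_label hp.1
  have hc := curvature_identity hp hG
  have e0 : M.denGrad 0 p = 0 := rfl
  have e1 : M.denGrad 1 p = lin M.c₀ M.c₁ 1 p := rfl
  have e2 : M.denGrad 2 p = lin M.c₀ M.c₂ 2 p := rfl
  have e3 : M.denGrad 3 p = M.denLabel p := rfl
  have l1 : M.denLabelGrad 1 p = lin (deriv M.c₀) (deriv M.c₁) 1 p := rfl
  have l2 : M.denLabelGrad 2 p = lin (deriv M.c₀) (deriv M.c₂) 2 p := rfl
  have hA : M.coeffA p = M.scale p * (M.f (p 3) / M.den p) := rfl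
  have hB : M.coeffB p = M.𝓦 (p 3) * M.radialScale p := rfl
  have two : (2 : WithTop ℕ∞) ≤ ∞ := ENat.LEInfty.out
  have hcA := (contDiffOn_coeffA.contDiffAt (M.isOpen_chart.mem_nhds hp)).of_le two
  have hcB := (contDiffOn_coeffB.contDiffAt (M.isOpen_chart.mem_nhds hp)).of_le two
  have hk : (M.k₀ / M.scale p ^ 2 - (3 * M.rate p * M.rate₁ p + M.rate₂ p)) * M.coeffA p ^ 2
      * M.coeffB p = M.k₀ * M.labelRate p / M.scale p * M.coeffA p ^ 2 * M.𝓦 (p 3) := by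
    rw [← hc, hB]
    ring
  constructor
  case a_ne => exact hA ▸ mul_ne_zero hs (div_ne_zero hf hE)
  case b_ne => exact hB ▸ mul_ne_zero hW hG
  case dda_symm => exact fun i j => pd_comm i j hcA
  case ddb_symm => exact fun i j => pd_comm i j hcB
  case a_t =>
    rw [a0, hA, rate]
    field_simp
  case b_t =>
    rw [b0, hB, rate₁]
    field_simp
    ring
  case a_tt =>
    rw [pd_time_pd_time_coeffA hp, hA]
    field_simp
  case b_tt =>
    rw [pd_pd_coeffB (by decide) (by decide) hp, hB, rate₂]
    field_simp
    ring
  case a_tx =>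
    rw [pd_pd_coeffA (Or.inl rfl) (Or.inl rfl) hp, a1, rate, e0]
    simp
    field_simp
  case a_ty =>
    rw [pd_pd_coeffA (Or.inl rfl) (Or.inr rfl) hp, a2, rate, e0]
    simp
    field_simp
  case a_tz =>
    rw [pd_pd_label_coeffA 0 hp, a3, rate₁, e0]
    field_simp
    ring
  case b_tx =>
    rw [pd_pd_coeffB (by decide) (by decide) hp, b1, g1, pd_time_pd_radialScale (Or.inl rfl) hp,
      rate]
    field_simp
  case b_ty =>
    rw [pd_pd_coeffB (by decide) (by decide) hp, b2, g2, pd_time_pd_radialScale (Or.inr rfl) hp,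
      rate]
    field_simp
  case b_xy =>
    rw [pd_pd_coeffB (by decide) (by decide) hp, pd_pd_radialScale (Or.inl rfl) (Or.inr rfl) hp,
      (hasPd_pd_labelRate (Or.inr rfl) (by decide) hp).pd_eq, b1, b2, g1, g2, n1, n2, a1, a2, hA]
    simp
    field_simp
    ring
  case a_xz =>
    rw [pd_pd_label_coeffA 1 hp, a1, a3, b1, hA, hB]
    field_simp
    ring
  case a_yz =>
    rw [pd_pd_label_coeffA 2 hp, a2, a3, b2, hA, hB]
    field_simp
    ring
  case k_xy =>
    rw [pd_pd_coeffA (Or.inr (Or.inr rfl)) (Or.inr rfl) hp,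
      pd_pd_coeffA (Or.inr (Or.inl rfl)) (Or.inl rfl) hp, a1, a2, a3, hA, hB, e1, e2]
    simp
    field_simp
    linear_combination (-M.𝓦 (p 3) ^ 2) * p1 - w
  -- The derivative `∂_ξ (S 𝓖)`, which would bring in second label derivatives, occurs in `A_{,ξξ}`
  -- and in `A_{,ξ} B_{,ξ}/B` and cancels between them.
  case k_xz =>
    rw [hk, pd_pd_coeffB (by decide) (by decide) hp, pd_pd_radialScale (Or.inl rfl) (Or.inl rfl) hp,
      (hasPd_pd_labelRate (Or.inl rfl) (by decide) hp).pd_eq, pd_pd_label_coeffA 3 hp, b1, b2, b3,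
      g1, g2, n1, n2, a1, a2, a3, hA, hB, e1, e2, e3, l1, l2, labelRate]
    simp only [if_true]
    field_simp
    linear_combination M.radialScale p * ((-M.𝓦 (p 3) ^ 2 * M.den p) * p2
      + (M.𝓦 (p 3) ^ 2 * M.denLabel p) * p1 + M.denLabel p * w)
  case k_yz =>
    rw [hk, pd_pd_coeffB (by decide) (by decide) hp, pd_pd_radialScale (Or.inr rfl) (Or.inr rfl) hp,
      (hasPd_pd_labelRate (Or.inr rfl) (by decide) hp).pd_eq, pd_pd_label_coeffA 3 hp, b1, b2, b3,
      g1, g2, n1, n2, a1, a2, a3, hA, hB, e1, e2, e3, l1, l2, labelRate]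
    simp only [if_true]
    field_simp
    linear_combination M.radialScale p * ((-M.𝓦 (p 3) ^ 2 * M.den p) * p2
      + (M.𝓦 (p 3) ^ 2 * M.denLabel p) * p1 + M.denLabel p * w)

/-! #### Comparison with the modes -/

variable {t : ℝ} {x : Fin 3 → ℝ}

theorem Regular.mem_chart (h : M.Regular t x) : (Fin.cons t x : Fin 4 → ℝ) ∈ M.chart :=
  ⟨h.1, h.2.1, h.2.2.1⟩

theorem isDensityMode_𝓕 (hx : x 2 ∈ Prod.snd '' M.Ω) :
    IsDensityMode (M.μ (x 2)) (M.lifeSpan (x 2)) (fun t => M.S t (x 2)) (M.𝓕 x) :=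
  (M.growing _ hx).1.linear_combination (M.background _ hx).isOpen
    (M.background _ hx).isDensityMode_hubble _ _

theorem 𝓐_eq (h : (Fin.cons t x : Fin 4 → ℝ) ∈ M.chart) :
    M.𝓐 x = M.labelRate (Fin.cons t x) - M.k₀ * M.βPlus (x 2) := by
  have hE := den_ne h
  have hf := f_ne h
  have d := (hasPd_f h.1 3).div (hasPd_den h.1 3) hE
  have e : pd 2 (fun y => Real.log (M.expNu y)) x = _ :=
    (pd_succ_cons (fun p => Real.log (M.f (p 3) / M.den p)) t x 2).trans
      (HasDerivAt.log d (by simpa using div_ne_zero hf hE)).deriv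
  rw [𝓐, e, labelRate]
  simp only [Function.update_eq_self]
  rw [cons_apply_three] at hf ⊢
  simp
  field_simp

/-- Here `𝓕_eq` is used. It also supplies the regularity of `𝓖`: the growing mode is not assumed
smooth in the label, but `S_{,ξ}` is. -/
theorem radialScale_eq (h : (Fin.cons t x : Fin 4 → ℝ) ∈ M.chart) :
    M.radialScale (Fin.cons t x) = M.S t (x 2) * M.𝓖 t x := by
  have hs := (M.scale_pos h.1).ne'
  rw [𝓖, 𝓐_eq h, M.𝓕_eq x (t := t) h.1, radialScale, cons_apply_three,
    show M.S t (x 2) = M.scale (Fin.cons t x) from rfl]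
  field_simp
  ring

end ClassI

section time

variable {L : Set ℝ} {S F : ℝ → ℝ} {α t : ℝ}

/-- The first two derivatives of `S (α - F)`. -/
theorem hasDerivAt_radial (hL : IsOpen L) (hS : ContDiffOn ℝ ∞ S L) (hF : ContDiffOn ℝ 2 F L)
    (ht : t ∈ L) :
    deriv (fun s => S s * (α - F s)) t = deriv S t * (α - F t) - S t * deriv F t ∧
    deriv (deriv fun s => S s * (α - F s)) t = deriv (deriv S) t * (α - F t)
      - 2 * deriv S t * deriv F t - S t * deriv (deriv F) t := by
  have dS : ∀ u ∈ L, HasDerivAt S (deriv S u) u := fun u hu =>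
    ((hS.contDiffAt (hL.mem_nhds hu)).differentiableAt (by simp)).hasDerivAt
  have dF : ∀ u ∈ L, HasDerivAt F (deriv F u) u := fun u hu =>
    ((hF.contDiffAt (hL.mem_nhds hu)).differentiableAt (by simp)).hasDerivAt
  have hS' : ContDiffOn ℝ 1 (deriv S) L := 
    (hS.of_le (show (2 : WithTop ℕ∞) ≤ ∞ from ENat.LEInfty.out)).deriv_of_isOpen hL (by norm_num)
  have hF' : ContDiffOn ℝ 1 (deriv F) L := hF.deriv_of_isOpen hL (by norm_num)
  have ddS := ((hS'.contDiffAt (hL.mem_nhds ht)).differentiableAt (by simp)).hasDerivAt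
  have ddF := ((hF'.contDiffAt (hL.mem_nhds ht)).differentiableAt (by simp)).hasDerivAt
  have d1 : ∀ u ∈ L, deriv (fun s => S s * (α - F s)) u
      = deriv S u * (α - F u) - S u * deriv F u := fun u hu =>
    (((dS u hu).mul ((dF u hu).const_sub α)).deriv).trans (by ring)
  refine ⟨d1 t ht, ?_⟩
  have e : (deriv fun s => S s * (α - F s)) =ᶠ[𝓝 t] fun u =>
      deriv S u * (α - F u) - S u * deriv F u :=
    (hL.eventually_mem ht).mono fun u hu => d1 u hu
  have d2 := (ddS.mul ((dF t ht).const_sub α)).sub ((dS t ht).mul ddF)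
  exact (e.deriv_eq.trans d2.deriv).trans (by ring)

end time

namespace ClassI

variable {Λ : ℝ} {M : ClassI Λ} {t : ℝ} {x : Fin 3 → ℝ}

theorem Regular.isSzekeresAt (h : M.Regular t x) : IsSzekeresAt M.metric M.coeffA M.coeffB t x
    (hubble (fun t => M.S t (x 2)) t)
    (deriv (deriv fun t => M.S t (x 2)) t / M.S t (x 2))
    (-deriv (M.𝓕 x) t / (M.𝓐 x - M.𝓕 x t)) (-deriv (deriv (M.𝓕 x)) t / (M.𝓐 x - M.𝓕 x t))
    (M.k₀ / M.S t (x 2) ^ 2) := by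
  have hc := h.mem_chart
  have hx : x 2 ∈ Prod.snd '' M.Ω := M.label_mem hc.1
  have hb := M.background _ hx
  have hs : M.S t (x 2) ≠ 0 := (M.scale_pos hc.1).ne'
  have hg : M.𝓐 x - M.𝓕 x t ≠ 0 := h.2.2.2
  have hR : M.radialScale (Fin.cons t x) ≠ 0 := by
    rw [radialScale_eq hc]
    exact mul_ne_zero hs hg
  have two : (2 : WithTop ℕ∞) ≤ ∞ := ENat.LEInfty.out
  have hcurve : Tendsto (fun s : ℝ => (Fin.cons s x : Fin 4 → ℝ)) (𝓝 t) (𝓝 (Fin.cons t x)) := by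
    refine tendsto_pi_nhds.2 fun i => ?_
    refine Fin.cases ?_ (fun j => ?_) i
    · exact tendsto_id
    · exact tendsto_const_nhds
  -- Equality near `t`, not only at `t`, since two time derivatives follow.
  have er : (fun s => M.radialScale (Fin.cons s x)) =ᶠ[𝓝 t]
      fun s => M.S s (x 2) * (M.𝓐 x - M.𝓕 x s) :=
    (hcurve.eventually (M.isOpen_chart.eventually_mem hc)).mono fun s hs => radialScale_eq hs
  have g0 : M.radialScale (Fin.cons t x) = M.S t (x 2) * (M.𝓐 x - M.𝓕 x t) := radialScale_eq hc
  have g1 : pd 0 M.radialScale (Fin.cons t x) = _ := (pd_zero_cons _ t x).trans er.deriv_eq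
  have g2 : pd 0 (pd 0 M.radialScale) (Fin.cons t x) = _ :=
    (pd_zero_cons _ t x).trans ((congrArg (fun g => deriv g t)
      (funext fun s => pd_zero_cons _ s x)).trans er.deriv.deriv_eq)
  obtain ⟨r1, r2⟩ := hasDerivAt_radial (α := M.𝓐 x) hb.isOpen hb.smooth
    (isDensityMode_𝓕 hx).1 h.1
  rw [r1] at g1
  rw [r2] at g2
  have s1 : pd 0 M.scale (Fin.cons t x) = deriv (fun t => M.S t (x 2)) t := by
    rw [pd_zero_scale]
    rfl
  have s2 : pd 0 (pd 0 M.scale) (Fin.cons t x) = deriv (deriv fun t => M.S t (x 2)) t := by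
    rw [pd_zero_pd_zero_scale]
    rfl
  have s0 : M.scale (Fin.cons t x) = M.S t (x 2) := rfl
  have e0 : M.rate (Fin.cons t x) = hubble (fun t => M.S t (x 2)) t := by
    rw [rate, s1]
    rfl
  have e1 : M.rate₁ (Fin.cons t x) = -deriv (M.𝓕 x) t / (M.𝓐 x - M.𝓕 x t) := by
    rw [rate₁, rate, s1, s0, g0, g1]
    field_simp
    ring
  have e2 : M.rate₂ (Fin.cons t x) = -deriv (deriv (M.𝓕 x)) t / (M.𝓐 x - M.𝓕 x t) := by
    rw [rate₂, e1, rate, s1, s2, s0, g0, g2]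
    field_simp
    ring
  refine ⟨?_, (contDiffOn_coeffA.contDiffAt (M.isOpen_chart.mem_nhds hc)).of_le two,
    (contDiffOn_coeffB.contDiffAt (M.isOpen_chart.mem_nhds hc)).of_le two, ?_⟩
  · filter_upwards [M.isOpen_chart.eventually_mem hc] with q hq
    have eq : q = Fin.cons (q 0) (Fin.tail q) := (Fin.cons_self_tail q).symm
    have hB : M.coeffB q = M.𝓦 (q 3) * (M.S (q 0) (q 3) * M.𝓖 (q 0) (Fin.tail q)) := by
      rw [coeffB]
      congr 1
      have := radialScale_eq (t := q 0) (x := Fin.tail q) (eq ▸ hq)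
      rwa [← eq] at this
    have hA : M.coeffA q = M.S (q 0) (q 3) * M.expNu (Fin.tail q) := rfl
    rw [metric, gwMetric, hA, hB, show Fin.tail q 2 = q 3 from rfl]
    simp only [mul_pow]
    rw [mul_comm (M.𝓦 (q 3) ^ 2)]
  · have := szekeresJet hc hR
    rwa [e0, e1, e2, s2, s0] at this

end ClassI
end Szekeres

namespace Szekeres

/-! ### Consequences of the Szekeres form for dust -/

section dust

variable {Λ k₀ μ T : ℝ} {L : Set ℝ} {S F : ℝ → ℝ} {h : SpatialMetric} {A B : (Fin 4 → ℝ) → ℝ}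
  {t : ℝ} {x : Fin 3 → ℝ} {α : ℝ} {ρ : ℝ → (Fin 3 → ℝ) → ℝ}

/-- By the mode equation `-(2 H γ₁ + γ₂) = (3 μ/S³) F/(α - F)`. Added to the background term `3
μ/S³` this gives `(3 μ/S³) α/(α - F)`, the prescribed density. -/
theorem IsSzekeresAt.isDustSolutionAt_of_mode (hb : IsBackground Λ k₀ μ T L S)
    (hF : IsDensityMode μ L S F) (ht : t ∈ L) (hG : α - F t ≠ 0)
    (hS : IsSzekeresAt h A B t x (hubble S t) (deriv (deriv S) t / S t)
      (-deriv F t / (α - F t)) (-deriv (deriv F) t / (α - F t)) (k₀ / S t ^ 2))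
    (hρ : ρ t x = 6 * μ * α / (S t ^ 3 * (α - F t)) / (8 * Real.pi)) :
    IsDustSolutionAt Λ h ρ t x := by
  have hs := (hb.pos t ht).ne'
  refine hS.isDustSolutionAt (m := μ / S t ^ 3) (hb.hubble_sq ht) ?_ ?_
  · rw [hb.acceleration ht]
    field_simp
  · have hF2 := hF.2 t ht
    have e : deriv (deriv F) t = 3 * μ / S t ^ 3 * F t - 2 * hubble S t * deriv F t := by
      linear_combination hF2
    have hπ := Real.pi_ne_zero
    rw [hρ, e]
    field_simp
    ring

theorem IsSzekeresAt.localQuantities_eq_functionals {tᵢ : ℝ} (hb : IsBackground Λ k₀ μ T L S)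
    (ht : t ∈ L) (hi : tᵢ ∈ L) (hG : α - F t ≠ 0) (hGi : α - F tᵢ ≠ 0)
    (hS : IsSzekeresAt h A B t x (hubble S t) (deriv (deriv S) t / S t)
      (-deriv F t / (α - F t)) (-deriv (deriv F) t / (α - F t)) (k₀ / S t ^ 2))
    (hρ : ∀ t, ρ t x = 6 * μ * α / (S t ^ 3 * (α - F t)) / (8 * Real.pi)) :
    localQuantities h ρ t x
      = exactBodyFunctionals k₀ S (gwDeformation α F tᵢ) (ρ tᵢ x) tᵢ t := by
  have hs := (hb.pos t ht).ne'
  have hsi := (hb.pos tᵢ hi).ne'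
  rw [hS.localQuantities_at, exactBodyFunctionals_gwDeformation k₀ S _ t hGi hG rfl rfl rfl]
  congr 1
  rw [hρ, hρ]
  have hπ := Real.pi_ne_zero
  field_simp

end dust

/-! ### Quotients of quadratic forms -/

section quotients

variable {a b c d a₁ b₁ c₁ d₁ : ℝ → ℝ} {p : Fin 4 → ℝ}

/-- The transversal gradient of a quadratic form. -/
def quadGrad (a b c : ℝ → ℝ) (k : Fin 4) (p : Fin 4 → ℝ) : ℝ := ![0, lin a b 1 p, lin a c 2 p, 0] k

theorem hasPd_quad_of_ne {V : Set ℝ} {k : Fin 4} (hk : k ≠ 3) (hV : IsOpen V)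
    (ha : ContDiffOn ℝ ∞ a V) (hb : ContDiffOn ℝ ∞ b V) (hc : ContDiffOn ℝ ∞ c V)
    (hd : ContDiffOn ℝ ∞ d V) (hp : p 3 ∈ V) : HasPd k (quad a b c d) (quadGrad a b c k p) p := by
  have h : ∀ {g : ℝ → ℝ}, ContDiffOn ℝ ∞ g V → HasDerivAt g (deriv g (p 3)) (p 3) := fun hg =>
    ((hg.contDiffAt (hV.mem_nhds hp)).differentiableAt (by simp)).hasDerivAt
  refine (hasPd_quad (h ha) (h hb) (h hc) (h hd) k).congr ?_
  fin_cases k <;> first | rfl | exact absurd rfl hk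

theorem hasPd_quadGrad {V : Set ℝ} {j k : Fin 4} (hk : k = 1 ∨ k = 2) (hj : j ≠ 3) (hV : IsOpen V)
    (ha : ContDiffOn ℝ ∞ a V) (hb : ContDiffOn ℝ ∞ b V) (hc : ContDiffOn ℝ ∞ c V) (hp : p 3 ∈ V) :
    HasPd j (quadGrad a b c k) (if j = k then 2 * a (p 3) else 0) p := by
  have h : ∀ {g : ℝ → ℝ}, ContDiffOn ℝ ∞ g V → HasDerivAt g (deriv g (p 3)) (p 3) := fun hg =>
    ((hg.contDiffAt (hV.mem_nhds hp)).differentiableAt (by simp)).hasDerivAt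
  rcases hk with rfl | rfl
  · exact (hasPd_lin (h ha) (h hb) 1 j).congr (by simp [hj])
  · exact (hasPd_lin (h ha) (h hc) 2 j).congr (by simp [hj])

end quotients

namespace ClassII

/-! ### Class II models are Szekeres spacetimes -/

variable {Λ : ℝ} (M : ClassII Λ)

/-- The denominator of `e^ν`. -/
noncomputable def den : (Fin 4 → ℝ) → ℝ :=
  quad (fun _ => M.k₀ / 4) (fun _ => 0) (fun _ => 0) fun _ => 1

open Classical in
/-- The coefficient of `ς² + ϰ²` in `e^{-ν} 𝓐`. -/
noncomputable def leadCoeff (ξ : ℝ) : ℝ :=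
  if M.k₀ = 0 then -M.βPlus ξ / 2 else -(M.k₀ / 4) * (M.c₀ ξ + M.k₀ * M.βPlus ξ)

/-- The constant coefficient in `e^{-ν} 𝓐`. -/
noncomputable def constCoeff (ξ : ℝ) : ℝ := M.c₀ ξ - M.k₀ * M.βPlus ξ

/-- The quadratic form `e^{-ν} 𝓐`. -/
noncomputable def num : (Fin 4 → ℝ) → ℝ :=
  quad M.leadCoeff (fun ξ => M.c₁ ξ / 2) (fun ξ => M.c₂ ξ / 2) M.constCoeff

/-- The events at which the coordinates are defined. -/
def chart : Set (Fin 4 → ℝ) := {p | p 0 ∈ M.L ∧ p 3 ∈ M.X ∧ 0 < M.den p}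

/-- The metric coefficient `S e^ν`. -/
noncomputable def coeffA (p : Fin 4 → ℝ) : ℝ := M.S (p 0) / M.den p

/-- The superposition of the modes as a function of the event. -/
noncomputable def modeSum (p : Fin 4 → ℝ) : ℝ :=
  M.βPlus (p 3) * M.fPlus (p 0) + M.βMinus (p 3) * M.fMinus (p 0)

/-- The metric coefficient `S 𝓖`. -/
noncomputable def coeffB (p : Fin 4 → ℝ) : ℝ := M.S (p 0) * (M.num p / M.den p - M.modeSum p)

/-- The relation between the coefficients of `e^{-ν} 𝓐` and `β₊`. -/
theorem coeff_relation (ξ : ℝ) : 2 * M.leadCoeff ξ + M.k₀ / 2 * M.constCoeff ξ = -M.βPlus ξ := by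
  rw [leadCoeff, constCoeff]
  rcases M.k₀_mem with h | h | h <;> simp [h] <;> ring

theorem contDiffOn_leadCoeff : ContDiffOn ℝ ∞ M.leadCoeff M.X := by
  unfold leadCoeff
  split_ifs
  · exact M.βPlus_smooth.neg.div_const 2
  · exact contDiffOn_const.mul (M.c₀_smooth.add (contDiffOn_const.mul M.βPlus_smooth))

theorem contDiffOn_constCoeff : ContDiffOn ℝ ∞ M.constCoeff M.X :=
  M.c₀_smooth.sub (contDiffOn_const.mul M.βPlus_smooth)

theorem contDiffOn_num : ContDiffOn ℝ ∞ M.num M.chart :=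
  contDiffOn_quad M.contDiffOn_leadCoeff (M.c₁_smooth.div_const 2) (M.c₂_smooth.div_const 2)
    M.contDiffOn_constCoeff fun _ hp => hp.2.1

theorem contDiff_den : ContDiff ℝ ∞ M.den :=
  contDiffOn_univ.1 (contDiffOn_quad contDiffOn_const contDiffOn_const contDiffOn_const
    contDiffOn_const fun _ _ => mem_univ _)

theorem isOpen_chart : IsOpen M.chart :=
  (M.background.isOpen.preimage (continuous_apply 0)).inter
    ((M.X_open.preimage (continuous_apply 3)).inter
      (isOpen_Ioi.preimage M.contDiff_den.continuous))

theorem contDiffOn_scale : ContDiffOn ℝ ∞ (fun p : Fin 4 → ℝ => M.S (p 0)) M.chart :=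
  M.background.smooth.comp (contDiff_apply ℝ ℝ 0).contDiffOn fun _ hp => hp.1

variable {M} {p : Fin 4 → ℝ}

theorem contDiffOn_coeffA : ContDiffOn ℝ ∞ M.coeffA M.chart :=
  M.contDiffOn_scale.div M.contDiff_den.contDiffOn fun _ hp => hp.2.2.ne'

/-- Modes are only assumed `C²` in time; this is all that the curvature of the metric needs. -/
theorem contDiffOn_modeSum : ContDiffOn ℝ 2 M.modeSum M.chart := by
  have h0 : ∀ {g : ℝ → ℝ}, ContDiffOn ℝ 2 g M.L →
      ContDiffOn ℝ 2 (fun p : Fin 4 → ℝ => g (p 0)) M.chart := fun hg =>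
    hg.comp (contDiff_apply ℝ ℝ 0).contDiffOn fun _ hp => hp.1
  have h3 : ∀ {g : ℝ → ℝ}, ContDiffOn ℝ ∞ g M.X →
      ContDiffOn ℝ 2 (fun p : Fin 4 → ℝ => g (p 3)) M.chart := fun hg =>
    (contDiffOn_label hg fun _ hp => hp.2.1).of_le ENat.LEInfty.out
  exact ((h3 M.βPlus_smooth).mul (h0 M.growing.1.1)).add
    ((h3 M.βMinus_smooth).mul (h0 M.background.isDensityMode_hubble.1))

theorem contDiffOn_quotient : ContDiffOn ℝ ∞ (fun p => M.num p / M.den p) M.chart :=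
  M.contDiffOn_num.div M.contDiff_den.contDiffOn fun _ hp => hp.2.2.ne'

theorem contDiffOn_coeffB : ContDiffOn ℝ 2 M.coeffB M.chart :=
  (M.contDiffOn_scale.of_le ENat.LEInfty.out).mul
    ((contDiffOn_quotient.of_le ENat.LEInfty.out).sub contDiffOn_modeSum)

/-- The transversal gradient of the denominator of `e^ν`. -/
noncomputable def denGrad (M : ClassII Λ) : Fin 4 → (Fin 4 → ℝ) → ℝ :=
  quadGrad (fun _ => M.k₀ / 4) (fun _ => 0) fun _ => 0

/-- The transversal gradient of `e^{-ν} 𝓐`. -/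
noncomputable def numGrad (M : ClassII Λ) : Fin 4 → (Fin 4 → ℝ) → ℝ :=
  quadGrad M.leadCoeff (fun ξ => M.c₁ ξ / 2) fun ξ => M.c₂ ξ / 2

theorem hasPd_den (k : Fin 4) : HasPd k M.den (M.denGrad k p) p := by
  refine (hasPd_quad (hasDerivAt_const _ _) (hasDerivAt_const _ _) (hasDerivAt_const _ _)
    (hasDerivAt_const _ _) k).congr ?_
  fin_cases k <;> first | rfl | simp [denGrad, quadGrad]

theorem hasPd_num {k : Fin 4} (hk : k ≠ 3) (hp : p ∈ M.chart) :
    HasPd k M.num (M.numGrad k p) p :=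
  hasPd_quad_of_ne hk M.X_open M.contDiffOn_leadCoeff (M.c₁_smooth.div_const 2)
    (M.c₂_smooth.div_const 2) M.contDiffOn_constCoeff hp.2.1

theorem hasPd_denGrad {j k : Fin 4} (hk : k = 1 ∨ k = 2) (hj : j ≠ 3) :
    HasPd j (M.denGrad k) (if j = k then M.k₀ / 2 else 0) p :=
  (hasPd_quadGrad hk hj isOpen_univ contDiffOn_const contDiffOn_const contDiffOn_const
    (mem_univ _)).congr (by split_ifs <;> ring)

theorem hasPd_numGrad {j k : Fin 4} (hk : k = 1 ∨ k = 2) (hj : j ≠ 3) (hp : p ∈ M.chart) :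
    HasPd j (M.numGrad k) (if j = k then 2 * M.leadCoeff (p 3) else 0) p :=
  hasPd_quadGrad hk hj M.X_open M.contDiffOn_leadCoeff (M.c₁_smooth.div_const 2)
    (M.c₂_smooth.div_const 2) hp.2.1

/-- The transversal gradient of `𝓐`. -/
noncomputable def quotGrad (M : ClassII Λ) (k : Fin 4) (p : Fin 4 → ℝ) : ℝ :=
  (M.numGrad k p * M.den p - M.num p * M.denGrad k p) / M.den p ^ 2

theorem hasPd_quotGrad {j k : Fin 4} (hk : k = 1 ∨ k = 2) (hj : j ≠ 3) (hp : p ∈ M.chart) :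
    HasPd j (M.quotGrad k) (
      ((if j = k then 2 * M.leadCoeff (p 3) else 0) * M.den p
        + M.numGrad k p * M.denGrad j p - M.numGrad j p * M.denGrad k p
        - M.num p * (if j = k then M.k₀ / 2 else 0)) / M.den p ^ 2
      - 2 * (M.numGrad k p * M.den p - M.num p * M.denGrad k p) * M.denGrad j p
        / M.den p ^ 3) p := by
  have hE := hp.2.2.ne'
  refine ((((hasPd_numGrad hk hj hp).mul (hasPd_den j)).sub
    ((hasPd_num hj hp).mul (hasPd_denGrad hk hj))).div
      ((hasPd_den j).pow 2) (pow_ne_zero 2 hE)).congr ?_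
  field_simp
  push_cast
  ring

theorem hasPd_scale (i : Fin 4) (hp : p ∈ M.chart) : HasPd i (fun p : Fin 4 → ℝ => M.S (p 0))
    (if i = 0 then deriv M.S (p 0) else 0) p :=
  hasPd_coord 0 (M.background.hasDerivAt hp.1)

theorem hasPd_deriv_scale (i : Fin 4) (hp : p ∈ M.chart) :
    HasPd i (fun p : Fin 4 → ℝ => deriv M.S (p 0))
      (if i = 0 then deriv (deriv M.S) (p 0) else 0) p :=
  hasPd_coord 0 (M.background.hasDerivAt_deriv hp.1)

theorem hasPd_modeSum {k : Fin 4} (hk : k = 1 ∨ k = 2) : HasPd k M.modeSum 0 p := by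
  rcases hk with rfl | rfl <;> simpa [HasPd, modeSum] using hasDerivAt_const _ _

theorem hasPd_coeffA (k : Fin 4) (hp : p ∈ M.chart) :
    HasPd k M.coeffA (((if k = 0 then deriv M.S (p 0) else 0) * M.den p
      - M.S (p 0) * M.denGrad k p) / M.den p ^ 2) p :=
  (hasPd_scale k hp).div (hasPd_den k) hp.2.2.ne'

/-- In class II, `A` does not depend on `ξ`; the relations `a_tz`, `a_xz`, `a_yz` are therefore
trivial. -/
theorem pd_pd_coeffA_label (i : Fin 4) (hp : p ∈ M.chart) : pd i (pd 3 M.coeffA) p = 0 := by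
  refine pd_pd_eq M.isOpen_chart hp (fun q hq => (hasPd_coeffA 3 hq).congr ?_) (hasPd_const 0)
  simp [denGrad, quadGrad]

theorem pd_time_pd_time_coeffA (hp : p ∈ M.chart) :
    pd 0 (pd 0 M.coeffA) p = deriv (deriv M.S) (p 0) / M.den p := by
  have hE : ∀ q ∈ M.chart, M.den q ≠ 0 := fun q hq => hq.2.2.ne'
  refine pd_pd_eq (φ₁ := fun q => deriv M.S (q 0) / M.den q) M.isOpen_chart hp
    (fun q hq => (hasPd_coeffA 0 hq).congr ?_)
    (((hasPd_deriv_scale 0 hp).div (hasPd_den 0) (hE p hp)).congr ?_)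
  · have := hE q hq
    simp [denGrad, quadGrad]
    field_simp
  · have := hE p hp
    simp [denGrad, quadGrad]
    field_simp

theorem pd_pd_coeffA {j k : Fin 4} (hj : j ≠ 3) (hk : k = 1 ∨ k = 2) (hp : p ∈ M.chart) :
    pd j (pd k M.coeffA) p =
      -((if j = 0 then deriv M.S (p 0) else 0) * M.denGrad k p / M.den p ^ 2)
      - M.S (p 0) * ((if j = k then M.k₀ / 2 else 0) / M.den p ^ 2
          - 2 * M.denGrad k p * M.denGrad j p / M.den p ^ 3) := by
  have hk0 : k ≠ 0 := by rcases hk with rfl | rfl <;> decide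
  have hE : M.den p ≠ 0 := hp.2.2.ne'
  refine pd_pd_eq (φ₁ := fun q => -1 * (M.S (q 0) * M.denGrad k q / M.den q ^ 2)) M.isOpen_chart hp
    (fun q hq => (hasPd_coeffA k hq).congr ?_)
    (((((hasPd_scale j hp).mul (hasPd_denGrad hk hj)).div ((hasPd_den j).pow 2)
      (pow_ne_zero 2 hE)).const_mul (-1)).congr ?_)
  · simp only [if_neg hk0]
    ring
  · field_simp
    push_cast
    ring

theorem hasPd_coeffB {k : Fin 4} (hk : k = 1 ∨ k = 2) (hp : p ∈ M.chart) :
    HasPd k M.coeffB (M.S (p 0) * M.quotGrad k p) p := by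
  have hk3 : k ≠ 3 := by rcases hk with rfl | rfl <;> decide
  have hk0 : k ≠ 0 := by rcases hk with rfl | rfl <;> decide
  refine ((hasPd_scale k hp).mul (((hasPd_num hk3 hp).div (hasPd_den k) hp.2.2.ne').sub
    (hasPd_modeSum hk))).congr ?_
  simp [hk0, quotGrad]

theorem pd_pd_coeffB {j k : Fin 4} (hj : j ≠ 3) (hk : k = 1 ∨ k = 2) (hp : p ∈ M.chart) :
    pd j (pd k M.coeffB) p = (if j = 0 then deriv M.S (p 0) else 0) * M.quotGrad k p
      + M.S (p 0) * (((if j = k then 2 * M.leadCoeff (p 3) else 0) * M.den p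
        + M.numGrad k p * M.denGrad j p - M.numGrad j p * M.denGrad k p
        - M.num p * (if j = k then M.k₀ / 2 else 0)) / M.den p ^ 2
      - 2 * (M.numGrad k p * M.den p - M.num p * M.denGrad k p) * M.denGrad j p
        / M.den p ^ 3) :=
  pd_pd_eq M.isOpen_chart hp (fun _ hq => hasPd_coeffB hk hq)
    ((hasPd_scale j hp).mul (hasPd_quotGrad hk hj hp))

end ClassII
end Szekeres

namespace Szekeres
-- Verification of the jet relations in class II
namespace ClassII

variable {Λ : ℝ} {M : ClassII Λ} {p : Fin 4 → ℝ} {t : ℝ} {x : Fin 3 → ℝ}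

/-- This expresses that `e^{2ν} (dς² + dϰ²)` has constant curvature `k₀`. -/
theorem denGrad_sq : M.denGrad 1 p ^ 2 + M.denGrad 2 p ^ 2 = M.k₀ * (M.den p - 1) := by
  simp [denGrad, den, quadGrad, lin, quad]
  ring

/-- The corresponding bilinear identity for the forms `e^{-ν} 𝓐` and `e^{-ν}`. The term `β₊` enters
through `coeff_relation`, uniformly in the three values of `k₀`. -/
theorem numGrad_mul_denGrad :
    M.numGrad 1 p * M.denGrad 1 p + M.numGrad 2 p * M.denGrad 2 p
      = M.k₀ / 2 * M.num p + 2 * M.leadCoeff (p 3) * M.den p + M.βPlus (p 3) := by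
  have h := M.coeff_relation (p 3)
  simp [denGrad, den, numGrad, num, quadGrad, lin, quad]
  linear_combination -h

theorem expNu_eq (q : Fin 4 → ℝ) : M.expNu (Fin.tail q) = (M.den q)⁻¹ := by
  rw [expNu, den, quad, show Fin.tail q 0 = q 1 from rfl, show Fin.tail q 1 = q 2 from rfl]
  congr 1
  ring

theorem Regular.mem_chart (h : M.Regular t x) : (Fin.cons t x : Fin 4 → ℝ) ∈ M.chart := by
  have e : M.expNu x = (M.den (Fin.cons t x))⁻¹ := expNu_eq (Fin.cons t x)
  exact ⟨h.1, h.2.1, inv_pos.1 (e ▸ h.2.2.1)⟩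

/-- Absorbing `-k₀ β₊` into the numerator merges the flat and curved definitions into one quotient,
with denominator `1` if `k₀ = 0`. -/
theorem 𝓐_eq {q : Fin 4 → ℝ} (h : q ∈ M.chart) : M.𝓐 (Fin.tail q) = M.num q / M.den q := by
  have hE : M.den q ≠ 0 := h.2.2.ne'
  have hD : M.den q = M.k₀ / 4 * (q 1 ^ 2 + q 2 ^ 2) + 1 := by
    simp [den, quad]
  rw [𝓐, expNu_eq]
  simp only [Fin.tail, Fin.succ_zero_eq_one, Fin.succ_one_eq_two, show Fin.succ 2 = (3 : Fin 4) from rfl]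
  split_ifs with h0
  · rw [hD]
    simp [num, quad, leadCoeff, constCoeff, h0]
    ring
  · have hN : M.num q = -(M.k₀ / 4) * (M.c₀ (q 3) + M.k₀ * M.βPlus (q 3)) * (q 1 ^ 2 + q 2 ^ 2)
        + M.c₁ (q 3) * q 1 + M.c₂ (q 3) * q 2 + (M.c₀ (q 3) - M.k₀ * M.βPlus (q 3)) := by
      simp [num, quad, leadCoeff, constCoeff, h0]
      ring
    rw [hN]
    field_simp
    rw [hD]
    ring

theorem isDensityMode_𝓕 (x : Fin 3 → ℝ) : IsDensityMode M.μ M.L M.S (M.𝓕 x) :=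
  M.growing.1.linear_combination M.background.isOpen M.background.isDensityMode_hubble _ _

/-- The decaying mode has zero Wronskian with itself, so only the growing part contributes. This
first integral ties the dynamics of `𝓕` to the `β₊` that appears in `𝓐`. -/
theorem wronskian_𝓕 (x : Fin 3 → ℝ) (ht : t ∈ M.L) :
    M.S t ^ 2 * (hubble M.S t * deriv (M.𝓕 x) t
      - (M.k₀ / M.S t ^ 2 - 3 * M.μ / M.S t ^ 3) * M.𝓕 x t) = M.βPlus (x 2) := by
  have h1 := wronskian_growing M.background M.growing ht
  have e : deriv (M.𝓕 x) t = M.βPlus (x 2) * deriv M.fPlus t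
      + M.βMinus (x 2) * (M.k₀ / M.S t ^ 2 - 3 * M.μ / M.S t ^ 3) :=
    (((M.growing.1.hasDerivAt M.background.isOpen ht).const_mul _).add
      ((M.background.hasDerivAt_hubble ht).const_mul _)).deriv
  rw [e, show M.𝓕 x t = M.βPlus (x 2) * M.fPlus t + M.βMinus (x 2) * hubble M.S t from rfl]
  linear_combination M.βPlus (x 2) * h1

theorem Regular.szekeresJet (h : M.Regular t x) :
    SzekeresJet (M.coeffA (Fin.cons t x)) (M.coeffB (Fin.cons t x))
      (fun i => pd i M.coeffA (Fin.cons t x)) (fun i => pd i M.coeffB (Fin.cons t x))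
      (fun i j => pd i (pd j M.coeffA) (Fin.cons t x))
      (fun i j => pd i (pd j M.coeffB) (Fin.cons t x))
      (hubble M.S t) (deriv (deriv M.S) t / M.S t)
      (-deriv (M.𝓕 x) t / (M.𝓐 x - M.𝓕 x t)) (-deriv (deriv (M.𝓕 x)) t / (M.𝓐 x - M.𝓕 x t))
      (M.k₀ / M.S t ^ 2) := by
  have hp := h.mem_chart
  have hs := (M.background.pos t h.1).ne'
  have hg : M.𝓐 x - M.𝓕 x t ≠ 0 := h.2.2.2
  have hE : M.den (Fin.cons t x) ≠ 0 := hp.2.2.ne'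
  have hα : M.𝓐 x = M.num (Fin.cons t x) / M.den (Fin.cons t x) := 𝓐_eq hp
  have hA : M.coeffA (Fin.cons t x) = M.S t / M.den (Fin.cons t x) := rfl
  have eB : ∀ s, M.coeffB (Fin.cons s x) = M.S s * (M.𝓐 x - M.𝓕 x s) := fun s => by
    rw [hα]
    rfl
  obtain ⟨r1, r2⟩ := hasDerivAt_radial (α := M.𝓐 x) M.background.isOpen M.background.smooth
    (isDensityMode_𝓕 x).1 h.1
  have b0 : pd 0 M.coeffB (Fin.cons t x) = _ :=
    (pd_zero_cons _ t x).trans ((congrArg (fun g => deriv g t) (funext eB)).trans r1)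
  have b00 : pd 0 (pd 0 M.coeffB) (Fin.cons t x) = _ :=
    (pd_zero_cons _ t x).trans ((congrArg (fun g => deriv g t) (funext fun s =>
      (pd_zero_cons _ s x).trans (congrArg (fun g => deriv g s) (funext eB)))).trans r2)
  have a0 := (hasPd_coeffA 0 hp).pd_eq
  have a1 := (hasPd_coeffA 1 hp).pd_eq
  have a2 := (hasPd_coeffA 2 hp).pd_eq
  have a3 := (hasPd_coeffA 3 hp).pd_eq
  have b1 := (hasPd_coeffB (Or.inl rfl) hp).pd_eq
  have b2 := (hasPd_coeffB (Or.inr rfl) hp).pd_eq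
  have e0 : M.denGrad 0 (Fin.cons t x) = 0 := rfl
  have e3 : M.denGrad 3 (Fin.cons t x) = 0 := rfl
  have n0 : M.numGrad 0 (Fin.cons t x) = 0 := rfl
  simp only [Fin.cons_zero, if_true, if_false, e0, e3, mul_zero, sub_zero, zero_mul, zero_sub,
    zero_div, Fin.reduceEq] at a0 a1 a2 a3 b1 b2
  have hF := (isDensityMode_𝓕 (M := M) x).2 t h.1
  have hw := wronskian_𝓕 x h.1
  -- The mode equation removes the second derivative of `𝓕` and the Wronskian removes the rest of
  -- its time dependence. What remains, `k₀ 𝓐 + β₊`, is what the quadratic forms produce in `k_xz`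
  -- and `k_yz`.
  have hk : (M.k₀ / M.S t ^ 2 - (3 * hubble M.S t * (-deriv (M.𝓕 x) t / (M.𝓐 x - M.𝓕 x t))
      + -deriv (deriv (M.𝓕 x)) t / (M.𝓐 x - M.𝓕 x t))) * M.coeffA (Fin.cons t x) ^ 2
        * M.coeffB (Fin.cons t x) = (M.k₀ * M.𝓐 x + M.βPlus (x 2)) / M.S t
          * M.coeffA (Fin.cons t x) ^ 2 := by
    have e : deriv (deriv (M.𝓕 x)) t
        = 3 * M.μ / M.S t ^ 3 * M.𝓕 x t - 2 * hubble M.S t * deriv (M.𝓕 x) t := by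
      linear_combination hF
    rw [eB, e, ← hw]
    field_simp
    ring
  have q1 := denGrad_sq (M := M) (p := Fin.cons t x)
  have q2 := numGrad_mul_denGrad (M := M) (p := Fin.cons t x)
  rw [cons_apply_three] at q2
  have two : (2 : WithTop ℕ∞) ≤ ∞ := ENat.LEInfty.out
  have hcA := (contDiffOn_coeffA.contDiffAt (M.isOpen_chart.mem_nhds hp)).of_le two
  have hcB := contDiffOn_coeffB.contDiffAt (M.isOpen_chart.mem_nhds hp)
  constructor
  case a_ne => exact hA ▸ div_ne_zero hs hE
  case b_ne => exact eB t ▸ mul_ne_zero hs hg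
  case dda_symm => exact fun i j => pd_comm i j hcA
  case ddb_symm => exact fun i j => pd_comm i j hcB
  case a_t =>
    rw [a0, hA, hubble]
    field_simp
  case b_t =>
    rw [b0, eB, hubble]
    field_simp
    ring
  case a_tt =>
    rw [pd_time_pd_time_coeffA hp, hA, Fin.cons_zero]
    field_simp
  case b_tt =>
    rw [b00, eB, hubble]
    field_simp
    ring
  case a_tx =>
    rw [pd_pd_coeffA (by decide) (Or.inl rfl) hp, a1, hubble, e0]
    simp
    field_simp
  case a_ty =>
    rw [pd_pd_coeffA (by decide) (Or.inr rfl) hp, a2, hubble, e0]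
    simp
    field_simp
  case a_tz => rw [pd_pd_coeffA_label 0 hp, a3, mul_zero]
  case b_tx =>
    rw [pd_pd_coeffB (by decide) (Or.inl rfl) hp, b1, hubble, e0, n0]
    simp
    field_simp
  case b_ty =>
    rw [pd_pd_coeffB (by decide) (Or.inr rfl) hp, b2, hubble, e0, n0]
    simp
    field_simp
  case b_xy =>
    rw [pd_pd_coeffB (by decide) (Or.inr rfl) hp, b1, b2, a1, a2, hA, quotGrad, quotGrad]
    simp
    field_simp
    ring
  case a_xz => rw [pd_pd_coeffA_label 1 hp, a3]; simp
  case a_yz => rw [pd_pd_coeffA_label 2 hp, a3]; simp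
  case k_xy =>
    rw [pd_pd_coeffA (by decide) (Or.inr rfl) hp, pd_pd_coeffA (by decide) (Or.inl rfl) hp, a1, a2,
      a3, hA]
    simp
    field_simp
    linear_combination 2 * q1
  case k_xz =>
    rw [hk, pd_pd_coeffB (by decide) (Or.inl rfl) hp, pd_pd_coeffA_label 3 hp, b1, b2, a1, a2, a3,
      hA, hα, quotGrad, quotGrad]
    rw [cons_apply_three]
    simp
    field_simp
    linear_combination (-2 * M.den (Fin.cons t x)) * q2 + (2 * M.num (Fin.cons t x)) * q1
  case k_yz =>
    rw [hk, pd_pd_coeffB (by decide) (Or.inr rfl) hp, pd_pd_coeffA_label 3 hp, b1, b2, a1, a2, a3,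
      hA, hα, quotGrad, quotGrad]
    rw [cons_apply_three]
    simp
    field_simp
    linear_combination (-2 * M.den (Fin.cons t x)) * q2 + (2 * M.num (Fin.cons t x)) * q1

theorem Regular.isSzekeresAt (h : M.Regular t x) : IsSzekeresAt M.metric M.coeffA M.coeffB t x
    (hubble M.S t) (deriv (deriv M.S) t / M.S t)
    (-deriv (M.𝓕 x) t / (M.𝓐 x - M.𝓕 x t)) (-deriv (deriv (M.𝓕 x)) t / (M.𝓐 x - M.𝓕 x t))
    (M.k₀ / M.S t ^ 2) := by
  have hc := h.mem_chart
  refine ⟨?_, (contDiffOn_coeffA.contDiffAt (M.isOpen_chart.mem_nhds hc)).of_le ENat.LEInfty.out,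
    contDiffOn_coeffB.contDiffAt (M.isOpen_chart.mem_nhds hc), h.szekeresJet⟩
  filter_upwards [M.isOpen_chart.eventually_mem hc] with q hq
  have hB : M.coeffB q = M.S (q 0) * M.𝓖 (q 0) (Fin.tail q) := by
    rw [coeffB, 𝓖, 𝓐_eq hq]
    rfl
  have hA : M.coeffA q = M.S (q 0) * M.expNu (Fin.tail q) := by
    rw [expNu_eq]
    rfl
  rw [metric, gwMetric, hA, hB]
  simp only [mul_pow, one_pow, mul_one]

end ClassII
end Szekeres

namespace Szekeres

/-! ### Conclusions for both classes and the class II partner of a class I world line -/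

namespace ClassII

variable {Λ : ℝ} {M : ClassII Λ} {t tᵢ : ℝ} {x : Fin 3 → ℝ}

theorem Regular.isDustSolutionAt (h : M.Regular t x) :
    IsDustSolutionAt Λ M.metric M.density t x :=
  h.isSzekeresAt.isDustSolutionAt_of_mode M.background (isDensityMode_𝓕 x) h.1 h.2.2.2 rfl

theorem Regular.isExactBodyLine (h : M.Regular tᵢ x) :
    IsExactBodyLine Λ M.k₀ M.μ M.T M.L M.S M.metric x tᵢ (M.deformation tᵢ x)
      (M.worldLine tᵢ x) :=
  isExactBodyLine_gwMetric M.background (isDensityMode_𝓕 x) (fun _ => rfl) one_pos h.2.2.1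
    ⟨h.1, h.2.2.2⟩ fun _ ht s hs => ⟨(ht s hs).1, (ht s hs).2.2.2⟩

theorem localQuantities_eq (hi : M.Regular tᵢ x) (h : M.Regular t x) :
    localQuantities M.metric M.density t x
      = exactBodyFunctionals M.k₀ M.S (M.deformation tᵢ x) (M.density tᵢ x) tᵢ t :=
  h.isSzekeresAt.localQuantities_eq_functionals M.background h.1 hi.1 h.2.2.2 hi.2.2.2
    fun _ => rfl

end ClassII

namespace ClassI

variable {Λ : ℝ} {M : ClassI Λ} {t tᵢ : ℝ} {x : Fin 3 → ℝ}

theorem Regular.label_mem (h : M.Regular t x) : x 2 ∈ Prod.snd '' M.Ω := ⟨_, h.1, rfl⟩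

theorem Regular.isDustSolutionAt (h : M.Regular t x) :
    IsDustSolutionAt Λ M.metric M.density t x :=
  h.isSzekeresAt.isDustSolutionAt_of_mode (M.background _ h.label_mem)
    (isDensityMode_𝓕 h.label_mem) h.1 h.2.2.2 rfl

theorem Regular.isExactBodyLine (h : M.Regular tᵢ x) :
    IsExactBodyLine Λ M.k₀ (M.μ (x 2)) (M.T (x 2)) (M.lifeSpan (x 2)) (fun t => M.S t (x 2))
      M.metric x tᵢ (M.deformation tᵢ x) (M.worldLine tᵢ x) :=
  isExactBodyLine_gwMetric (M.background _ h.label_mem) (isDensityMode_𝓕 h.label_mem)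
    (fun _ => rfl) (𝓦_pos h.2.2.1) h.2.1 ⟨h.1, h.2.2.2⟩
    fun _ ht s hs => ⟨(ht s hs).1, (ht s hs).2.2.2⟩

theorem localQuantities_eq (hi : M.Regular tᵢ x) (h : M.Regular t x) :
    localQuantities M.metric M.density t x = exactBodyFunctionals M.k₀ (fun s => M.S s (x 2))
      (M.deformation tᵢ x) (M.density tᵢ x) tᵢ t :=
  h.isSzekeresAt.localQuantities_eq_functionals (M.background _ h.label_mem) h.1 hi.1 h.2.2.2
    hi.2.2.2 fun _ => rfl

theorem existsUnique_worldLine {p : Fin 4 → ℝ} (hp : M.Regular (p 0) (Fin.tail p)) :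
    ∃! x : Fin 3 → ℝ, ∃ t : ℝ, M.Regular t x ∧ worldLineCurve x t = p := by
  refine ⟨Fin.tail p, ⟨p 0, hp, Fin.cons_self_tail p⟩, ?_⟩
  rintro y ⟨t, -, rfl⟩
  rfl

open Classical in
/-- The class II model with the local background of the world lines with label `x`, with constant
functions of `ξ`. -/
noncomputable def partner (M : ClassI Λ) (x : Fin 3 → ℝ) (hx : x 2 ∈ Prod.snd '' M.Ω) :
    ClassII Λ where
  k₀ := M.k₀
  μ := M.μ (x 2)
  T := M.T (x 2)
  L := M.lifeSpan (x 2)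
  X := univ
  S := fun t => M.S t (x 2)
  fPlus := fun t => M.fPlus t (x 2)
  -- At the origin `e^ν = 1` and only `c₀` and `-k₀ β₊` contribute to `𝓐`; this value of `c₀` makes
  -- `𝓐` there equal to the prescribed number.
  c₀ := fun _ => if M.k₀ = 0 then M.𝓐 x else M.𝓐 x + M.k₀ * M.βPlus (x 2)
  c₁ := fun _ => 0
  c₂ := fun _ => 0
  βPlus := fun _ => M.βPlus (x 2)
  βMinus := fun _ => M.βMinus (x 2)
  k₀_mem := M.k₀_mem
  background := M.background _ hx
  growing := M.growing _ hx
  X_open := isOpen_univ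
  c₀_smooth := contDiffOn_const
  c₁_smooth := contDiffOn_const
  c₂_smooth := contDiffOn_const
  βPlus_smooth := contDiffOn_const
  βMinus_smooth := contDiffOn_const

theorem partner_𝓐 (hx : x 2 ∈ Prod.snd '' M.Ω) : (M.partner x hx).𝓐 0 = M.𝓐 x := by
  by_cases h : M.k₀ = 0 <;> simp [ClassII.𝓐, ClassII.expNu, partner, h]

/-- The class I conditions on `e^ν` and `𝓦` do not involve the time, so `hi` supplies them for every
`t`. At the origin of the partner only `t ∈ L` and `𝓖 ≠ 0` are at stake. -/
theorem partner_regular (hi : M.Regular tᵢ x) (t : ℝ) :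
    (M.partner x hi.label_mem).Regular t 0 ↔ M.Regular t x := by
  have h1 : (M.partner x hi.label_mem).expNu 0 = 1 := by simp [ClassII.expNu]
  have h2 : (M.partner x hi.label_mem).𝓖 t 0 = M.𝓖 t x :=
    congrArg (· - M.𝓕 x t) (partner_𝓐 hi.label_mem)
  rw [ClassII.Regular, h1, h2]
  exact ⟨fun h => ⟨h.1, hi.2.1, hi.2.2.1, h.2.2.2⟩, fun h => ⟨h.1, mem_univ _, one_pos, h.2.2.2⟩⟩

theorem partner_deformation (hx : x 2 ∈ Prod.snd '' M.Ω) (tᵢ : ℝ) :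
    (M.partner x hx).deformation tᵢ 0 = M.deformation tᵢ x :=
  congrArg (fun α => gwDeformation α (M.𝓕 x) tᵢ) (partner_𝓐 hx)

theorem partner_density (hx : x 2 ∈ Prod.snd '' M.Ω) (t : ℝ) :
    (M.partner x hx).density t 0 = M.density t x :=
  congrArg (fun α => 6 * M.μ (x 2) * α / (M.S t (x 2) ^ 3 * (α - M.𝓕 x t)) / (8 * Real.pi))
    (partner_𝓐 hx)

/-- The two metrics differ as fields and no curvatures are compared: each side is the same
exact-body functional of the common background, deformation and initial density. -/
theorem partner_localQuantities (hi : M.Regular tᵢ x) (h : M.Regular t x) :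
    localQuantities (M.partner x hi.label_mem).metric (M.partner x hi.label_mem).density t 0
      = localQuantities M.metric M.density t x := by
  rw [localQuantities_eq hi h, ClassII.localQuantities_eq ((partner_regular hi tᵢ).2 hi)
    ((partner_regular hi t).2 h), partner_deformation, partner_density]
  rfl

end ClassI
end Szekeres

theorem mainTheorem8 (Λ : ℝ) :
    -- class II: exact dust solutions, each world line being a solution of the exact body on the
    -- global background, with all local quantities given by the exact-body functionals
    (∀ (N : Szekeres.ClassII Λ) (tᵢ : ℝ) (y : Fin 3 → ℝ), N.Regular tᵢ y →
      Szekeres.IsDustSolutionAt Λ N.metric N.density tᵢ y ∧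
      Szekeres.IsExactBodyLine Λ N.k₀ N.μ N.T N.L N.S N.metric y tᵢ
        (N.deformation tᵢ y) (N.worldLine tᵢ y) ∧
      ∀ t ∈ N.worldLine tᵢ y,
        Szekeres.localQuantities N.metric N.density t y =
          Szekeres.exactBodyFunctionals N.k₀ N.S (N.deformation tᵢ y) (N.density tᵢ y) tᵢ t) ∧
    -- class I
    ∀ M : Szekeres.ClassI Λ,
      -- the superposition is globally consistent with Einstein's equations and their constraints
      (∀ (t : ℝ) (x : Fin 3 → ℝ), M.Regular t x →
        Szekeres.IsDustSolutionAt Λ M.metric M.density t x) ∧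
      -- through every event there is exactly one world line, and it is a timelike geodesic
      (∀ p : Fin 4 → ℝ, M.Regular (p 0) (Fin.tail p) →
        ∃! x : Fin 3 → ℝ, ∃ t : ℝ, M.Regular t x ∧ Szekeres.worldLineCurve x t = p) ∧
      (∀ (t : ℝ) (x : Fin 3 → ℝ), M.Regular t x →
        Szekeres.IsGeodesicAt (Szekeres.spacetimeMetric M.metric) (Szekeres.worldLineCurve x) t ∧
        ∑ a, ∑ b, Szekeres.spacetimeMetric M.metric (Szekeres.worldLineCurve x t) a b
          * deriv (fun s => Szekeres.worldLineCurve x s a) t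
          * deriv (fun s => Szekeres.worldLineCurve x s b) t = -1) ∧
      ∀ (tᵢ : ℝ) (x : Fin 3 → ℝ), M.Regular tᵢ x →
        -- every world line is a solution of the exact body on its own local background
        Szekeres.IsExactBodyLine Λ M.k₀ (M.μ (x 2)) (M.T (x 2)) (M.lifeSpan (x 2))
          (fun t => M.S t (x 2)) M.metric x tᵢ (M.deformation tᵢ x) (M.worldLine tᵢ x) ∧
        Szekeres.IsDensityMode (M.μ (x 2)) (M.lifeSpan (x 2)) (fun t => M.S t (x 2))
          (fun t => M.fPlus t (x 2)) ∧
        Szekeres.IsDensityMode (M.μ (x 2)) (M.lifeSpan (x 2)) (fun t => M.S t (x 2))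
          (fun t => M.fMinus t (x 2)) ∧
        -- it is a world line of a class II model with that background, with the same modes, the
        -- same deformation field and the same local quantities
        (∃ (N : Szekeres.ClassII Λ) (y : Fin 3 → ℝ),
          N.k₀ = M.k₀ ∧ N.μ = M.μ (x 2) ∧ N.T = M.T (x 2) ∧ N.L = M.lifeSpan (x 2) ∧
          N.S = (fun t => M.S t (x 2)) ∧ N.fPlus = (fun t => M.fPlus t (x 2)) ∧
          N.fMinus = (fun t => M.fMinus t (x 2)) ∧
          N.βPlus (y 2) = M.βPlus (x 2) ∧ N.βMinus (y 2) = M.βMinus (x 2) ∧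
          N.𝓐 y = M.𝓐 x ∧ N.𝓕 y = M.𝓕 x ∧
          (∀ t : ℝ, N.Regular t y ↔ M.Regular t x) ∧
          N.deformation tᵢ y = M.deformation tᵢ x ∧
          ∀ t ∈ M.worldLine tᵢ x,
            Szekeres.localQuantities N.metric N.density t y =
              Szekeres.localQuantities M.metric M.density t x) ∧
        -- all local quantities have the same functional expressions as in class II
        ∀ t ∈ M.worldLine tᵢ x,
          Szekeres.localQuantities M.metric M.density t x =
            Szekeres.exactBodyFunctionals M.k₀ (fun s => M.S s (x 2)) (M.deformation tᵢ x)
              (M.density tᵢ x) tᵢ t := by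
  refine ⟨fun N tᵢ y h => ⟨h.isDustSolutionAt, h.isExactBodyLine, fun t ht =>
    Szekeres.ClassII.localQuantities_eq h (ht t right_mem_uIcc)⟩, fun M =>
    ⟨fun t x h => h.isDustSolutionAt, fun p hp => Szekeres.ClassI.existsUnique_worldLine hp,
      fun t x h => ⟨h.isSzekeresAt.isGeodesicAt,
        Szekeres.IsSzekeresAt.spacetimeMetric_worldLineCurve_eq_neg_one⟩,
      fun tᵢ x h => ⟨h.isExactBodyLine, (M.growing _ h.label_mem).1,
        (M.background _ h.label_mem).isDensityMode_hubble, ?_, fun t ht =>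
          Szekeres.ClassI.localQuantities_eq h (ht t right_mem_uIcc)⟩⟩⟩
  -- The world line of the partner is the one through the origin. Background, modes, `β_±` and `𝓕`
  -- agree by construction; only `𝓐` and what depends on it need an argument.
  exact ⟨M.partner x h.label_mem, 0, rfl, rfl, rfl, rfl, rfl, rfl, rfl, rfl, rfl,
    Szekeres.ClassI.partner_𝓐 _, rfl, Szekeres.ClassI.partner_regular h,
    Szekeres.ClassI.partner_deformation _ tᵢ, fun t ht =>
      Szekeres.ClassI.partner_localQuantities h (ht t right_mem_uIcc)⟩
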